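/- A Boolean circuit is a finite DAG whose vertices of positive in-degree are labelled by $\lor$, $\land$ or $\neg$ ($\neg$-vertices having in-degree $1$) and which has a unique sink, the output gate; its vertices of in-degree $0$ are the input gates, and $n$ denotes their number. The size $s$ of a circuit is its number of arcs. It is monotone if it has no $\neg$-vertices. A constant bound $\Delta\ge 2$ on the fan-in (in-degree) of all circuits is fixed. A strong Horn backdoor of a CNF formula $\phi$ is a set $B$ of variables such that, for every truth assignment to $B$, the formula obtained from $\phi$ by deleting the satisfied clauses and removing the falsified literals is Horn, that is, each of its clauses contains at most one positive literal. The size $|\phi|$ is the number of variables plus the number of clauses plus the total length of the clauses. Algorithms are programs of a unit-cost random access machine on natural numbers with addition, truncated subtraction and halving, time is its number of steps, and $X^{O(1)}$ stands for a polynomial in $X$. Then the following four statements are equivalent. 1. (Circuit-SETH is false) There exist $\varepsilon>0$ (with $\varepsilon<2$) and an algorithm that takes as input a Boolean circuit of size $s$ on $n$ inputs and decides whether the circuit is satisfiable in time $(2-\varepsilon)^n s^{O(1)}$. 2. (HornB-SETH is false) There exist $\varepsilon>0$ (with $\varepsilon<2$) and an algorithm that takes as input a CNF formula $\phi$ together with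 a strong Horn backdoor of $\phi$ of size $b$ and decides whether $\phi$ is satisfiable in time $(2-\varepsilon)^b|\phi|^{O(1)}$. 3. (W[P]-SETH is false, weak version) There exist $\varepsilon>0$, an integer $k_0>0$ and an algorithm that, for all integers $k>k_0$, takes as input $k$ and a monotone Boolean circuit of size $s$ and decides whether the circuit can be satisfied by setting at most $k$ of its inputs to True in time $O(s^{(1-\varepsilon)k})$, where the implied constant does not depend on $k$ (and $s$ is replaced by $1$ for the circuit with a single vertex, which has $s=0$). 4. (W[P]-SETH is false, strong version) There exist $\varepsilon>0$ and an algorithm that takes as input a Boolean circuit of size $s$ on $n$ inputs and an integer $k\ge 0$ and decides whether the circuit can be satisfied by setting exactly $k$ of its inputs to True in time $n^{(1-\varepsilon)k}s^{O(1)}$. -/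

import Mathlib

/-! ### Random access machines

Algorithms are programs of a unit-cost random access machine over natural numbers. A program uses
finitely many integer variables and finitely many one-dimensional arrays (both named by natural
numbers), and is built from elementary instructions (constants, addition, truncated subtraction,
halving, indirect reads and writes) by sequencing, branching and loops. There is no multiplication.
Every elementary instruction and every evaluation of a branch or loop condition costs one step. -/

namespace RAM

/-- Programs of the machine. -/
inductive Cmd : Type
  /-- do nothing -/
  | nop : Cmd
  /-- `x := c` -/
  | const (x c : ℕ) : Cmd
  /-- `x := y + z` -/
  | add (x y z : ℕ) : Cmd
  /-- `x := max (y - z) 0` -/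
  | sub (x y z : ℕ) : Cmd
  /-- `x := ⌊y / 2⌋` -/
  | half (x y : ℕ) : Cmd
  /-- `x := A_a[y]` -/
  | load (x a y : ℕ) : Cmd
  /-- `A_a[x] := y` -/
  | store (a x y : ℕ) : Cmd
  /-- first `p`, then `q` -/
  | seq (p q : Cmd) : Cmd
  /-- if `x ≠ 0` then `p` else `q` -/
  | branch (x : ℕ) (p q : Cmd) : Cmd
  /-- while `x ≠ 0` do `p` -/
  | loop (x : ℕ) (p : Cmd) : Cmd

/-- Memory contents: the values of the variables and of the array cells. -/
structure State : Type where
  var : ℕ → ℕ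
  arr : ℕ → ℕ → ℕ

/-- Set the variable `x` to `n`. -/
def State.setVar (σ : State) (x n : ℕ) : State :=
  { σ with var := Function.update σ.var x n }

/-- Set the cell `i` of the array `a` to `n`. -/
def State.setCell (σ : State) (a i n : ℕ) : State :=
  { σ with arr := Function.update σ.arr a (Function.update (σ.arr a) i n) }

/-- `Exec p σ t σ'`: started on the memory `σ`, the program `p` halts after exactly `t` steps
with the memory `σ'`. -/
inductive Exec : Cmd → State → ℕ → State → Prop
  | nop (σ : State) : Exec .nop σ 1 σ
  | const (σ : State) (x c : ℕ) : Exec (.const x c) σ 1 (σ.setVar x c)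
  | add (σ : State) (x y z : ℕ) : Exec (.add x y z) σ 1 (σ.setVar x (σ.var y + σ.var z))
  | sub (σ : State) (x y z : ℕ) : Exec (.sub x y z) σ 1 (σ.setVar x (σ.var y - σ.var z))
  | half (σ : State) (x y : ℕ) : Exec (.half x y) σ 1 (σ.setVar x (σ.var y / 2))
  | load (σ : State) (x a y : ℕ) : Exec (.load x a y) σ 1 (σ.setVar x (σ.arr a (σ.var y)))
  | store (σ : State) (a x y : ℕ) : Exec (.store a x y) σ 1 (σ.setCell a (σ.var x) (σ.var y))
  | seq {p q : Cmd} {σ σ' σ'' : State} {t t' : ℕ} (hp : Exec p σ t σ') (hq : Exec q σ' t' σ'') :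
      Exec (.seq p q) σ (t + t') σ''
  | branch_true {x : ℕ} {p q : Cmd} {σ σ' : State} {t : ℕ} (hx : σ.var x ≠ 0)
      (hp : Exec p σ t σ') : Exec (.branch x p q) σ (1 + t) σ'
  | branch_false {x : ℕ} {p q : Cmd} {σ σ' : State} {t : ℕ} (hx : σ.var x = 0)
      (hq : Exec q σ t σ') : Exec (.branch x p q) σ (1 + t) σ'
  | loop_stop {x : ℕ} {p : Cmd} {σ : State} (hx : σ.var x = 0) : Exec (.loop x p) σ 1 σ
  | loop_next {x : ℕ} {p : Cmd} {σ σ' σ'' : State} {t t' : ℕ} (hx : σ.var x ≠ 0)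
      (hp : Exec p σ t σ') (hl : Exec (.loop x p) σ' t' σ'') :
      Exec (.loop x p) σ (1 + t + t') σ''

/-- Computations are deterministic. -/
theorem Exec.unique {p : Cmd} {σ σ₁ σ₂ : State} {t₁ t₂ : ℕ}
    (h₁ : Exec p σ t₁ σ₁) (h₂ : Exec p σ t₂ σ₂) : t₁ = t₂ ∧ σ₁ = σ₂ := by
  induction h₁ generalizing t₂ σ₂ with
  | nop | const | add | sub | half | load | store => cases h₂; exact ⟨rfl, rfl⟩
  | seq _ _ ihp ihq =>
    cases h₂ with
    | seq hp hq =>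
      obtain ⟨rfl, rfl⟩ := ihp hp
      obtain ⟨rfl, rfl⟩ := ihq hq
      exact ⟨rfl, rfl⟩
  | branch_true hx _ ih =>
    cases h₂ with
    | branch_true _ hp => obtain ⟨rfl, rfl⟩ := ih hp; exact ⟨rfl, rfl⟩
    | branch_false hx' _ => exact absurd hx' hx
  | branch_false hx _ ih =>
    cases h₂ with
    | branch_true hx' _ => exact absurd hx hx'
    | branch_false _ hp => obtain ⟨rfl, rfl⟩ := ih hp; exact ⟨rfl, rfl⟩
  | loop_stop hx =>
    cases h₂ with
    | loop_stop => exact ⟨rfl, rfl⟩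
    | loop_next hx' => exact absurd hx hx'
  | loop_next hx _ _ ihp ihl =>
    cases h₂ with
    | loop_stop hx' => exact absurd hx' hx
    | loop_next _ hp hl =>
      obtain ⟨rfl, rfl⟩ := ihp hp
      obtain ⟨rfl, rfl⟩ := ihl hl
      exact ⟨rfl, rfl⟩

/-- The initial memory on the input word `w`: array `0` holds `w`, variable `0` holds the length
of `w`, and everything else is zero. -/
def initial (w : List ℕ) : State where
  var x := if x = 0 then w.length else 0
  arr a i := if a = 0 then w.getD i 0 else 0

/-- On the input word `w` the program `P` halts within `bound` steps, and it accepts (ends with a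
nonzero value in variable `0`) if and only if `yes` holds. -/
def DecidesWithin (P : Cmd) (w : List ℕ) (yes : Prop) (bound : ℝ) : Prop :=
  ∃ (t : ℕ) (σ : State), Exec P (initial w) t σ ∧ (σ.var 0 ≠ 0 ↔ yes) ∧ (t : ℝ) ≤ bound

end RAM

/-! ### Boolean circuits -/

/-- A vertex of a circuit, with the list of its in-neighbours. -/
inductive Gate : Type
  | input : Gate
  | and (l : List ℕ) : Gate
  | or (l : List ℕ) : Gate
  | not (j : ℕ) : Gate
  deriving DecidableEq

namespace Gate

/-- The in-neighbours of a vertex. -/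
def preds : Gate → List ℕ
  | input => []
  | and l => l
  | or l => l
  | not j => [j]

/-- The vertex computes `b` when the values of its in-neighbours are given by `v` (an input gate
takes the value `a`). -/
def Computes (a : Bool) (v : ℕ → Bool) (b : Bool) : Gate → Prop
  | input => b = a
  | and l => b = l.all v
  | or l => b = l.any v
  | not j => b = !(v j)

def tag : Gate → ℕ
  | input => 0
  | and _ => 1
  | or _ => 2
  | not _ => 3

def encode (g : Gate) : List ℕ := g.tag :: g.preds.length :: g.preds

end Gate

/-- `GateArc gates j i`: there is an arc from vertex `j` to vertex `i`. -/
def GateArc (gates : List Gate) (j i : ℕ) : Prop :=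
  ∃ g, gates[i]? = some g ∧ j ∈ g.preds

/-- A Boolean circuit: a DAG on the vertices `0, …, gates.length - 1` (in any order), whose vertices
of positive in-degree are labelled by `∧`, `∨`, `¬`, and which has a unique sink `out`. The vertices
of in-degree zero are the input gates. -/
structure Circuit : Type where
  gates : List Gate
  out : ℕ
  preds_lt : ∀ g ∈ gates, ∀ j ∈ g.preds, j < gates.length
  preds_nodup : ∀ g ∈ gates, g.preds.Nodup
  preds_ne_nil : ∀ g ∈ gates, g ≠ Gate.input → g.preds ≠ []
  acyclic : ∀ i, ¬ Relation.TransGen (GateArc gates) i i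
  out_lt : out < gates.length
  sink_iff : ∀ i < gates.length, (∀ j, ¬ GateArc gates i j) ↔ i = out

namespace Circuit

/-- The input gates. -/
def inputs (C : Circuit) : Finset ℕ :=
  (Finset.range C.gates.length).filter fun i => C.gates[i]? = some Gate.input

/-- The number `n` of inputs. -/
def numInputs (C : Circuit) : ℕ := C.inputs.card

/-- The size `s` of a circuit is its number of arcs. -/
def size (C : Circuit) : ℕ := (C.gates.map fun g => g.preds.length).sum

def FanInAtMost (C : Circuit) (Δ : ℕ) : Prop := ∀ g ∈ C.gates, g.preds.length ≤ Δ

/-- A circuit is monotone if it has no negation gates. -/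
def IsMonotone (C : Circuit) : Prop := ∀ g ∈ C.gates, ∀ j, g ≠ Gate.not j

/-- `v` assigns to each vertex the value that it takes under the assignment `x` to the inputs. -/
def IsValuation (C : Circuit) (x v : ℕ → Bool) : Prop :=
  ∀ (i : ℕ) (g : Gate), C.gates[i]? = some g → g.Computes (x i) v (v i)

theorem lt_of_arc {C : Circuit} {j i : ℕ} (h : GateArc C.gates j i) :
    j < C.gates.length ∧ i < C.gates.length := by
  obtain ⟨g, hg, hj⟩ := h
  exact ⟨C.preds_lt g (List.mem_of_getElem? hg) j hj, (List.getElem?_eq_some_iff.1 hg).1⟩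

theorem wellFounded_arc (C : Circuit) : WellFounded (GateArc C.gates) := by
  have hlt : ∀ {j i}, Relation.TransGen (GateArc C.gates) j i → j < C.gates.length := by
    intro j i h
    induction h using Relation.TransGen.head_induction_on with
    | single h => exact (lt_of_arc h).1
    | head h _ _ => exact (lt_of_arc h).1
  let r : Fin C.gates.length → Fin C.gates.length → Prop :=
    fun a b => Relation.TransGen (GateArc C.gates) a b
  have : IsTrans _ r := ⟨fun _ _ _ h h' => Relation.TransGen.trans h h'⟩
  have : Std.Irrefl r := ⟨fun a => C.acyclic a⟩
  have hr : WellFounded r := Finite.wellFounded_of_trans_of_irrefl r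
  have key : ∀ a : Fin C.gates.length, Acc (GateArc C.gates) (a : ℕ) := by
    intro a
    induction a using hr.induction with
    | _ a ih =>
      refine Acc.intro _ fun j hj => ?_
      exact ih ⟨j, (lt_of_arc hj).1⟩ (Relation.TransGen.single hj)
  refine ⟨fun i => Acc.intro _ fun j hj => key ⟨j, (lt_of_arc hj).1⟩⟩

/-- Every assignment to the inputs determines the values of all vertices. -/
theorem exists_isValuation (C : Circuit) (x : ℕ → Bool) : ∃ v, C.IsValuation x v := by
  classical
  let F : (i : ℕ) → ((j : ℕ) → GateArc C.gates j i → Bool) → Bool := fun i f =>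
    let w : ℕ → Bool := fun j => if h : GateArc C.gates j i then f j h else false
    match C.gates[i]? with
    | none => false
    | some Gate.input => x i
    | some (Gate.and l) => l.all w
    | some (Gate.or l) => l.any w
    | some (Gate.not j) => !(w j)
  refine ⟨C.wellFounded_arc.fix F, ?_⟩
  intro i g hg
  have hfix := C.wellFounded_arc.fix_eq F i
  have hw : ∀ j ∈ g.preds, GateArc C.gates j i := fun j hj => ⟨g, hg, hj⟩
  rw [hfix]
  cases g with
  | input => simp [F, hg, Gate.Computes]
  | not j =>
    have := hw j (by simp [Gate.preds])
    simp [F, hg, Gate.Computes, this]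
  | and l =>
    simp only [F, hg, Gate.Computes]
    rw [Bool.eq_iff_iff, List.all_eq_true, List.all_eq_true]
    refine forall₂_congr fun j hj => ?_
    rw [dif_pos (hw j hj)]
  | or l =>
    simp only [F, hg, Gate.Computes]
    rw [Bool.eq_iff_iff, List.any_eq_true, List.any_eq_true]
    refine exists_congr fun j => and_congr_right fun hj => ?_
    rw [dif_pos (hw j hj)]

theorem isValuation_unique {C : Circuit} {x v w : ℕ → Bool} (hv : C.IsValuation x v)
    (hw : C.IsValuation x w) {i : ℕ} (hi : i < C.gates.length) : v i = w i := by
  induction i using C.wellFounded_arc.induction with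
  | _ i ih =>
    have hg := List.getElem?_eq_getElem hi
    have ih' : ∀ j ∈ (C.gates[i]).preds, v j = w j := fun j hj =>
      ih j ⟨_, hg, hj⟩ (lt_of_arc ⟨_, hg, hj⟩).1
    have h1 := hv i _ hg
    have h2 := hw i _ hg
    generalize C.gates[i] = g at ih' h1 h2
    cases g with
    | input => exact h1.trans h2.symm
    | not j => rw [h1, h2, ih' j (by simp [Gate.preds])]
    | and l =>
      rw [h1, h2, Bool.eq_iff_iff, List.all_eq_true, List.all_eq_true]
      exact forall₂_congr fun j hj => by rw [ih' j hj]
    | or l =>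
      rw [h1, h2, Bool.eq_iff_iff, List.any_eq_true, List.any_eq_true]
      exact exists_congr fun j => and_congr_right fun hj => by rw [ih' j hj]

/-- The output gate evaluates to True under the assignment `x` to the inputs. -/
def Accepts (C : Circuit) (x : ℕ → Bool) : Prop :=
  ∃ v, C.IsValuation x v ∧ v C.out = true

/-- The number of inputs that the assignment `x` sets to True. -/
def weight (C : Circuit) (x : ℕ → Bool) : ℕ := (C.inputs.filter fun i => x i = true).card

def Satisfiable (C : Circuit) : Prop := ∃ x, C.Accepts x

/-- The circuit as an input word: output gate, number of vertices, and then for each vertex its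
label, its in-degree and its in-neighbours. -/
def encode (C : Circuit) : List ℕ :=
  C.out :: C.gates.length :: C.gates.flatMap Gate.encode

end Circuit

/-! ### CNF formulas and Horn backdoors -/

/-- A literal: a variable with a sign (`true` for a positive literal). -/
abbrev Literal : Type := ℕ × Bool

/-- A clause, as the list of its literals. -/
abbrev Clause : Type := List Literal

/-- A CNF formula on the variables `0, …, numVars - 1`. -/
structure CNF : Type where
  numVars : ℕ
  clauses : List Clause
  var_lt : ∀ c ∈ clauses, ∀ l ∈ c, l.1 < numVars

namespace CNF

/-- The size `|φ|`: number of variables, plus number of clauses, plus total length of clauses. -/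
def size (φ : CNF) : ℕ := φ.numVars + φ.clauses.length + (φ.clauses.map List.length).sum

def Satisfiable (φ : CNF) : Prop :=
  ∃ τ : ℕ → Bool, ∀ c ∈ φ.clauses, ∃ l ∈ c, τ l.1 = l.2

/-- The formula obtained by assigning the variables of `B` according to `τ`: clauses with a
satisfied literal are dropped, and falsified literals are deleted from the others. -/
def restrict (φ : CNF) (B : List ℕ) (τ : ℕ → Bool) : List Clause :=
  (φ.clauses.filter fun c => ∀ l ∈ c, ¬ (l.1 ∈ B ∧ τ l.1 = l.2)).map fun c =>
    c.filter fun l => l.1 ∉ B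

/-- Each clause contains at most one positive literal. -/
def IsHorn (cs : List Clause) : Prop :=
  ∀ c ∈ cs, ∀ x y : ℕ, (x, true) ∈ c → (y, true) ∈ c → x = y

/-- `B` lists a set of variables such that every assignment to them leaves a Horn formula. -/
def IsStrongHornBackdoor (φ : CNF) (B : List ℕ) : Prop :=
  B.Nodup ∧ (∀ x ∈ B, x < φ.numVars) ∧ ∀ τ : ℕ → Bool, IsHorn (φ.restrict B τ)

/-- The formula as an input word: number of variables, number of clauses, and then for each clause
its length and its literals. -/
def encode (φ : CNF) : List ℕ :=
  φ.numVars :: φ.clauses.length ::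
    φ.clauses.flatMap fun c => c.length :: c.flatMap fun l => [l.1, l.2.toNat]

/-- A formula together with a set of variables as an input word. -/
def encodeWith (φ : CNF) (B : List ℕ) : List ℕ := B.length :: (B ++ φ.encode)

end CNF

/-! ### The four hypotheses, negated

A factor `s^{O(1)}` is a polynomial in `s`. Circuits have fan-in at most the constant `Δ`. -/

/-- Satisfiability of circuits with `n` inputs and size `s` in time `(2 - ε)^n s^{O(1)}`. -/
def CircuitSETHFails (Δ : ℕ) : Prop :=
  ∃ ε : ℝ, 0 < ε ∧ ε < 2 ∧ ∃ (P : RAM.Cmd) (p : Polynomial ℕ),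
    ∀ C : Circuit, C.FanInAtMost Δ →
      RAM.DecidesWithin P C.encode C.Satisfiable
        ((2 - ε) ^ C.numInputs * ((p.eval C.size : ℕ) : ℝ))

/-- SAT with a given strong Horn backdoor of size `b` in time `(2 - ε)^b |φ|^{O(1)}`. -/
def HornBackdoorSETHFails : Prop :=
  ∃ ε : ℝ, 0 < ε ∧ ε < 2 ∧ ∃ (P : RAM.Cmd) (p : Polynomial ℕ),
    ∀ (φ : CNF) (B : List ℕ), φ.IsStrongHornBackdoor B →
      RAM.DecidesWithin P (φ.encodeWith B) φ.Satisfiable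
        ((2 - ε) ^ B.length * ((p.eval φ.size : ℕ) : ℝ))

/-- Satisfiability of monotone circuits by at most `k` true inputs in time `O(s^{(1 - ε) k})`, for
all `k > k₀`. The maximum only matters for the circuit with a single vertex, which has no arcs. -/
def WeakWPSETHFails (Δ : ℕ) : Prop :=
  ∃ (ε : ℝ) (k₀ : ℕ), 0 < ε ∧ 0 < k₀ ∧ ∃ (P : RAM.Cmd) (A : ℝ),
    ∀ k : ℕ, k₀ < k → ∀ C : Circuit, C.FanInAtMost Δ → C.IsMonotone →
      RAM.DecidesWithin P (k :: C.encode) (∃ x, C.Accepts x ∧ C.weight x ≤ k)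
        (A * ((max C.size 1 : ℕ) : ℝ) ^ ((1 - ε) * (k : ℝ)))

/-- Satisfiability of circuits by exactly `k` true inputs in time `n^{(1 - ε) k} s^{O(1)}`. -/
def StrongWPSETHFails (Δ : ℕ) : Prop :=
  ∃ ε : ℝ, 0 < ε ∧ ∃ (P : RAM.Cmd) (p : Polynomial ℕ),
    ∀ (k : ℕ) (C : Circuit), C.FanInAtMost Δ →
      RAM.DecidesWithin P (k :: C.encode) (∃ x, C.Accepts x ∧ C.weight x = k)
        ((C.numInputs : ℝ) ^ ((1 - ε) * (k : ℝ)) * ((p.eval C.size : ℕ) : ℝ))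

/-! The satisfiability problem with a Horn backdoor is the hub: statement 2 is equivalent to
statement 1 directly, and to the other two through the cycle 2 → 4 → 3 → 2.

Once the backdoor is assigned, the rest of the formula is Horn and unit propagation decides it.
Propagation is a straight-line program of polynomial length (`CNF.hornCode`, correct by
`CNF.run_hornCode`), and such a program unfolds into a circuit (`RegProg.toCircuit`). With one input
per backdoor variable this gives 1 → 2 (`CNF.negProg_satisfiable`). Conversely, if every vertex of a
circuit has one variable for "is true" and another for "is false", then all rules of evaluation are
Horn clauses. Only the guess of the inputs is not, and the `n` guess variables form a backdoor; this
is 2 → 1 (`Circuit.guessFormula_satisfiable`).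

Guessing the names of `k` true inputs costs only `k * ⌈log₂ n⌉` backdoor variables, and a power of a
base below 2 with this exponent is essentially `n ^ ((1 - δ) * k)`; this is 2 → 4
(`Circuit.chooseFormula_satisfiable`, `exists_pow_clog_le`). For 4 → 3, more true inputs never hurt
a monotone circuit, so "at most `k`" becomes "exactly `min k n`"
(`Circuit.IsMonotone.exists_weight_eq_iff`), and for large `k` a factor `s ^ e` is absorbed into a
slightly larger exponent.

For 3 → 2 the backdoor is cut into `k` groups of about `b / k` variables, with `D ≈ 2 ^ (b / k)`
inputs per group, one for each assignment to it. Propagation needs no negation if both literals of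
each backdoor variable are supplied, so the circuit is monotone. A check that every group has a true
input, together with weight at most `k`, leaves exactly one true input per group
(`CNF.groupProg_satisfiable`). The circuit size is `D` times a polynomial, so `s ^ ((1 - ε) * k)` is
about `2 ^ ((1 - ε) * b)`. The reduction itself takes time `D ^ O(1)`, which is harmless when `k` is
large compared with that exponent. The exponent must therefore be known before `k` is chosen, which
is why `exists_reduction` provides the overhead before the program and `k`.

That the reductions run fast on the machine follows from closure properties: `Comp`, `CompL` and
their variants are closed under arithmetic, branching and bounded recursion (`Comp.natRec`,
`CompL.flatMap`), and concrete machine code is confined to a few basic lemmas. -/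

/-! ### Polynomial bounds -/

/-- `g` is bounded by a polynomial in `m`. -/
def PolyLE {X : Type} (m g : X → ℕ) : Prop := ∃ c e : ℕ, ∀ x, g x ≤ c * (m x + 1) ^ e

namespace PolyLE

variable {X Y : Type} {m g h : X → ℕ}

theorem mono (hg : PolyLE m g) (hle : ∀ x, h x ≤ g x) : PolyLE m h := by
  obtain ⟨c, e, hc⟩ := hg
  exact ⟨c, e, fun x => (hle x).trans (hc x)⟩

theorem const (c : ℕ) : PolyLE m (fun _ => c) := ⟨c, 0, fun x => by simp⟩

theorem self : PolyLE m m := ⟨1, 1, fun x => by simp⟩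

theorem of_le (h : ∀ x, g x ≤ m x) : PolyLE m g := self.mono h

theorem add (hg : PolyLE m g) (hh : PolyLE m h) : PolyLE m (fun x => g x + h x) := by
  obtain ⟨c, e, hc⟩ := hg
  obtain ⟨d, f, hd⟩ := hh
  refine ⟨c + d, e + f, fun x => ?_⟩
  have h1 : (m x + 1) ^ e ≤ (m x + 1) ^ (e + f) := Nat.pow_le_pow_right (by omega) (by omega)
  have h2 : (m x + 1) ^ f ≤ (m x + 1) ^ (e + f) := Nat.pow_le_pow_right (by omega) (by omega)
  calc g x + h x ≤ c * (m x + 1) ^ e + d * (m x + 1) ^ f := add_le_add (hc x) (hd x)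
    _ ≤ c * (m x + 1) ^ (e + f) + d * (m x + 1) ^ (e + f) := by gcongr
    _ = _ := by ring

theorem mul (hg : PolyLE m g) (hh : PolyLE m h) : PolyLE m (fun x => g x * h x) := by
  obtain ⟨c, e, hc⟩ := hg
  obtain ⟨d, f, hd⟩ := hh
  refine ⟨c * d, e + f, fun x => ?_⟩
  calc g x * h x ≤ (c * (m x + 1) ^ e) * (d * (m x + 1) ^ f) := Nat.mul_le_mul (hc x) (hd x)
    _ = _ := by ring

theorem pow (hg : PolyLE m g) (k : ℕ) : PolyLE m (fun x => g x ^ k) := by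
  induction k with
  | zero => exact (const 1).mono fun x => by simp
  | succ k ih => exact (ih.mul hg).mono fun x => by rw [pow_succ]

theorem comp (hg : PolyLE m g) (f : Y → X) : PolyLE (fun y => m (f y)) (fun y => g (f y)) := by
  obtain ⟨c, e, hc⟩ := hg
  exact ⟨c, e, fun y => hc (f y)⟩

theorem trans (hg : PolyLE m g) (hh : PolyLE g h) : PolyLE m h := by
  obtain ⟨d, f, hd⟩ := hh
  exact ((const d).mul ((hg.add (const 1)).pow f)).mono hd

theorem eval (p : Polynomial ℕ) (hg : PolyLE m g) : PolyLE m (fun x => p.eval (g x)) := by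
  induction p using Polynomial.induction_on' with
  | add p q hp hq => exact (hp.add hq).mono fun x => by simp
  | monomial n a => exact ((const a).mul (hg.pow n)).mono fun x => by simp

end PolyLE

namespace RAM

/-! ### Facts about executions -/

/-- A bound for the variables that a program uses. -/
def Cmd.varBound : Cmd → ℕ
  | .nop => 0
  | .const x _ => x + 1
  | .add x _ _ => x + 1
  | .sub x _ _ => x + 1
  | .half x _ => x + 1
  | .load x _ _ => x + 1
  | .store _ _ _ => 0
  | .seq p q => max p.varBound q.varBound
  | .branch _ p q => max p.varBound q.varBound
  | .loop _ p => p.varBound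

@[simp] theorem State.setVar_var (σ : State) (x n y : ℕ) :
    (σ.setVar x n).var y = if y = x then n else σ.var y := by
  simp [State.setVar, Function.update_apply]

@[simp] theorem State.setVar_arr (σ : State) (x n : ℕ) : (σ.setVar x n).arr = σ.arr := rfl

@[simp] theorem State.setCell_var (σ : State) (a i n : ℕ) : (σ.setCell a i n).var = σ.var := rfl

theorem State.setCell_arr (σ : State) (a i n b j : ℕ) :
    (σ.setCell a i n).arr b j = if b = a ∧ j = i then n else σ.arr b j := by
  by_cases h : b = a
  · subst h; simp [State.setCell, Function.update_apply]
  · simp [State.setCell, h]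

/-- `varBound` counts only the variables that are written. The variables above it still have their
initial value 0, so a second program can be run there as if on fresh memory. -/
theorem Exec.var_eq {p : Cmd} {σ σ' : State} {t : ℕ} (h : Exec p σ t σ') :
    ∀ x, p.varBound ≤ x → σ'.var x = σ.var x := by
  induction h with
  | nop => intros; rfl
  | const | add | sub | half | load =>
    intro x hx
    simp only [Cmd.varBound] at hx
    rw [State.setVar_var, if_neg (by omega)]
  | store => intros; rfl
  | seq _ _ ihp ihq =>
    intro x hx
    simp only [Cmd.varBound] at hx
    rw [ihq x (by omega), ihp x (by omega)]
  | branch_true _ _ ih | branch_false _ _ ih =>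
    intro x hx
    simp only [Cmd.varBound] at hx
    exact ih x (by omega)
  | loop_stop => intros; rfl
  | loop_next _ _ _ ihp ihl =>
    intro x hx
    rw [ihl x hx, ihp x (by simpa [Cmd.varBound] using hx)]

/-- Rename the variables and the arrays of a program. -/
def Cmd.rename (f g : ℕ → ℕ) : Cmd → Cmd
  | .nop => .nop
  | .const x c => .const (f x) c
  | .add x y z => .add (f x) (f y) (f z)
  | .sub x y z => .sub (f x) (f y) (f z)
  | .half x y => .half (f x) (f y)
  | .load x a y => .load (f x) (g a) (f y)
  | .store a x y => .store (g a) (f x) (f y)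
  | .seq p q => .seq (p.rename f g) (q.rename f g)
  | .branch x p q => .branch (f x) (p.rename f g) (q.rename f g)
  | .loop x p => .loop (f x) (p.rename f g)

/-- The memory `τ` contains a renamed copy of the memory `σ`. -/
def Embeds (f g : ℕ → ℕ) (σ τ : State) : Prop :=
  (∀ x, τ.var (f x) = σ.var x) ∧ ∀ a i, τ.arr (g a) i = σ.arr a i

theorem Embeds.setVar {f g : ℕ → ℕ} (hf : f.Injective) {σ τ : State} (h : Embeds f g σ τ)
    (x : ℕ) {m n : ℕ} (hn : m = n) : Embeds f g (σ.setVar x m) (τ.setVar (f x) n) := by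
  refine ⟨fun y => ?_, h.2⟩
  simp only [State.setVar_var, hf.eq_iff, h.1, hn]

/-- A step-by-step simulation with the same running time; injectivity keeps distinct variables and
arrays from being merged. -/
theorem Exec.rename {f g : ℕ → ℕ} (hf : f.Injective) (hg : g.Injective) {p : Cmd}
    {σ σ' : State} {t : ℕ} (h : Exec p σ t σ') :
    ∀ τ, Embeds f g σ τ → ∃ τ', Exec (p.rename f g) τ t τ' ∧ Embeds f g σ' τ' := by
  induction h with
  | nop => exact fun τ hτ => ⟨τ, .nop τ, hτ⟩
  | const σ x c => exact fun τ hτ => ⟨_, .const _ _ _, hτ.setVar hf x rfl⟩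
  | add σ x y z => exact fun τ hτ => ⟨_, .add _ _ _ _, hτ.setVar hf x (by rw [hτ.1, hτ.1])⟩
  | sub σ x y z => exact fun τ hτ => ⟨_, .sub _ _ _ _, hτ.setVar hf x (by rw [hτ.1, hτ.1])⟩
  | half σ x y => exact fun τ hτ => ⟨_, .half _ _ _, hτ.setVar hf x (by rw [hτ.1])⟩
  | load σ x a y => exact fun τ hτ => ⟨_, .load _ _ _ _, hτ.setVar hf x (by rw [hτ.1, hτ.2])⟩
  | store σ a x y =>
    refine fun τ hτ => ⟨_, .store _ _ _ _, hτ.1, fun b i => ?_⟩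
    simp only [State.setCell_arr, hg.eq_iff, hτ.1, hτ.2]
  | seq _ _ ihp ihq =>
    intro τ hτ
    obtain ⟨τ₁, h₁, e₁⟩ := ihp τ hτ
    obtain ⟨τ₂, h₂, e₂⟩ := ihq τ₁ e₁
    exact ⟨τ₂, .seq h₁ h₂, e₂⟩
  | branch_true hx _ ih =>
    intro τ hτ
    obtain ⟨τ₁, h₁, e₁⟩ := ih τ hτ
    exact ⟨τ₁, .branch_true (by rwa [hτ.1]) h₁, e₁⟩
  | branch_false hx _ ih =>
    intro τ hτ
    obtain ⟨τ₁, h₁, e₁⟩ := ih τ hτ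
    exact ⟨τ₁, .branch_false (by rwa [hτ.1]) h₁, e₁⟩
  | loop_stop hx => exact fun τ hτ => ⟨τ, Exec.loop_stop (by rwa [hτ.1]), hτ⟩
  | loop_next hx _ _ ihp ihl =>
    intro τ hτ
    obtain ⟨τ₁, h₁, e₁⟩ := ihp τ hτ
    obtain ⟨τ₂, h₂, e₂⟩ := ihl τ₁ e₁
    exact ⟨τ₂, .loop_next (by rwa [hτ.1]) h₁ h₂, e₂⟩

/-- The invariant is indexed by the number of remaining rounds, so it doubles as the termination
measure. Each round costs at most `B` plus one test of the condition. -/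
theorem exec_loop {x : ℕ} {p : Cmd} (I : ℕ → State → Prop) (B : ℕ)
    (hstep : ∀ m σ, I (m + 1) σ → σ.var x ≠ 0 ∧ ∃ t σ', Exec p σ t σ' ∧ I m σ' ∧ t ≤ B)
    (hzero : ∀ σ, I 0 σ → σ.var x = 0) :
    ∀ m σ, I m σ → ∃ t σ', Exec (.loop x p) σ t σ' ∧ I 0 σ' ∧ t ≤ 1 + m * (B + 1) := by
  intro m
  induction m with
  | zero => exact fun σ h => ⟨1, σ, Exec.loop_stop (hzero σ h), h, by omega⟩
  | succ m ih =>
    intro σ h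
    obtain ⟨hx, t, σ₁, h₁, i₁, ht⟩ := hstep m σ h
    obtain ⟨t', σ₂, h₂, i₂, ht'⟩ := ih σ₁ i₁
    refine ⟨_, σ₂, .loop_next hx h₁ h₂, i₂, ?_⟩
    calc 1 + t + t' ≤ 1 + B + (1 + m * (B + 1)) := by omega
      _ = _ := by ring

/-! ### Functions that are computable in polynomial time

The functions are defined on a context: a type whose elements are described by an input word and
by the values of finitely many variables. Contexts are extended by loop variables. -/

class Ctx (Γ : Type) where
  word : Γ → List ℕ
  size : Γ → ℕ
  vars : ℕ
  slot : ℕ → Γ → ℕ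

/-- The loop variable does not enter the size. Hence time bounds in an extended context are uniform
in the value of that variable, even for values that never occur. This is why loop variables are
later clamped by `min` before they bound a loop themselves. -/
instance Ctx.extend {Γ : Type} [Ctx Γ] : Ctx (Γ × ℕ) where
  word p := Ctx.word p.1
  size p := Ctx.size p.1
  vars := Ctx.vars Γ + 1
  slot i p := if i = Ctx.vars Γ then p.2 else Ctx.slot i p.1

variable {Γ : Type} [Ctx Γ]

abbrev PolyBdd (g : Γ → ℕ) : Prop := PolyLE (Ctx.size (Γ := Γ)) g

theorem PolyBdd.fst {g : Γ → ℕ} (h : PolyBdd g) : PolyBdd (fun p : Γ × ℕ => g p.1) :=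
  PolyLE.comp h Prod.fst

/-- The memory `σ` describes `γ`, where the variables are placed according to `ρ`. -/
structure Holds (γ : Γ) (ρ : ℕ → ℕ) (σ : State) : Prop where
  word : ∀ i, σ.arr 0 i = (Ctx.word γ).getD i 0
  length : σ.var 0 = (Ctx.word γ).length
  slot : ∀ i < Ctx.vars Γ, σ.var (ρ i) = Ctx.slot i γ

/-- The variables of the context are placed below `s`, above the two reserved variables. -/
structure Placed (Γ : Type) [Ctx Γ] (ρ : ℕ → ℕ) (s : ℕ) : Prop where
  two_le : 2 ≤ s
  slot : ∀ i < Ctx.vars Γ, 2 ≤ ρ i ∧ ρ i < s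

theorem Placed.mono {ρ : ℕ → ℕ} {s s' : ℕ} (h : Placed Γ ρ s) (hs : s ≤ s') : Placed Γ ρ s' :=
  ⟨h.two_le.trans hs, fun i hi => ⟨(h.slot i hi).1, (h.slot i hi).2.trans_le hs⟩⟩

theorem Placed.extend {ρ : ℕ → ℕ} {s s' : ℕ} (h : Placed Γ ρ s) (hs : s < s') :
    Placed (Γ × ℕ) (Function.update ρ (Ctx.vars Γ) s) s' := by
  refine ⟨h.two_le.trans hs.le, fun i hi => ?_⟩
  have h2 := h.two_le
  by_cases hv : i = Ctx.vars Γ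
  · subst hv; simp only [Function.update_self]; omega
  · have := h.slot i (by change i < Ctx.vars Γ + 1 at hi; omega)
    simp only [Function.update_of_ne hv]; omega

theorem Holds.of_eq {γ : Γ} {ρ : ℕ → ℕ} {s : ℕ} {σ σ' : State} (h : Holds γ ρ σ)
    (hp : Placed Γ ρ s) (hv : ∀ x < s, x ≠ 1 → σ'.var x = σ.var x)
    (ha : σ'.arr 0 = σ.arr 0) : Holds γ ρ σ' := by
  have h2 := hp.two_le
  refine ⟨fun i => by rw [ha, h.word], by rw [hv 0 (by omega) (by omega), h.length],
    fun i hi => ?_⟩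
  have := hp.slot i hi
  rw [hv _ this.2 (by omega), h.slot i hi]

theorem Holds.extend {γ : Γ} {ρ : ℕ → ℕ} {s i : ℕ} {σ : State} (h : Holds γ ρ σ)
    (hs : σ.var s = i) : Holds (γ, i) (Function.update ρ (Ctx.vars Γ) s) σ := by
  refine ⟨h.word, h.length, fun j hj => ?_⟩
  by_cases hv : j = Ctx.vars Γ
  · subst hv; simpa [Ctx.slot] using hs
  · have := h.slot j (by change j < Ctx.vars Γ + 1 at hj; omega)
    simpa [Ctx.slot, hv] using this

/-- A number that depends on the context is computable in polynomial time. -/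
def Comp (f : Γ → ℕ) : Prop :=
  ∃ (code : (ℕ → ℕ) → ℕ → Cmd) (T : Γ → ℕ), PolyBdd T ∧
    ∀ ρ s γ σ, Placed Γ ρ s → Holds γ ρ σ → ∃ t σ', Exec (code ρ s) σ t σ' ∧
      σ'.var s = f γ ∧ (∀ x < s, σ'.var x = σ.var x) ∧ σ'.arr = σ.arr ∧ t ≤ T γ

/-- Array `1` and variable `1` contain the list `L` and its length. -/
def OutIs (σ : State) (L : List ℕ) : Prop :=
  σ.var 1 = L.length ∧ ∀ i, σ.arr 1 i = L.getD i 0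

theorem OutIs.of_eq {σ σ' : State} {L : List ℕ} (h : OutIs σ L) (hv : σ'.var 1 = σ.var 1)
    (ha : σ'.arr 1 = σ.arr 1) : OutIs σ' L := by
  unfold OutIs; rwa [hv, ha]

/-- A word that depends on the context is computable in polynomial time. -/
def CompL (f : Γ → List ℕ) : Prop :=
  ∃ (code : (ℕ → ℕ) → ℕ → Cmd) (T : Γ → ℕ), PolyBdd T ∧
    ∀ ρ s γ σ L, Placed Γ ρ s → Holds γ ρ σ → OutIs σ L → ∃ t σ', Exec (code ρ s) σ t σ' ∧
      OutIs σ' (L ++ f γ) ∧ (∀ x < s, x ≠ 1 → σ'.var x = σ.var x) ∧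
      (∀ a, a ≠ 1 → σ'.arr a = σ.arr a) ∧ t ≤ T γ

namespace Comp

variable {f g h : Γ → ℕ}

theorem const (c : ℕ) : Comp (fun _ : Γ => c) :=
  ⟨fun _ s => .const s c, fun _ => 1, PolyLE.const 1, fun ρ s γ σ _ _ =>
    ⟨1, _, .const _ _ _, by simp, fun x hx => by simp [hx.ne], rfl, le_rfl⟩⟩

/-- Two arguments are computed, and then one instruction is applied. -/
theorem binary {op : ℕ → ℕ → ℕ} {ins : ℕ → ℕ → ℕ → Cmd}
    (hins : ∀ σ x y z, Exec (ins x y z) σ 1 (σ.setVar x (op (σ.var y) (σ.var z))))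
    (hf : Comp f) (hg : Comp g) : Comp (fun γ => op (f γ) (g γ)) := by
  obtain ⟨cf, Tf, pf, hf⟩ := hf
  obtain ⟨cg, Tg, pg, hg⟩ := hg
  refine ⟨fun ρ s => .seq (cf ρ s) (.seq (cg ρ (s + 1)) (ins s s (s + 1))),
    fun γ => Tf γ + (Tg γ + 1), pf.add (pg.add (.const 1)), fun ρ s γ σ hp hσ => ?_⟩
  beta_reduce
  obtain ⟨t₁, σ₁, e₁, v₁, k₁, a₁, b₁⟩ := hf ρ s γ σ hp hσ
  obtain ⟨t₂, σ₂, e₂, v₂, k₂, a₂, b₂⟩ := hg ρ (s + 1) γ σ₁ (hp.mono (by omega))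
    (hσ.of_eq hp (fun x hx _ => k₁ x hx) (by rw [a₁]))
  refine ⟨_, _, .seq e₁ (.seq e₂ (hins _ _ _ _)), ?_, fun x hx => ?_, ?_, by omega⟩
  · rw [State.setVar_var, if_pos rfl, v₂, k₂ s (by omega), v₁]
  · rw [State.setVar_var, if_neg hx.ne, k₂ x (by omega), k₁ x hx]
  · rw [State.setVar_arr, a₂, a₁]

theorem add (hf : Comp f) (hg : Comp g) : Comp (fun γ => f γ + g γ) :=
  binary (op := fun a b => a + b) Exec.add hf hg

theorem sub (hf : Comp f) (hg : Comp g) : Comp (fun γ => f γ - g γ) :=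
  binary (op := fun a b => a - b) Exec.sub hf hg

theorem half (hf : Comp f) : Comp (fun γ => f γ / 2) :=
  binary (op := fun a _ => a / 2) (ins := fun x y _ => .half x y) (fun σ x y _ => .half σ x y)
    hf (const 0)

theorem slot (i : ℕ) (hi : i < Ctx.vars Γ) : Comp (fun γ : Γ => Ctx.slot i γ) := by
  refine ⟨fun ρ s => .seq (.const s 0) (.add s (ρ i) s), fun _ => 2, PolyLE.const 2,
    fun ρ s γ σ hp hσ => ⟨_, _, .seq (.const _ _ _) (.add _ _ _ _), ?_, fun x hx => ?_, rfl, le_rfl⟩⟩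
  · have := hp.slot i hi
    simp [this.2.ne, hσ.slot i hi]
  · simp [hx.ne]

theorem snd : Comp (fun p : Γ × ℕ => p.2) := by
  simpa [Ctx.slot] using slot (Γ := Γ × ℕ) (Ctx.vars Γ) (Nat.lt_succ_self _)

/-- Read a letter of the input word. -/
theorem get (hf : Comp f) : Comp (fun γ => (Ctx.word γ).getD (f γ) 0) := by
  obtain ⟨cf, Tf, pf, hf⟩ := hf
  refine ⟨fun ρ s => .seq (cf ρ s) (.load s 0 s), fun γ => Tf γ + 1, pf.add (.const 1),
    fun ρ s γ σ hp hσ => ?_⟩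
  beta_reduce
  obtain ⟨t₁, σ₁, e₁, v₁, k₁, a₁, b₁⟩ := hf ρ s γ σ hp hσ
  refine ⟨_, _, .seq e₁ (.load _ _ _ _), ?_, fun x hx => ?_, ?_, by omega⟩
  · rw [State.setVar_var, if_pos rfl, v₁, a₁, hσ.word]
  · rw [State.setVar_var, if_neg hx.ne, k₁ x hx]
  · rw [State.setVar_arr, a₁]

/-- The length of the input word. -/
theorem wordLength : Comp (fun γ : Γ => (Ctx.word γ).length) := by
  refine ⟨fun ρ s => .seq (.const s 0) (.add s 0 s), fun _ => 2, PolyLE.const 2,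
    fun ρ s γ σ hp hσ => ⟨_, _, .seq (.const _ _ _) (.add _ _ _ _), ?_, fun x hx => ?_, rfl, le_rfl⟩⟩
  · have := hp.two_le
    simp [hσ.length, show 0 ≠ s by omega]
  · simp [hx.ne]

theorem fst (hf : Comp f) : Comp (fun p : Γ × ℕ => f p.1) := by
  obtain ⟨cf, Tf, pf, hf⟩ := hf
  refine ⟨cf, fun p => Tf p.1, pf.fst, fun ρ s γ σ hp hσ => hf ρ s γ.1 σ ⟨hp.two_le, ?_⟩
    ⟨hσ.word, hσ.length, ?_⟩⟩
  · exact fun i hi => hp.slot i (Nat.lt_succ_of_lt hi)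
  · intro i hi
    have := hσ.slot i (Nat.lt_succ_of_lt hi)
    simpa [Ctx.slot, hi.ne] using this

theorem ite_zero (hc : Comp h) (hf : Comp f) (hg : Comp g) :
    Comp (fun γ => if h γ = 0 then f γ else g γ) := by
  obtain ⟨ch, Th, ph, hh⟩ := hc
  obtain ⟨cf, Tf, pf, hf⟩ := hf
  obtain ⟨cg, Tg, pg, hg⟩ := hg
  refine ⟨fun ρ s => .seq (ch ρ s) (.branch s (cg ρ s) (cf ρ s)),
    fun γ => Th γ + (1 + Tf γ + Tg γ), ph.add (((PolyLE.const 1).add pf).add pg),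
    fun ρ s γ σ hp hσ => ?_⟩
  beta_reduce
  obtain ⟨t₁, σ₁, e₁, v₁, k₁, a₁, b₁⟩ := hh ρ s γ σ hp hσ
  have hσ₁ := hσ.of_eq hp (fun x hx _ => k₁ x hx) (by rw [a₁])
  by_cases h0 : h γ = 0
  · obtain ⟨t₂, σ₂, e₂, v₂, k₂, a₂, b₂⟩ := hf ρ s γ σ₁ hp hσ₁
    refine ⟨_, σ₂, .seq e₁ (.branch_false (by rw [v₁, h0]) e₂), by rw [v₂, if_pos h0],
      fun x hx => by rw [k₂ x hx, k₁ x hx], by rw [a₂, a₁], by omega⟩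
  · obtain ⟨t₂, σ₂, e₂, v₂, k₂, a₂, b₂⟩ := hg ρ s γ σ₁ hp hσ₁
    refine ⟨_, σ₂, .seq e₁ (.branch_true (by rwa [v₁]) e₂), by rw [v₂, if_neg h0],
      fun x hx => by rw [k₂ x hx, k₁ x hx], by rw [a₂, a₁], by omega⟩

end Comp

/-- The body of a counting loop: the loop variable is `s`, the number of remaining rounds is in
`s + 2`, and `s + 3` contains `1`. -/
def countBody (s : ℕ) (p : Cmd) : Cmd :=
  .seq p (.seq (.add s s (s + 3)) (.sub (s + 2) (s + 2) (s + 3)))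

/-- Only the number of rounds needs a polynomial bound. At unit cost the accumulator may grow
without restriction, and `Comp.two_pow` exploits this. -/
theorem Comp.natRec {n z : Γ → ℕ} {step : Γ → ℕ → ℕ → ℕ} (hn : Comp n) (pn : PolyBdd n)
    (hz : Comp z) (hs : Comp (fun p : (Γ × ℕ) × ℕ => step p.1.1 p.1.2 p.2)) :
    Comp (fun γ => Nat.rec (motive := fun _ => ℕ) (z γ) (fun i a => step γ i a) (n γ)) := by
  obtain ⟨cn, Tn, ptn, hn⟩ := hn
  obtain ⟨cz, Tz, ptz, hz⟩ := hz
  obtain ⟨cs, Ts, ⟨c, e, pts⟩, hs⟩ := hs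
  let B : Γ → ℕ := fun γ => c * (Ctx.size γ + 1) ^ e + 4
  have pB : PolyBdd B := PolyLE.add ⟨c, e, fun _ => le_rfl⟩ (.const 4)
  -- The accumulator is in `s + 1`. The step function leaves its result in `s + 4`, and adding the
  -- zero in `s + 5` copies it back.
  let body : (ℕ → ℕ) → ℕ → Cmd := fun ρ s =>
    countBody s (.seq (cs (Function.update (Function.update ρ (Ctx.vars Γ) s) (Ctx.vars Γ + 1) (s + 1))
      (s + 4)) (.seq (.const (s + 5) 0) (.add (s + 1) (s + 4) (s + 5))))
  refine ⟨fun ρ s => .seq (cz ρ (s + 1)) (.seq (cn ρ (s + 2)) (.seq (.const s 0)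
    (.seq (.const (s + 3) 1) (.seq (.loop (s + 2) (body ρ s)) (.seq (.const (s + 3) 0)
      (.add s (s + 1) (s + 3))))))),
    fun γ => Tz γ + (Tn γ + (5 + n γ * (B γ + 1))),
    ptz.add (ptn.add ((PolyLE.const 5).add (pn.mul (pB.add (.const 1))))), fun ρ s γ σ hp hσ => ?_⟩
  beta_reduce
  obtain ⟨t₁, σ₁, e₁, v₁, k₁, a₁, b₁⟩ := hz ρ (s + 1) γ σ (hp.mono (by omega)) hσ
  have hσ₁ := hσ.of_eq hp (fun x hx _ => k₁ x (by omega)) (by rw [a₁])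
  obtain ⟨t₂, σ₂, e₂, v₂, k₂, a₂, b₂⟩ := hn ρ (s + 2) γ σ₁ (hp.mono (by omega)) hσ₁
  let I : ℕ → State → Prop := fun m τ => m ≤ n γ ∧ τ.var s = n γ - m ∧ τ.var (s + 2) = m ∧
    τ.var (s + 3) = 1 ∧
    τ.var (s + 1) = Nat.rec (motive := fun _ => ℕ) (z γ) (fun i a => step γ i a) (n γ - m) ∧
    (∀ x < s, τ.var x = σ.var x) ∧ τ.arr = σ.arr
  obtain ⟨t₃, σ₃, e₃, i₃, b₃⟩ := exec_loop (x := s + 2) (p := body ρ s) I (B γ) (by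
    rintro m τ ⟨hm, w₀, w₂, w₃, w₁, kv, ka⟩
    refine ⟨by omega, ?_⟩
    have hτ := hσ.of_eq hp (fun x hx _ => kv x hx) (by rw [ka])
    obtain ⟨t, τ', e', v', k', a', b'⟩ := hs _ (s + 4) ((γ, n γ - (m + 1)), τ.var (s + 1)) τ
      (((hp.extend (s' := s + 1) (by omega)).extend (s' := s + 4) (by omega)))
      ((hτ.extend w₀).extend rfl)
    refine ⟨_, _, .seq (.seq e' (.seq (.const _ _ _) (.add _ _ _ _)))
      (.seq (.add _ _ _ _) (.sub _ _ _ _)), ⟨by omega, ?_, ?_, ?_, ?_, fun x hx => ?_, ?_⟩, ?_⟩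
    · simp [k' s (by omega), k' (s + 3) (by omega), w₀, w₃]; omega
    · simp [k' (s + 2) (by omega), k' (s + 3) (by omega), w₂, w₃]
    · simp [k' (s + 3) (by omega), w₃]
    · have : n γ - m = (n γ - (m + 1)) + 1 := by omega
      simp [v', w₁, this]
    · have h1 : x ≠ s := by omega
      have h2 : x ≠ s + 1 := by omega
      have h3 : x ≠ s + 2 := by omega
      have h4 : x ≠ s + 5 := by omega
      simp [h1, h2, h3, h4, k' x (by omega), kv x hx]
    · simp [a', ka]
    · have := b'.trans (pts _)
      simp only [Ctx.size] at this
      simp only [B]; omega) (fun τ hτ => hτ.2.2.1) (n γ) ((σ₂.setVar s 0).setVar (s + 3) 1) (by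
    refine ⟨le_rfl, by simp, by simp [v₂], by simp, ?_, fun x hx => ?_, by simp [a₂, a₁]⟩
    · simp [k₂ (s + 1) (by omega), v₁]
    · have h1 : x ≠ s := by omega
      have h2 : x ≠ s + 3 := by omega
      simp [h1, h2, k₂ x (by omega), k₁ x (by omega)])
  obtain ⟨_, -, -, -, w₁, kv, ka⟩ := i₃
  refine ⟨_, _, .seq e₁ (.seq e₂ (.seq (.const _ _ _) (.seq (.const _ _ _) (.seq e₃
    (.seq (.const _ _ _) (.add _ _ _ _)))))), ?_, fun x hx => ?_, ?_, ?_⟩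
  · simp [w₁]
  · have h1 : x ≠ s := by omega
    have h2 : x ≠ s + 3 := by omega
    simp [h1, h2, kv x hx]
  · simp [ka]
  · omega

namespace CompL

variable {f g : Γ → List ℕ}

theorem nil : CompL (fun _ : Γ => []) :=
  ⟨fun _ _ => .nop, fun _ => 1, .const 1, fun ρ s γ σ L _ _ hL =>
    ⟨1, σ, .nop σ, by simpa using hL, fun _ _ _ => rfl, fun _ _ => rfl, le_rfl⟩⟩

theorem singleton {f : Γ → ℕ} (hf : Comp f) : CompL (fun γ => [f γ]) := by
  obtain ⟨cf, Tf, pf, hf⟩ := hf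
  refine ⟨fun ρ s => .seq (cf ρ s) (.seq (.store 1 1 s) (.seq (.const s 1) (.add 1 1 s))),
    fun γ => Tf γ + 3, pf.add (.const 3), fun ρ s γ σ L hp hσ hL => ?_⟩
  beta_reduce
  obtain ⟨t₁, σ₁, e₁, v₁, k₁, a₁, b₁⟩ := hf ρ s γ σ hp hσ
  have h2 := hp.two_le
  refine ⟨_, _, .seq e₁ (.seq (.store _ _ _ _) (.seq (.const _ _ _) (.add _ _ _ _))),
    ⟨?_, fun i => ?_⟩, fun x hx hx1 => ?_, fun a ha => ?_, by omega⟩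
  · simp [k₁ 1 (by omega), hL.1, show 1 ≠ s by omega]
  · rw [State.setVar_arr, State.setVar_arr, State.setCell_arr, k₁ 1 (by omega), hL.1, v₁, a₁]
    by_cases hi : i = L.length
    · simp [hi]
    · rw [if_neg (by tauto), hL.2]
      rcases Nat.lt_or_ge i L.length with h | h
      · rw [List.getD_append _ _ _ _ h]
      · rw [List.getD_eq_default _ _ h, List.getD_eq_default _ _ (by simp; omega)]
  · simp [hx1, hx.ne, k₁ x hx]
  · funext i
    rw [State.setVar_arr, State.setVar_arr, State.setCell_arr, if_neg (by tauto), a₁]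

theorem append (hf : CompL f) (hg : CompL g) : CompL (fun γ => f γ ++ g γ) := by
  obtain ⟨cf, Tf, pf, hf⟩ := hf
  obtain ⟨cg, Tg, pg, hg⟩ := hg
  refine ⟨fun ρ s => .seq (cf ρ s) (cg ρ s), fun γ => Tf γ + Tg γ, pf.add pg,
    fun ρ s γ σ L hp hσ hL => ?_⟩
  beta_reduce
  obtain ⟨t₁, σ₁, e₁, v₁, k₁, a₁, b₁⟩ := hf ρ s γ σ L hp hσ hL
  obtain ⟨t₂, σ₂, e₂, v₂, k₂, a₂, b₂⟩ := hg ρ s γ σ₁ _ hp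
    (hσ.of_eq hp k₁ (a₁ 0 (by omega))) v₁
  exact ⟨_, σ₂, .seq e₁ e₂, by simpa using v₂, fun x hx h1 => by rw [k₂ x hx h1, k₁ x hx h1],
    fun a ha => by rw [a₂ a ha, a₁ a ha], by omega⟩

theorem cons {f : Γ → ℕ} (hf : Comp f) (hg : CompL g) : CompL (fun γ => f γ :: g γ) :=
  (singleton hf).append hg

theorem ite_zero {h : Γ → ℕ} (hc : Comp h) (hf : CompL f) (hg : CompL g) :
    CompL (fun γ => if h γ = 0 then f γ else g γ) := by
  obtain ⟨ch, Th, ph, hh⟩ := hc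
  obtain ⟨cf, Tf, pf, hf⟩ := hf
  obtain ⟨cg, Tg, pg, hg⟩ := hg
  refine ⟨fun ρ s => .seq (ch ρ s) (.branch s (cg ρ s) (cf ρ s)),
    fun γ => Th γ + (1 + Tf γ + Tg γ), ph.add (((PolyLE.const 1).add pf).add pg),
    fun ρ s γ σ L hp hσ hL => ?_⟩
  beta_reduce
  obtain ⟨t₁, σ₁, e₁, v₁, k₁, a₁, b₁⟩ := hh ρ s γ σ hp hσ
  have hσ₁ := hσ.of_eq hp (fun x hx _ => k₁ x hx) (by rw [a₁])
  have h2 := hp.two_le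
  have hL₁ := hL.of_eq (k₁ 1 (by omega)) (by rw [a₁])
  by_cases h0 : h γ = 0
  · obtain ⟨t₂, σ₂, e₂, v₂, k₂, a₂, b₂⟩ := hf ρ s γ σ₁ L hp hσ₁ hL₁
    refine ⟨_, σ₂, .seq e₁ (.branch_false (by rw [v₁, h0]) e₂), by rwa [if_pos h0],
      fun x hx h1 => by rw [k₂ x hx h1, k₁ x hx], fun a ha => by rw [a₂ a ha, a₁], by omega⟩
  · obtain ⟨t₂, σ₂, e₂, v₂, k₂, a₂, b₂⟩ := hg ρ s γ σ₁ L hp hσ₁ hL₁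
    refine ⟨_, σ₂, .seq e₁ (.branch_true (by rwa [v₁]) e₂), by rwa [if_neg h0],
      fun x hx h1 => by rw [k₂ x hx h1, k₁ x hx], fun a ha => by rw [a₂ a ha, a₁], by omega⟩

/-- The output is only ever appended to, so a counting loop whose body appends one block per round
produces the concatenation. -/
theorem flatMap {n : Γ → ℕ} {f : Γ → ℕ → List ℕ} (hn : Comp n) (pn : PolyBdd n)
    (hf : CompL (fun p : Γ × ℕ => f p.1 p.2)) :
    CompL (fun γ => (List.range (n γ)).flatMap (f γ)) := by
  obtain ⟨cn, Tn, ptn, hn⟩ := hn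
  obtain ⟨cs, Ts, ⟨c, e, pts⟩, hs⟩ := hf
  let B : Γ → ℕ := fun γ => c * (Ctx.size γ + 1) ^ e + 2
  have pB : PolyBdd B := PolyLE.add ⟨c, e, fun _ => le_rfl⟩ (.const 2)
  let body : (ℕ → ℕ) → ℕ → Cmd := fun ρ s =>
    countBody s (cs (Function.update ρ (Ctx.vars Γ) s) (s + 4))
  refine ⟨fun ρ s => .seq (cn ρ (s + 2)) (.seq (.const s 0)
    (.seq (.const (s + 3) 1) (.loop (s + 2) (body ρ s)))),
    fun γ => Tn γ + (3 + n γ * (B γ + 1)),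
    ptn.add ((PolyLE.const 3).add (pn.mul (pB.add (.const 1)))), fun ρ s γ σ L hp hσ hL => ?_⟩
  beta_reduce
  obtain ⟨t₂, σ₂, e₂, v₂, k₂, a₂, b₂⟩ := hn ρ (s + 2) γ σ (hp.mono (by omega)) hσ
  have h2 := hp.two_le
  let I : ℕ → State → Prop := fun m τ => m ≤ n γ ∧ τ.var s = n γ - m ∧ τ.var (s + 2) = m ∧
    τ.var (s + 3) = 1 ∧ OutIs τ (L ++ (List.range (n γ - m)).flatMap (f γ)) ∧
    (∀ x < s, x ≠ 1 → τ.var x = σ.var x) ∧ (∀ a, a ≠ 1 → τ.arr a = σ.arr a)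
  obtain ⟨t₃, σ₃, e₃, i₃, b₃⟩ := exec_loop (x := s + 2) (p := body ρ s) I (B γ) (by
    rintro m τ ⟨hm, w₀, w₂, w₃, w₁, kv, ka⟩
    refine ⟨by omega, ?_⟩
    have hτ := hσ.of_eq hp (fun x hx => kv x hx) (ka 0 (by omega))
    obtain ⟨t, τ', e', v', k', a', b'⟩ := hs _ (s + 4) (γ, n γ - (m + 1)) τ _
      (hp.extend (s' := s + 4) (by omega)) (hτ.extend w₀) w₁
    refine ⟨_, _, .seq e' (.seq (.add _ _ _ _) (.sub _ _ _ _)),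
      ⟨by omega, ?_, ?_, ?_, ?_, fun x hx hx1 => ?_, fun a ha => ?_⟩, ?_⟩
    · simp [k' s (by omega) (by omega), k' (s + 3) (by omega) (by omega), w₀, w₃]; omega
    · simp [k' (s + 2) (by omega) (by omega), k' (s + 3) (by omega) (by omega), w₂, w₃]
    · simp [k' (s + 3) (by omega) (by omega), w₃]
    · have h3 : n γ - m = (n γ - (m + 1)) + 1 := by omega
      rw [h3, List.range_succ, List.flatMap_append, List.flatMap_singleton, ← List.append_assoc]
      refine v'.of_eq ?_ rfl
      simp [show 1 ≠ s by omega]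
    · have h1 : x ≠ s := by omega
      have h3 : x ≠ s + 2 := by omega
      simp [h1, h3, k' x (by omega) hx1, kv x hx hx1]
    · simp [a' a ha, ka a ha]
    · have := b'.trans (pts _)
      simp only [Ctx.size] at this
      simp only [B]; omega) (fun τ hτ => hτ.2.2.1) (n γ) ((σ₂.setVar s 0).setVar (s + 3) 1) (by
    refine ⟨le_rfl, by simp, by simp [v₂], by simp, ?_, fun x hx hx1 => ?_, fun a _ => by simp [a₂]⟩
    · simp only [Nat.sub_self, List.range_zero, List.flatMap_nil, List.append_nil]
      refine hL.of_eq ?_ (by simp [a₂])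
      simp [k₂ 1 (by omega), show 1 ≠ s by omega]
    · have h1 : x ≠ s := by omega
      have h2 : x ≠ s + 3 := by omega
      simp [h1, h2, k₂ x (by omega)])
  obtain ⟨_, -, -, -, w₁, kv, ka⟩ := i₃
  exact ⟨_, _, .seq e₂ (.seq (.const _ _ _) (.seq (.const _ _ _) e₃)), by simpa using w₁, kv, ka,
    by omega⟩

end CompL

/-! ### Reductions -/

/-- If `f` is computable in polynomial time, then a program for the words `f γ` gives a program
for the words that describe `γ`. The only variable of the context has a fixed value `k`; the
overhead does not depend on it. -/
theorem exists_reduction (hvars : Ctx.vars Γ = 1) {f : Γ → List ℕ} (hf : CompL f) :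
    ∃ T : Γ → ℕ, PolyBdd T ∧ ∀ (P : Cmd) (k : ℕ), ∃ Q : Cmd, ∀ (γ : Γ) (yes : Prop) (b : ℝ),
      Ctx.slot 0 γ = k → DecidesWithin P (f γ) yes b →
        DecidesWithin Q (Ctx.word γ) yes (b + T γ) := by
  obtain ⟨code, T, pT, hf⟩ := hf
  refine ⟨fun γ => T γ + 3, pT.add (.const 3), fun P k => ?_⟩
  let p : Cmd := .seq (.const 2 k) (code (fun _ => 2) 3)
  let V := p.varBound + 3
  -- The output of `p` becomes the input of `P`: variable 0 goes to variable 1 and array 0 to array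
  -- 1, where the word and its length were left. All other variables go above everything that `p`
  -- writes, where the memory is still zero.
  let r : ℕ → ℕ := fun x => if x = 0 then 1 else x + V
  have hr : r.Injective := by
    intro x y hxy
    simp only [r] at hxy
    split_ifs at hxy <;> omega
  -- The last two instructions copy the answer of `P`, which is in variable 1, to variable 0.
  refine ⟨.seq p (.seq (P.rename r (· + 1)) (.seq (.const 0 0) (.add 0 0 1))), ?_⟩
  rintro γ yes b hk ⟨t, σ, hP, hyes, ht⟩
  have hpl : Placed Γ (fun _ => 2) 3 := ⟨by omega, fun i _ => by simp⟩
  obtain ⟨t₁, σ₁, e₁, v₁, k₁, a₁, b₁⟩ := hf (fun _ => 2) 3 γ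
    ((initial (Ctx.word γ)).setVar 2 k) [] hpl
    ⟨fun i => by simp [initial], by simp [initial], fun i hi => by
      have : i = 0 := by omega
      subst this; simp [hk]⟩ ⟨by simp [initial], fun i => by simp [initial]⟩
  have e₂ : Exec p (initial (Ctx.word γ)) (1 + t₁) σ₁ := .seq (.const _ _ _) e₁
  obtain ⟨τ, e₃, hτ⟩ := hP.rename (f := r) (g := (· + 1)) hr (add_left_injective 1) σ₁ (by
    rw [List.nil_append] at v₁
    refine ⟨fun x => ?_, fun a i => ?_⟩
    · by_cases hx : x = 0
      · subst hx; simp [r, v₁.1, initial]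
      · simp only [r, hx, if_false]
        rw [e₂.var_eq _ (by omega)]
        simp [initial, hx]
    · by_cases ha : a = 0
      · subst ha; simp [v₁.2, initial]
      · change σ₁.arr (a + 1) i = _
        rw [a₁ (a + 1) (by omega)]
        simp [initial, ha])
  refine ⟨_, _, .seq e₂ (.seq e₃ (.seq (.const _ _ _) (.add _ _ _ _))), ?_, ?_⟩
  · have := hτ.1 0
    simp only [r, if_true] at this
    simpa [this] using hyes
  · have : (t₁ : ℝ) ≤ T γ := by exact_mod_cast b₁
    push_cast
    linarith

end RAM

/-! ### Decidable predicates and arithmetic in polynomial time -/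

namespace RAM

variable {Γ : Type} [Ctx Γ]

/-- A property of the context is decidable in polynomial time. -/
def CompP (p : Γ → Prop) : Prop := Comp fun γ => open Classical in if p γ then 1 else 0

theorem Comp.congr {f g : Γ → ℕ} (hf : Comp f) (h : ∀ γ, f γ = g γ) : Comp g := by
  obtain rfl : f = g := funext h
  exact hf

theorem CompL.congr {f g : Γ → List ℕ} (hf : CompL f) (h : ∀ γ, f γ = g γ) : CompL g := by
  obtain rfl : f = g := funext h
  exact hf

theorem CompP.congr {p q : Γ → Prop} (hp : CompP p) (h : ∀ γ, p γ ↔ q γ) : CompP q := by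
  obtain rfl : p = q := funext fun γ => propext (h γ)
  exact hp

theorem Comp.ite {p : Γ → Prop} [DecidablePred p] {f g : Γ → ℕ} (hp : CompP p) (hf : Comp f)
    (hg : Comp g) : Comp (fun γ => if p γ then f γ else g γ) :=
  (Comp.ite_zero hp hg hf).congr fun γ => by by_cases h : p γ <;> simp [h]

theorem CompL.ite {p : Γ → Prop} [DecidablePred p] {f g : Γ → List ℕ} (hp : CompP p)
    (hf : CompL f) (hg : CompL g) : CompL (fun γ => if p γ then f γ else g γ) :=
  (CompL.ite_zero hp hg hf).congr fun γ => by by_cases h : p γ <;> simp [h]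

namespace CompP

variable {f g : Γ → ℕ} {p q : Γ → Prop}

theorem eq_zero (hf : Comp f) : CompP (fun γ => f γ = 0) :=
  (Comp.ite_zero hf (.const 1) (.const 0)).congr fun γ => by by_cases h : f γ = 0 <;> simp [h]

theorem not (hp : CompP p) : CompP (fun γ => ¬ p γ) :=
  (eq_zero hp).congr fun γ => by by_cases h : p γ <;> simp [h]

theorem and (hp : CompP p) (hq : CompP q) : CompP (fun γ => p γ ∧ q γ) :=
  (eq_zero (Comp.add hp.not hq.not)).congr fun γ => by
    by_cases h : p γ <;> by_cases h' : q γ <;> simp [h, h']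

theorem le (hf : Comp f) (hg : Comp g) : CompP (fun γ => f γ ≤ g γ) :=
  (eq_zero (hf.sub hg)).congr fun γ => by omega

theorem lt (hf : Comp f) (hg : Comp g) : CompP (fun γ => f γ < g γ) :=
  (le hg hf).not.congr fun γ => by omega

theorem eq (hf : Comp f) (hg : Comp g) : CompP (fun γ => f γ = g γ) :=
  ((le hf hg).and (le hg hf)).congr fun γ => by omega

end CompP

namespace Comp

variable {f g : Γ → ℕ}

/-- A product, where one of the factors is polynomially bounded. -/
theorem mul (hf : Comp f) (pf : PolyBdd f) (hg : Comp g) : Comp (fun γ => f γ * g γ) :=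
  (natRec hf pf (const 0) (step := fun γ _ a => a + g γ) (snd.add hg.fst.fst)).congr fun γ => by
    induction f γ with
    | zero => simp
    | succ n ih => simp only [ih]; ring

theorem mul' (hf : Comp f) (hg : Comp g) (pg : PolyBdd g) : Comp (fun γ => f γ * g γ) :=
  (mul hg pg hf).congr fun _ => Nat.mul_comm _ _

/-- Counting up: the quotient grows by one as long as the product still fits. After `n` rounds it is
`min n (f γ / g γ)`, so `f γ` rounds suffice; a zero divisor gives 0, as it does in `ℕ`. -/
theorem div (hf : Comp f) (pf : PolyBdd f) (hg : Comp g) (pg : PolyBdd g) :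
    Comp (fun γ => f γ / g γ) := by
  refine (natRec hf pf (const 0)
    (step := fun γ _ a => if g γ ≠ 0 ∧ (a + 1) * g γ ≤ f γ then a + 1 else a) ?_).congr fun γ => ?_
  · exact ite ((CompP.eq_zero hg.fst.fst).not.and
      (CompP.le (mul' (snd.add (const 1)) hg.fst.fst pg.fst.fst) hf.fst.fst))
      (snd.add (const 1)) snd
  · have key : ∀ n, Nat.rec (motive := fun _ => ℕ) 0
        (fun i a => if g γ ≠ 0 ∧ (a + 1) * g γ ≤ f γ then a + 1 else a) n = min n (f γ / g γ) := by
      intro n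
      induction n with
      | zero => simp
      | succ n ih =>
        simp only [ih]
        rcases Nat.eq_zero_or_pos (g γ) with h0 | h0
        · simp [h0]
        · simp only [← Nat.le_div_iff_mul_le h0]
          split_ifs <;> omega
    exact (key (f γ)).trans (min_eq_right (Nat.div_le_self _ _))

theorem mod (hf : Comp f) (pf : PolyBdd f) (hg : Comp g) (pg : PolyBdd g) :
    Comp (fun γ => f γ % g γ) :=
  (hf.sub (mul hg pg (div hf pf hg pg))).congr fun γ => by
    have := Nat.div_add_mod (f γ) (g γ); omega

theorem two_pow (hf : Comp f) (pf : PolyBdd f) : Comp (fun γ => 2 ^ f γ) :=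
  (natRec hf pf (const 1) (step := fun _ _ a => a + a) (snd.add snd)).congr fun γ => by
    induction f γ with
    | zero => simp
    | succ n ih => simp only [ih]; ring

/-- Repeated halving shifts the bit to position 0. Only the position bounds a loop, so the number
itself may be arbitrarily large. -/
theorem testBit (hf : Comp f) (hg : Comp g) (pg : PolyBdd g) :
    CompP (fun γ => (f γ).testBit (g γ) = true) := by
  have h : Comp (fun γ => f γ / 2 ^ g γ) :=
    (natRec hg pg hf (step := fun _ _ a => a / 2) snd.half).congr fun γ => by
      induction g γ with
      | zero => simp
      | succ n ih => simp only [ih]; rw [Nat.div_div_eq_div_mul, pow_succ]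
  refine (CompP.eq (h.sub (h.half.add h.half)) (const 1)).congr fun γ => ?_
  rw [Nat.testBit_eq_decide_div_mod_eq, decide_eq_true_iff]
  omega

theorem sum {n : Γ → ℕ} {f : Γ → ℕ → ℕ} (hn : Comp n) (pn : PolyBdd n)
    (hf : Comp (fun p : Γ × ℕ => f p.1 p.2)) :
    Comp (fun γ => ∑ i ∈ Finset.range (n γ), f γ i) :=
  (natRec hn pn (const 0) (step := fun γ i a => a + f γ i) (snd.add hf.fst)).congr fun γ => by
    induction n γ with
    | zero => simp
    | succ n ih => simp only [ih]; rw [Finset.sum_range_succ]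

/-- Mostly used to clamp a loop variable, whose value is unbounded in the extended context. -/
theorem min (hf : Comp f) (hg : Comp g) : Comp (fun γ => Min.min (f γ) (g γ)) :=
  (hf.sub (hf.sub hg)).congr fun γ => by omega

end Comp

/-- Bounded search by counting the witnesses. -/
theorem CompP.exists_lt {n : Γ → ℕ} {p : Γ → ℕ → Prop} (hn : Comp n) (pn : PolyBdd n)
    (hp : CompP (fun q : Γ × ℕ => p q.1 q.2)) : CompP (fun γ => ∃ i < n γ, p γ i) :=
  (CompP.eq_zero (Comp.sum hn pn (f := fun γ i => open Classical in if p γ i then 1 else 0)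
    hp)).not.congr fun γ => by simp

theorem CompL.fst {f : Γ → List ℕ} (hf : CompL f) : CompL (fun p : Γ × ℕ => f p.1) := by
  obtain ⟨cf, Tf, pf, hf⟩ := hf
  refine ⟨cf, fun p => Tf p.1, pf.fst, fun ρ s γ σ L hp hσ =>
    hf ρ s γ.1 σ L ⟨hp.two_le, ?_⟩ ⟨hσ.word, hσ.length, ?_⟩⟩
  · exact fun i hi => hp.slot i (Nat.lt_succ_of_lt hi)
  · intro i hi
    have := hσ.slot i (Nat.lt_succ_of_lt hi)
    simpa [Ctx.slot, hi.ne] using this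

theorem CompL.map {n : Γ → ℕ} {f : Γ → ℕ → ℕ} (hn : Comp n) (pn : PolyBdd n)
    (hf : Comp (fun p : Γ × ℕ => f p.1 p.2)) : CompL (fun γ => (List.range (n γ)).map (f γ)) :=
  (CompL.flatMap hn pn (f := fun γ i => [f γ i]) (CompL.singleton hf)).congr fun γ => by
    induction List.range (n γ) with
    | nil => rfl
    | cons a l ih => rw [List.flatMap_cons, ih]; rfl

end RAM

/-! ### Straight-line register programs -/

/-- The instruction `r_tgt := r_tgt ∧ y` (`op = 0`), `r_tgt := r_tgt ∨ y` (`op = 1`), or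
`r_tgt := ¬ r_tgt`. The operand `y` with number `src` is an input or a register. -/
structure Instr : Type where
  op : ℕ
  tgt : ℕ
  src : ℕ

namespace Instr

/-- The value of operand `j`: inputs come first, followed by the registers. -/
def operand (n : ℕ) (x r : ℕ → Bool) (j : ℕ) : Bool := if j < n then x j else r (j - n)

def step (n : ℕ) (x r : ℕ → Bool) (I : Instr) : ℕ → Bool :=
  Function.update r I.tgt <|
    if I.op = 0 then r I.tgt && operand n x r I.src
    else if I.op = 1 then r I.tgt || operand n x r I.src
    else !r I.tgt

def run (n : ℕ) (x r : ℕ → Bool) (l : List Instr) : ℕ → Bool := l.foldl (step n x) r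

theorem run_append (n : ℕ) (x r : ℕ → Bool) (l l' : List Instr) :
    run n x r (l ++ l') = run n x (run n x r l) l' := List.foldl_append

/-- The instruction is sensible for `n` inputs and `W` registers. -/
def WF (n W : ℕ) (I : Instr) : Prop := I.tgt < W ∧ I.src < n + W ∧ I.src ≠ n + I.tgt

end Instr

/-- A program with `n` inputs and `W` registers, all of them initially equal to input `0`. -/
structure RegProg : Type where
  n : ℕ
  W : ℕ
  code : List Instr
  n_pos : 0 < n
  W_pos : 0 < W
  wf : ∀ I ∈ code, I.WF n W
  covers : ∀ j < n, ∃ I ∈ code, I.op ≤ 1 ∧ I.src = j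

namespace RegProg

variable (R : RegProg)

/-- The program accepts if it ends with True in register `0`. -/
def Accepts (x : ℕ → Bool) : Prop := Instr.run R.n x (fun _ => x 0) R.code 0 = true

def IsMonotone : Prop := ∀ I ∈ R.code, I.op ≤ 1

def instr (t : ℕ) : Instr := R.code.getD t ⟨0, 0, 0⟩

/-- The registers after `t` instructions. -/
def state (x : ℕ → Bool) (t : ℕ) : ℕ → Bool := Instr.run R.n x (fun _ => x 0) (R.code.take t)

theorem state_succ (x : ℕ → Bool) {t : ℕ} (ht : t < R.code.length) :
    R.state x (t + 1) = Instr.step R.n x (R.state x t) (R.instr t) := by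
  have : R.code.take (t + 1) = R.code.take t ++ [R.instr t] := by
    rw [List.take_add_one, instr, List.getElem?_eq_getElem ht, List.getD_eq_getElem _ _ ht]
    rfl
  rw [state, this, Instr.run_append]
  rfl

theorem instr_mem {t : ℕ} (ht : t < R.code.length) : R.instr t ∈ R.code := by
  rw [instr, List.getD_eq_getElem _ _ ht]; exact List.getElem_mem ht

/-! The circuit consists of the inputs, of one row of vertices for each state of the registers, of a
row for the disjunctions with the result, and of a row for the conjunction of these. -/

def addr (t i : ℕ) : ℕ := R.n + t * R.W + i

def srcAddr (t : ℕ) (I : Instr) : ℕ := if I.src < R.n then I.src else R.addr t (I.src - R.n)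

def instrGate (t i : ℕ) (I : Instr) : Gate :=
  if I.tgt = i then
    if I.op = 0 then .and [R.addr t i, R.srcAddr t I]
    else if I.op = 1 then .or [R.addr t i, R.srcAddr t I]
    else .not (R.addr t i)
  else .or [R.addr t i]

/-- A disjunction of one argument serves as a copy, and row 0 copies input 0 into every register.
The last two rows make the result the only sink without changing it: they form `r i ∨ r 0` for all
`i`, and then a chain of conjunctions starting from `r 0`. By absorption every vertex of the last
row has the value of `r 0`, and each one feeds the next. -/
def rowGate (t i : ℕ) : Gate :=
  if t = 0 then .or [0]
  else if t ≤ R.code.length then R.instrGate (t - 1) i (R.instr (t - 1))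
  else if t = R.code.length + 1 then
    if i = 0 then .or [R.addr (t - 1) i] else .or [R.addr (t - 1) i, R.addr (t - 1) 0]
  else if i = 0 then .or [R.addr (t - 1) i] else .and [R.addr (t - 1) i, R.addr t (i - 1)]

def gateAt (q : ℕ) : Gate :=
  if q < R.n then .input else R.rowGate ((q - R.n) / R.W) ((q - R.n) % R.W)

def numVertices : ℕ := R.n + (R.code.length + 3) * R.W

theorem gateAt_addr (t : ℕ) {i : ℕ} (hi : i < R.W) : R.gateAt (R.addr t i) = R.rowGate t i := by
  have h1 : R.addr t i - R.n = i + R.W * t := by rw [addr, Nat.mul_comm]; omega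
  have h2 : ¬ R.addr t i < R.n := by rw [addr]; omega
  rw [gateAt, if_neg h2, h1, Nat.add_mul_div_left _ _ R.W_pos, Nat.div_eq_of_lt hi,
    Nat.add_mul_mod_self_left, Nat.mod_eq_of_lt hi, Nat.zero_add]

theorem exists_addr {q : ℕ} (h1 : R.n ≤ q) (h2 : q < R.numVertices) :
    ∃ t i, t < R.code.length + 3 ∧ i < R.W ∧ q = R.addr t i := by
  refine ⟨(q - R.n) / R.W, (q - R.n) % R.W, ?_, Nat.mod_lt _ R.W_pos, ?_⟩
  · rw [Nat.div_lt_iff_lt_mul R.W_pos]; unfold numVertices at h2; omega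
  · have := Nat.div_add_mod (q - R.n) R.W
    rw [addr, Nat.mul_comm]; omega

theorem addr_lt {t i : ℕ} (ht : t < R.code.length + 3) (hi : i < R.W) :
    R.addr t i < R.numVertices := by
  have : (t + 1) * R.W ≤ (R.code.length + 3) * R.W := Nat.mul_le_mul_right _ (by omega)
  rw [addr, numVertices]
  linarith [Nat.add_mul t 1 R.W]

theorem addr_succ (t i : ℕ) : R.addr (t + 1) i = R.addr t i + R.W := by
  simp only [addr]; ring

theorem gateAt_of_lt {q : ℕ} (h : q < R.n) : R.gateAt q = .input := if_pos h

/-- The condition `src ≠ n + tgt` of `Instr.WF` makes the two in-neighbours distinct, as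
`Circuit.preds_nodup` demands. -/
theorem instrGate_preds {t i : ℕ} {I : Instr} (hI : I.WF R.n R.W) :
    (∀ j ∈ (R.instrGate t i I).preds, j < R.addr (t + 1) i) ∧ (R.instrGate t i I).preds.Nodup ∧
      (R.instrGate t i I).preds ≠ [] ∧ (R.instrGate t i I).preds.length ≤ 2 ∧
      R.addr t i ∈ (R.instrGate t i I).preds ∧ R.instrGate t i I ≠ .input := by
  have hW := R.W_pos
  obtain ⟨h1, h2, h3⟩ := hI
  have h4 := R.addr_succ t i
  have h5 : ∀ j, R.addr t j = R.n + t * R.W + j := fun _ => rfl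
  have key : I.tgt = i → R.srcAddr t I < R.addr (t + 1) i ∧ R.addr t i ≠ R.srcAddr t I := by
    intro hti
    rw [h4, srcAddr, h5, h5]
    split_ifs <;> omega
  have h6 : R.addr t i < R.addr (t + 1) i := by omega
  unfold instrGate
  split_ifs with ht
  · simp [Gate.preds, key ht, h6]
  · simp [Gate.preds, key ht, h6]
  · simp [Gate.preds, h6]
  · simp [Gate.preds, h6]

theorem rowGate_preds {t i : ℕ} (hi : i < R.W) :
    (∀ j ∈ (R.rowGate t i).preds, j < R.addr t i) ∧ (R.rowGate t i).preds.Nodup ∧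
      (R.rowGate t i).preds ≠ [] ∧ (R.rowGate t i).preds.length ≤ 2 ∧
      (0 < t → R.addr (t - 1) i ∈ (R.rowGate t i).preds) ∧ R.rowGate t i ≠ .input := by
  have hW := R.W_pos
  have hn := R.n_pos
  cases t with
  | zero => simp [rowGate, Gate.preds, addr]; omega
  | succ t =>
    have h4 := R.addr_succ t i
    have h5 : R.addr (t + 1) i = R.addr (t + 1) 0 + i := by simp [addr]
    have h6 := R.addr_succ t 0
    have h7 : 0 < i → R.addr (t + 1) (i - 1) + 1 = R.addr (t + 1) i := by
      intro h; simp only [addr]; omega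
    unfold rowGate
    rw [if_neg (Nat.succ_ne_zero t), Nat.add_sub_cancel]
    split_ifs with h1 h2 h3 h3
    · have := R.instrGate_preds (t := t) (i := i) (R.wf _ (R.instr_mem (t := t) (by omega)))
      tauto
    · simp [Gate.preds]; omega
    · simp [Gate.preds]; omega
    · simp [Gate.preds]; omega
    · simp [Gate.preds]; omega

theorem gateAt_preds {q : ℕ} (h : q < R.numVertices) :
    (∀ j ∈ (R.gateAt q).preds, j < q) ∧ (R.gateAt q).preds.Nodup ∧
      (R.gateAt q ≠ .input → (R.gateAt q).preds ≠ []) ∧ (R.gateAt q).preds.length ≤ 2 := by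
  rcases Nat.lt_or_ge q R.n with h1 | h1
  · simp [R.gateAt_of_lt h1, Gate.preds]
  · obtain ⟨t, i, -, hi, rfl⟩ := R.exists_addr h1 h
    rw [R.gateAt_addr t hi]
    have := R.rowGate_preds (t := t) hi
    tauto

def gates : List Gate := (List.range R.numVertices).map R.gateAt

theorem getElem?_gates {q : ℕ} {g : Gate} :
    R.gates[q]? = some g ↔ q < R.numVertices ∧ R.gateAt q = g := by
  rcases Nat.lt_or_ge q R.numVertices with h | h <;> simp [gates, h]

theorem gateArc_iff {j q : ℕ} :
    GateArc R.gates j q ↔ q < R.numVertices ∧ j ∈ (R.gateAt q).preds := by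
  simp only [GateArc, getElem?_gates]
  constructor
  · rintro ⟨g, ⟨h, rfl⟩, hj⟩; exact ⟨h, hj⟩
  · rintro ⟨h, hj⟩; exact ⟨_, ⟨h, rfl⟩, hj⟩

theorem lt_of_gateArc {j q : ℕ} (h : GateArc R.gates j q) : j < q := by
  rw [gateArc_iff] at h
  exact (R.gateAt_preds h.1).1 j h.2

theorem numVertices_pos : 0 < R.numVertices := by
  have := R.n_pos; unfold numVertices; omega

/-- This yields uniqueness of the sink. An input is read by some instruction because of `covers`,
which asks for `op ≤ 1` since a negation ignores its `src`. A register is carried to the next row,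
and in the last row each vertex feeds its right neighbour. -/
theorem exists_gateArc {q : ℕ} (hq : q + 1 < R.numVertices) : ∃ j, GateArc R.gates q j := by
  have hW := R.W_pos
  simp only [gateArc_iff]
  rcases Nat.lt_or_ge q R.n with h1 | h1
  · obtain ⟨I, hI, hop, rfl⟩ := R.covers q h1
    obtain ⟨t, ht, rfl⟩ := List.getElem_of_mem hI
    have hi : R.instr t = R.code[t] := by rw [instr, List.getD_eq_getElem _ _ ht]
    have hwf := R.wf _ hI
    refine ⟨R.addr (t + 1) R.code[t].tgt, R.addr_lt (by omega) hwf.1, ?_⟩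
    rw [R.gateAt_addr _ hwf.1, rowGate, if_neg (Nat.succ_ne_zero t), if_pos (by omega),
      Nat.add_sub_cancel, hi, instrGate, if_pos rfl, srcAddr, if_pos h1]
    split_ifs
    · simp [Gate.preds]
    · simp [Gate.preds]
    · omega
  · obtain ⟨t, i, ht, hi, rfl⟩ := R.exists_addr h1 (by omega)
    rcases Nat.lt_or_ge (t + 1) (R.code.length + 3) with h2 | h2
    · refine ⟨R.addr (t + 1) i, R.addr_lt h2 hi, ?_⟩
      rw [R.gateAt_addr _ hi]
      exact (R.rowGate_preds hi).2.2.2.2.1 (by omega)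
    · have ht' : t = R.code.length + 2 := by omega
      subst ht'
      have hi' : i + 1 < R.W := by
        by_contra hcon
        have : i + 1 = R.W := by omega
        unfold addr numVertices at hq
        have : (R.code.length + 3) * R.W = (R.code.length + 2) * R.W + R.W := by ring
        omega
      refine ⟨R.addr (R.code.length + 2) (i + 1), R.addr_lt ht hi', ?_⟩
      rw [R.gateAt_addr _ hi', rowGate, if_neg (by omega), if_neg (by omega), if_neg (by omega),
        if_neg (by omega)]
      simp [Gate.preds]

/-- The circuit of a register program. -/
def toCircuit : Circuit where
  gates := R.gates
  out := R.numVertices - 1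
  preds_lt := by
    intro g hg j hj
    obtain ⟨q, hq⟩ := List.getElem?_of_mem hg
    obtain ⟨h1, rfl⟩ := R.getElem?_gates.1 hq
    have := (R.gateAt_preds h1).1 j hj
    rw [gates, List.length_map, List.length_range]
    omega
  preds_nodup := by
    intro g hg
    obtain ⟨q, hq⟩ := List.getElem?_of_mem hg
    obtain ⟨h1, rfl⟩ := R.getElem?_gates.1 hq
    exact (R.gateAt_preds h1).2.1
  preds_ne_nil := by
    intro g hg
    obtain ⟨q, hq⟩ := List.getElem?_of_mem hg
    obtain ⟨h1, rfl⟩ := R.getElem?_gates.1 hq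
    exact (R.gateAt_preds h1).2.2.1
  acyclic := by
    have : ∀ i j, Relation.TransGen (GateArc R.gates) i j → i < j := by
      intro i j h
      induction h with
      | single h => exact R.lt_of_gateArc h
      | tail _ h ih => exact ih.trans (R.lt_of_gateArc h)
    exact fun i hi => lt_irrefl _ (this i i hi)
  out_lt := by
    have := R.numVertices_pos
    rw [gates, List.length_map, List.length_range]
    omega
  sink_iff := by
    intro i hi
    rw [gates, List.length_map, List.length_range] at hi
    constructor
    · intro h
      by_contra hne
      obtain ⟨j, hj⟩ := R.exists_gateArc (q := i) (by omega)
      exact h j hj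
    · rintro rfl j hj
      have h1 := R.lt_of_gateArc hj
      have h2 := (R.gateArc_iff.1 hj).1
      omega

theorem toCircuit_length : R.toCircuit.gates.length = R.numVertices := by
  simp [toCircuit, gates]

theorem toCircuit_inputs : R.toCircuit.inputs = Finset.range R.n := by
  ext q
  simp only [Circuit.inputs, Finset.mem_filter, Finset.mem_range, toCircuit_length]
  change _ ∧ R.gates[q]? = _ ↔ _
  rw [getElem?_gates]
  constructor
  · rintro ⟨h1, -, h2⟩
    by_contra h3
    obtain ⟨t, i, -, hi, rfl⟩ := R.exists_addr (Nat.le_of_not_lt h3) h1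
    rw [R.gateAt_addr t hi] at h2
    exact (R.rowGate_preds hi).2.2.2.2.2 h2
  · intro h
    have : q < R.numVertices := by unfold numVertices; omega
    exact ⟨this, this, R.gateAt_of_lt h⟩

theorem toCircuit_fanIn {Δ : ℕ} (hΔ : 2 ≤ Δ) : R.toCircuit.FanInAtMost Δ := by
  intro g hg
  obtain ⟨q, hq⟩ := List.getElem?_of_mem hg
  obtain ⟨h1, rfl⟩ := R.getElem?_gates.1 hq
  exact (R.gateAt_preds h1).2.2.2.trans hΔ

theorem toCircuit_size_le : R.toCircuit.size ≤ 2 * R.numVertices := by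
  have := List.sum_le_card_nsmul (R.toCircuit.gates.map fun g => g.preds.length) 2 (by
    intro m hm
    obtain ⟨g, hg, rfl⟩ := List.mem_map.1 hm
    exact R.toCircuit_fanIn le_rfl g hg)
  rw [List.length_map, toCircuit_length] at this
  simpa [Circuit.size, Nat.mul_comm] using this

theorem IsMonotone.toCircuit {R : RegProg} (h : R.IsMonotone) : R.toCircuit.IsMonotone := by
  intro g hg j
  obtain ⟨q, hq⟩ := List.getElem?_of_mem hg
  obtain ⟨h1, rfl⟩ := R.getElem?_gates.1 hq
  rcases Nat.lt_or_ge q R.n with h2 | h2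
  · simp [R.gateAt_of_lt h2]
  · obtain ⟨t, i, -, hi, rfl⟩ := R.exists_addr h2 h1
    rw [R.gateAt_addr t hi, rowGate]
    split_ifs with h3 h4
    any_goals simp
    have h5 := h _ (R.instr_mem (t := t - 1) (by omega))
    unfold instrGate
    split_ifs
    any_goals simp
    omega

/-- The value of a vertex. -/
def value (x : ℕ → Bool) (q : ℕ) : Bool :=
  if q < R.n then x q else
    let t := (q - R.n) / R.W
    let i := (q - R.n) % R.W
    if t ≤ R.code.length then R.state x t i
    else if t = R.code.length + 1 then R.state x R.code.length i || R.state x R.code.length 0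
    else R.state x R.code.length 0

theorem value_of_lt (x : ℕ → Bool) {q : ℕ} (h : q < R.n) : R.value x q = x q := if_pos h

theorem value_addr (x : ℕ → Bool) (t : ℕ) {i : ℕ} (hi : i < R.W) : R.value x (R.addr t i) =
    if t ≤ R.code.length then R.state x t i
    else if t = R.code.length + 1 then R.state x R.code.length i || R.state x R.code.length 0
    else R.state x R.code.length 0 := by
  have h1 : R.addr t i - R.n = i + R.W * t := by rw [addr, Nat.mul_comm]; omega
  have h2 : ¬ R.addr t i < R.n := by rw [addr]; omega
  rw [value, if_neg h2, h1, Nat.add_mul_div_left _ _ R.W_pos, Nat.div_eq_of_lt hi,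
    Nat.add_mul_mod_self_left, Nat.mod_eq_of_lt hi, Nat.zero_add]

theorem isValuation (x : ℕ → Bool) : R.toCircuit.IsValuation x (R.value x) := by
  intro q g hg
  obtain ⟨h1, rfl⟩ := R.getElem?_gates.1 hg
  have hn := R.n_pos
  rcases Nat.lt_or_ge q R.n with h2 | h2
  · rw [R.gateAt_of_lt h2, R.value_of_lt x h2]; rfl
  · obtain ⟨t, i, ht, hi, rfl⟩ := R.exists_addr h2 h1
    rw [R.gateAt_addr t hi, R.value_addr x t hi]
    cases t with
    | zero =>
      simp [rowGate, Gate.Computes, R.value_of_lt x hn, state, Instr.run]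
    | succ t =>
      rw [rowGate, if_neg (Nat.succ_ne_zero t), Nat.add_sub_cancel]
      by_cases h3 : t + 1 ≤ R.code.length
      · rw [if_pos h3, if_pos h3, R.state_succ x (by omega)]
        have hwf := R.wf _ (R.instr_mem (t := t) (by omega))
        have hy : R.value x (R.srcAddr t (R.instr t)) =
            Instr.operand R.n x (R.state x t) (R.instr t).src := by
          unfold Instr.operand srcAddr
          split_ifs with h
          · exact R.value_of_lt x h
          · rw [R.value_addr x t (by have := hwf.2.1; omega), if_pos (by omega)]
        have hp : R.value x (R.addr t i) = R.state x t i := by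
          rw [R.value_addr x t hi, if_pos (by omega)]
        unfold instrGate Instr.step
        by_cases h4 : (R.instr t).tgt = i
        · subst h4
          simp only [if_true, Function.update_self]
          split_ifs <;> simp only [Gate.Computes, List.all_cons, List.any_cons, List.all_nil,
            List.any_nil, Bool.and_true, Bool.or_false, hp] <;> simp_all
        · rw [if_neg h4, Function.update_of_ne (Ne.symm h4)]
          simp [Gate.Computes, hp]
      · rw [if_neg h3, if_neg h3]
        by_cases h4 : t + 1 = R.code.length + 1
        · obtain rfl : t = R.code.length := by omega
          have hp : ∀ j < R.W, R.value x (R.addr R.code.length j) = R.state x R.code.length j := by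
            intro j hj
            rw [R.value_addr x _ hj, if_pos le_rfl]
          rw [if_pos rfl, if_pos rfl]
          split_ifs with h5
          · subst h5; simp [Gate.Computes, hp 0 hi]
          · simp [Gate.Computes, hp i hi, hp 0 R.W_pos]
        · obtain rfl : t = R.code.length + 1 := by omega
          have hp : ∀ j < R.W, R.value x (R.addr (R.code.length + 1) j) =
              (R.state x R.code.length j || R.state x R.code.length 0) := by
            intro j hj
            rw [R.value_addr x _ hj, if_neg (by omega), if_pos rfl]
          have hp' : ∀ j < R.W, R.value x (R.addr (R.code.length + 1 + 1) j) =
              R.state x R.code.length 0 := by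
            intro j hj
            rw [R.value_addr x _ hj, if_neg (by omega), if_neg (by omega)]
          rw [if_neg h4, if_neg h4]
          split_ifs with h5
          · subst h5; simp [Gate.Computes, hp 0 hi]
          · simp only [Gate.Computes, List.all_cons, List.all_nil, hp i hi,
              hp' (i - 1) (by omega)]
            -- Absorption: `(r i ∨ r 0) ∧ r 0 = r 0`.
            cases R.state x R.code.length i <;> cases R.state x R.code.length 0 <;> rfl

theorem toCircuit_accepts (x : ℕ → Bool) : R.toCircuit.Accepts x ↔ R.Accepts x := by
  have hv := R.isValuation x
  have hout : R.value x R.toCircuit.out = Instr.run R.n x (fun _ => x 0) R.code 0 := by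
    have hW := R.W_pos
    have : R.toCircuit.out = R.addr (R.code.length + 2) (R.W - 1) := by
      change R.numVertices - 1 = _
      unfold numVertices addr
      have : (R.code.length + 3) * R.W = (R.code.length + 2) * R.W + R.W := by ring
      omega
    rw [this, R.value_addr x _ (by omega), if_neg (by omega), if_neg (by omega), state,
      List.take_length]
  constructor
  · rintro ⟨v, hv', h⟩
    rw [Circuit.isValuation_unique hv' hv R.toCircuit.out_lt, hout] at h
    exact h
  · intro h
    exact ⟨_, hv, by rw [hout]; exact h⟩

/-- The program as an input word. -/
def encode : List ℕ :=
  R.n :: R.W :: R.code.flatMap fun I => [I.op, I.tgt, I.src]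

end RegProg

/-! ### Reading an instance from inside nested loops; computable gates -/

namespace RAM

/-- The context `Δ` extends the context `Γ`. -/
structure Base {Γ Δ : Type} [Ctx Γ] [Ctx Δ] (β : Δ → Γ) : Prop where
  word : ∀ δ, Ctx.word δ = Ctx.word (β δ)
  size : ∀ δ, Ctx.size δ = Ctx.size (β δ)
  slot : ∀ i < Ctx.vars Γ, Comp (fun δ => Ctx.slot i (β δ))

variable {Γ Δ : Type} [Ctx Γ] [Ctx Δ] {β : Δ → Γ}

theorem Base.id : Base (fun γ : Γ => γ) := ⟨fun _ => rfl, fun _ => rfl, Comp.slot⟩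

/-- Facts about reading an instance are stated for any context that extends it, and this lemma makes
them available under any nesting of loops. -/
theorem Base.fst (h : Base β) : Base (fun p : Δ × ℕ => β p.1) :=
  ⟨fun p => h.word p.1, fun p => h.size p.1, fun i hi => (h.slot i hi).fst⟩

theorem Base.get (h : Base β) {t : Δ → ℕ} (ht : Comp t) :
    Comp (fun δ => (Ctx.word (β δ)).getD (t δ) 0) :=
  ht.get.congr fun δ => by rw [h.word]

theorem Base.bdd (h : Base β) {g : Γ → ℕ} (hg : PolyBdd g) : PolyBdd (fun δ => g (β δ)) := by
  obtain ⟨c, e, hc⟩ := hg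
  exact ⟨c, e, fun δ => by rw [h.size]; exact hc (β δ)⟩

/-- A gate that depends on the context is computable in polynomial time. -/
def CompG (g : Γ → Gate) : Prop := CompL fun γ => (g γ).encode

namespace CompG

theorem input : CompG (fun _ : Γ => Gate.input) :=
  .cons (.const 0) (.cons (.const 0) .nil)

theorem not {a : Γ → ℕ} (ha : Comp a) : CompG (fun γ => Gate.not (a γ)) :=
  .cons (.const 3) (.cons (.const 1) (.cons ha .nil))

theorem or₁ {a : Γ → ℕ} (ha : Comp a) : CompG (fun γ => Gate.or [a γ]) :=
  .cons (.const 2) (.cons (.const 1) (.cons ha .nil))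

theorem or₂ {a b : Γ → ℕ} (ha : Comp a) (hb : Comp b) : CompG (fun γ => Gate.or [a γ, b γ]) :=
  .cons (.const 2) (.cons (.const 2) (.cons ha (.cons hb .nil)))

theorem and₂ {a b : Γ → ℕ} (ha : Comp a) (hb : Comp b) : CompG (fun γ => Gate.and [a γ, b γ]) :=
  .cons (.const 1) (.cons (.const 2) (.cons ha (.cons hb .nil)))

theorem ite {p : Γ → Prop} [DecidablePred p] {f g : Γ → Gate} (hp : CompP p) (hf : CompG f)
    (hg : CompG g) : CompG (fun γ => if p γ then f γ else g γ) :=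
  (CompL.ite hp hf hg).congr fun γ => by beta_reduce; split_ifs <;> rfl

end CompG

/-- Constant block length allows random access without scanning. It serves for instructions (three
letters) and for literals (two letters). -/
theorem getD_flatMap {α : Type} {f : α → List ℕ} {m : ℕ} (hf : ∀ a, (f a).length = m)
    (l : List α) {t j : ℕ} (hj : j < m) (ht : t < l.length) :
    (l.flatMap f).getD (m * t + j) 0 = (f l[t]).getD j 0 := by
  induction l generalizing t with
  | nil => simp at ht
  | cons a l ih =>
    rw [List.flatMap_cons]
    cases t with
    | zero => rw [List.getD_append _ _ _ _ (by rw [hf]; omega)]; simp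
    | succ t =>
      rw [List.getD_append_right _ _ _ _ (by rw [hf]; nlinarith), hf,
        show m * (t + 1) + j - m = m * t + j by rw [Nat.mul_succ]; omega,
        ih (by simpa using ht)]
      simp

end RAM

/-! ### The circuit of a register program is computable in polynomial time -/

/-- A register program, together with a number. -/
structure RegInst : Type where
  prog : RegProg
  k : ℕ

/-- The number `k` is not part of the word. It is the value of the only variable, hence a constant
of the program built by `exists_reduction`. -/
instance : RAM.Ctx RegInst where
  word R := R.prog.encode
  size R := R.prog.n + R.prog.W + R.prog.code.length
  vars := 1
  slot _ R := R.k

namespace RegInst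

open RAM

variable {Δ : Type} [Ctx Δ] {β : Δ → RegInst}

theorem bdd_n : PolyBdd (fun R : RegInst => R.prog.n) :=
  .of_le fun R => by simp only [Ctx.size]; omega

theorem bdd_W : PolyBdd (fun R : RegInst => R.prog.W) :=
  .of_le fun R => by simp only [Ctx.size]; omega

theorem bdd_length : PolyBdd (fun R : RegInst => R.prog.code.length) :=
  .of_le fun R => by simp only [Ctx.size]; omega

theorem bdd_numVertices : PolyBdd (fun R : RegInst => R.prog.numVertices) :=
  bdd_n.add ((bdd_length.add (.const 3)).mul bdd_W)

theorem comp_n (hβ : Base β) : Comp (fun δ => (β δ).prog.n) := hβ.get (.const 0)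

theorem comp_W (hβ : Base β) : Comp (fun δ => (β δ).prog.W) := hβ.get (.const 1)

/-- The encoding does not store the number of instructions; it is recovered from the length of the
word, with two header letters and three letters per instruction. -/
theorem comp_length (hβ : Base β) : Comp (fun δ => (β δ).prog.code.length) := by
  have h : ∀ δ, (Ctx.word δ).length = 2 + 3 * (β δ).prog.code.length := fun δ => by
    rw [hβ.word]
    change (_ :: _ :: List.flatMap _ _).length = _
    simp [Nat.mul_comm]; omega
  refine (Comp.div (Comp.wordLength.sub (.const 2)) ?_ (.const 3) (.const 3)).congr fun δ => ?_
  · exact ((PolyLE.const 3).mul (hβ.bdd bdd_length)).mono fun δ => by rw [h]; omega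
  · rw [h]; omega

theorem comp_field (hβ : Base β) {t : Δ → ℕ} (ht : Comp t) (j : ℕ) (hj : j < 3) :
    Comp (fun δ => [((β δ).prog.instr (t δ)).op, ((β δ).prog.instr (t δ)).tgt,
      ((β δ).prog.instr (t δ)).src].getD j 0) := by
  refine (Comp.ite (CompP.lt ht (comp_length hβ))
    (hβ.get ((Comp.const 2).add (((ht.add ht).add ht).add (.const j)))) (.const 0)).congr fun δ => ?_
  split_ifs with h
  · have h1 := getD_flatMap (f := fun I : Instr => [I.op, I.tgt, I.src]) (m := 3) (fun _ => rfl)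
      (β δ).prog.code hj h
    have h2 : (β δ).prog.instr (t δ) = (β δ).prog.code[t δ] := List.getD_eq_getElem _ _ h
    rw [h2, ← h1]
    have h3 : 2 + (t δ + t δ + t δ + j) = (3 * t δ + j) + 2 := by ring
    rw [h3]
    rfl
  · have h2 : (β δ).prog.instr (t δ) = ⟨0, 0, 0⟩ :=
      List.getD_eq_default _ _ (Nat.le_of_not_lt h)
    rw [h2]
    interval_cases j <;> rfl

theorem comp_addr (hβ : Base β) {t i : Δ → ℕ} (ht : Comp t) (hi : Comp i) :
    Comp (fun δ => (β δ).prog.addr (t δ) (i δ)) :=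
  ((comp_n hβ).add (Comp.mul' ht (comp_W hβ) (hβ.bdd bdd_W))).add hi

theorem compG_rowGate (hβ : Base β) {t i : Δ → ℕ} (ht : Comp t) (hi : Comp i) :
    CompG (fun δ => (β δ).prog.rowGate (t δ) (i δ)) := by
  have ht' : Comp (fun δ => t δ - 1) := ht.sub (.const 1)
  have h1 := comp_addr hβ ht' hi
  have hsrc := comp_field hβ ht' 2 (by omega)
  have hop := comp_field hβ ht' 0 (by omega)
  have h2 : Comp (fun δ => (β δ).prog.srcAddr (t δ - 1) ((β δ).prog.instr (t δ - 1))) :=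
    .ite (.lt hsrc (comp_n hβ)) hsrc (comp_addr hβ ht' (hsrc.sub (comp_n hβ)))
  exact .ite (.eq ht (.const 0)) (.or₁ (.const 0)) <|
    .ite (.le ht (comp_length hβ))
      (.ite (.eq (comp_field hβ ht' 1 (by omega)) hi)
        (.ite (.eq hop (.const 0)) (.and₂ h1 h2) (.ite (.eq hop (.const 1)) (.or₂ h1 h2) (.not h1)))
        (.or₁ h1)) <|
    .ite (.eq ht ((comp_length hβ).add (.const 1)))
      (.ite (.eq hi (.const 0)) (.or₁ h1) (.or₂ h1 (comp_addr hβ ht' (.const 0)))) <|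
    .ite (.eq hi (.const 0)) (.or₁ h1) (.and₂ h1 (comp_addr hβ ht (hi.sub (.const 1))))

theorem comp_numVertices (hβ : Base β) : Comp (fun δ => (β δ).prog.numVertices) :=
  (comp_n hβ).add (Comp.mul' ((comp_length hβ).add (.const 3)) (comp_W hβ) (hβ.bdd bdd_W))

theorem compL_encode : CompL (fun R : RegInst => R.prog.toCircuit.encode) := by
  -- Division needs a bounded dividend, whereas the loop variable is arbitrary in the extended
  -- context. The clamp has no effect on the indices that occur.
  have hq : Comp (fun p : RegInst × ℕ => Min.min p.2 p.1.prog.numVertices - p.1.prog.n) :=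
    (Comp.snd.min (comp_numVertices Base.id.fst)).sub (comp_n Base.id.fst)
  have pq : PolyBdd (fun p : RegInst × ℕ => Min.min p.2 p.1.prog.numVertices - p.1.prog.n) :=
    (PolyBdd.fst bdd_numVertices).mono fun p => by omega
  have hW := comp_W (Base.id (Γ := RegInst)).fst
  let g : RegInst → ℕ → Gate := fun R q => if q < R.prog.n then Gate.input else
      R.prog.rowGate ((Min.min q R.prog.numVertices - R.prog.n) / R.prog.W)
        ((Min.min q R.prog.numVertices - R.prog.n) % R.prog.W)
  have hg : CompG (fun p : RegInst × ℕ => g p.1 p.2) :=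
    .ite (.lt .snd (comp_n Base.id.fst)) .input (compG_rowGate Base.id.fst
      (hq.div pq hW (PolyBdd.fst bdd_W)) (hq.mod pq hW (PolyBdd.fst bdd_W)))
  have hn := comp_numVertices (Base.id (Γ := RegInst))
  refine (CompL.cons (hn.sub (.const 1)) (CompL.cons hn (CompL.flatMap hn bdd_numVertices
    (f := fun R q => (g R q).encode) hg))).congr
    fun R => ?_
  rw [Circuit.encode, R.prog.toCircuit_length]
  congr 2
  change _ = (List.map _ _).flatMap _
  rw [List.flatMap_map]
  refine List.flatMap_congr fun q hq => ?_
  rw [List.mem_range] at hq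
  simp only [g, min_eq_left hq.le]
  rfl

theorem compL_cons_encode : CompL (fun R : RegInst => R.k :: R.prog.toCircuit.encode) :=
  CompL.cons (Comp.slot 0 Nat.one_pos) compL_encode

end RegInst

/-! ### Unit propagation by a register program -/

namespace Instr

/-- `r_t := r_t ∧ r_j` -/
def andReg (n t j : ℕ) : Instr := ⟨0, t, n + j⟩

/-- `r_t := r_t ∨ r_j` -/
def orReg (n t j : ℕ) : Instr := ⟨1, t, n + j⟩

/-- `r_t := r_t ∧ x_j` -/
def andInput (t j : ℕ) : Instr := ⟨0, t, j⟩

/-- `r_t := r_t ∨ x_j` -/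
def orInput (t j : ℕ) : Instr := ⟨1, t, j⟩

/-- `r_t := ¬ r_t` -/
def neg (t : ℕ) : Instr := ⟨2, t, 0⟩

variable {n : ℕ} {x r : ℕ → Bool}

@[simp] theorem step_andReg (t j : ℕ) :
    step n x r (andReg n t j) = Function.update r t (r t && r j) := by
  simp [step, andReg, operand]

@[simp] theorem step_orReg (t j : ℕ) :
    step n x r (orReg n t j) = Function.update r t (r t || r j) := by
  simp [step, orReg, operand]

theorem step_andInput (t : ℕ) {j : ℕ} (hj : j < n) :
    step n x r (andInput t j) = Function.update r t (r t && x j) := by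
  simp [step, andInput, operand, hj]

theorem step_orInput (t : ℕ) {j : ℕ} (hj : j < n) :
    step n x r (orInput t j) = Function.update r t (r t || x j) := by
  simp [step, orInput, operand, hj]

@[simp] theorem step_neg (t : ℕ) : step n x r (neg t) = Function.update r t (!r t) := by
  simp [step, neg]

@[simp] theorem run_nil : run n x r [] = r := rfl

@[simp] theorem run_cons (I : Instr) (l : List Instr) :
    run n x r (I :: l) = run n x (step n x r I) l := rfl

theorem run_orReg (t : ℕ) (s : List ℕ) (hs : ∀ j ∈ s, j ≠ t) :
    run n x r (s.map (orReg n t)) = Function.update r t (r t || s.any r) := by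
  induction s generalizing r with
  | nil => simp
  | cons j s ih =>
    rw [List.map_cons, run_cons, step_orReg, ih (fun i hi => hs i (by simp [hi]))]
    have : s.any (Function.update r t (r t || r j)) = s.any r := by
      rw [Bool.eq_iff_iff, List.any_eq_true, List.any_eq_true]
      refine exists_congr fun i => and_congr_right fun hi => ?_
      rw [Function.update_of_ne (hs i (by simp [hi]))]
    simp [this, Bool.or_assoc]

theorem run_orInput (t : ℕ) (s : List ℕ) (hs : ∀ j ∈ s, j < n) :
    run n x r (s.map (orInput t)) = Function.update r t (r t || s.any x) := by
  induction s generalizing r with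
  | nil => simp
  | cons j s ih =>
    rw [List.map_cons, run_cons, step_orInput _ (hs j (by simp)),
      ih (fun i hi => hs i (by simp [hi]))]
    simp [Bool.or_assoc]

theorem run_andInput (t : ℕ) (s : List ℕ) (hs : ∀ j ∈ s, j < n) :
    run n x r (s.map (andInput t)) = Function.update r t (r t && s.all x) := by
  induction s generalizing r with
  | nil => simp
  | cons j s ih =>
    rw [List.map_cons, run_cons, step_andInput _ (hs j (by simp)),
      ih (fun i hi => hs i (by simp [hi]))]
    simp [Bool.and_assoc]

/-- Registers that are no targets keep their values. -/
theorem run_of_forall_ne {l : List Instr} {q : ℕ} (h : ∀ I ∈ l, I.tgt ≠ q) :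
    run n x r l q = r q := by
  induction l generalizing r with
  | nil => rfl
  | cons I l ih =>
    rw [run_cons, ih (fun J hJ => h J (by simp [hJ])), step,
      Function.update_of_ne (h I (by simp)).symm]

/-- A register that is only changed by conjunctions can only become False. -/
theorem of_run {l : List Instr} {q : ℕ} (h : ∀ I ∈ l, I.tgt = q → I.op = 0)
    (hr : run n x r l q = true) : r q = true := by
  induction l generalizing r with
  | nil => exact hr
  | cons I l ih =>
    have := ih (fun J hJ => h J (by simp [hJ])) hr
    rw [step] at this
    by_cases hq : I.tgt = q
    · rw [← hq, Function.update_self, if_pos (h I (by simp) hq)] at this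
      rw [← hq]
      exact (Bool.and_eq_true_iff.1 this).1
    · rwa [Function.update_of_ne (Ne.symm hq)] at this

end Instr

namespace CNF

open Instr

/-! Register `0` contains the result, register `1` is an accumulator, registers `2` and `3` contain
True and False, register `4 + 2 * v` tells whether the variable `v` may be False, and register
`5 + 2 * v` whether it may be True (for the variables of the backdoor). -/

/-- The register that tells whether a literal may be satisfied. -/
def litReg (l : Literal) : ℕ := if l.2 then 5 + 2 * l.1 else 4 + 2 * l.1

/-- Positive literals outside of the backdoor are derived by unit propagation. -/
def IsHead (B : List ℕ) (l : Literal) : Prop := l.2 = true ∧ l.1 ∉ B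

instance (B : List ℕ) (l : Literal) : Decidable (IsHead B l) :=
  inferInstanceAs (Decidable (_ ∧ _))

/-- Accumulate whether a clause can be satisfied without its heads. -/
def bodyCode (n : ℕ) (B : List ℕ) (c : Clause) : List Instr :=
  andReg n 1 3 :: c.map fun l => orReg n 1 (if IsHead B l then 3 else litReg l)

/-- If the accumulator is False, then the heads of the clause cannot be False. -/
def headCode (n : ℕ) (B : List ℕ) (c : Clause) : List Instr :=
  c.map fun l => if IsHead B l then andReg n (4 + 2 * l.1) 1 else orReg n 1 3

/-- Check a clause at the end of the propagation. -/
def checkCode (n : ℕ) (B : List ℕ) (c : Clause) : List Instr :=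
  (andReg n 1 3 :: c.map fun l => orReg n 1 (if IsHead B l then 2 else litReg l)) ++ [andReg n 0 1]

def roundCode (n : ℕ) (B : List ℕ) (cs : List Clause) : List Instr :=
  cs.flatMap fun c => bodyCode n B c ++ headCode n B c

def hornCode (n : ℕ) (φ : CNF) (B : List ℕ) : List Instr :=
  ((List.range φ.numVars).flatMap fun _ => roundCode n B φ.clauses) ++
    φ.clauses.flatMap (checkCode n B)

variable {n : ℕ} {B : List ℕ} {x r : ℕ → Bool}

/-- The clause can be satisfied without its heads. -/
def bodySat (B : List ℕ) (r : ℕ → Bool) (c : Clause) : Prop :=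
  ∃ l ∈ c, ¬ IsHead B l ∧ r (litReg l) = true

theorem litReg_ge (l : Literal) : 4 ≤ litReg l := by unfold litReg; split_ifs <;> omega

/-- Conjunction with register 3 resets the accumulator, and every head is replaced by the False
register 3. So only the literals that are not heads contribute. -/
theorem run_body (hF : r 3 = false) (c : Clause) : ∃ a, (a = true ↔ bodySat B r c) ∧
    run n x r (bodyCode n B c) = Function.update r 1 a := by
  refine ⟨(c.map fun l => if IsHead B l then 3 else litReg l).any (Function.update r 1 false),
    ?_, ?_⟩
  rotate_left
  · rw [bodyCode, run_cons, step_andReg, hF, Bool.and_false,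
      ← Function.comp_def (orReg n 1), ← List.map_map, run_orReg, Function.update_idem,
      Function.update_self, Bool.false_or]
    intro j hj
    obtain ⟨l, -, rfl⟩ := List.mem_map.1 hj
    have := litReg_ge l
    split_ifs <;> omega
  · simp only [List.any_map, List.any_eq_true,
      Function.comp_apply, bodySat]
    refine exists_congr fun l => and_congr_right fun hl => ?_
    have := litReg_ge l
    by_cases h : IsHead B l
    · simp [h, hF]
    · rw [if_neg h, Function.update_of_ne (by omega)]; simp [h]

theorem run_check (hT : r 2 = true) (hF : r 3 = false) (c : Clause) :
    ∃ a, (a = true ↔ bodySat B r c ∨ ∃ l ∈ c, IsHead B l) ∧ run n x r (checkCode n B c) =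
      Function.update (Function.update r 1 a) 0 (r 0 && a) := by
  refine ⟨(c.map fun l => if IsHead B l then 2 else litReg l).any (Function.update r 1 false),
    ?_, ?_⟩
  rotate_left
  · have inner : run n x r (andReg n 1 3 :: c.map fun l =>
        orReg n 1 (if IsHead B l then 2 else litReg l)) = Function.update r 1
          ((c.map fun l => if IsHead B l then 2 else litReg l).any (Function.update r 1 false)) := by
      rw [run_cons, step_andReg, hF, Bool.and_false,
        ← Function.comp_def (orReg n 1), ← List.map_map, run_orReg, Function.update_idem,
        Function.update_self, Bool.false_or]
      intro j hj
      obtain ⟨l, -, rfl⟩ := List.mem_map.1 hj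
      have := litReg_ge l
      split_ifs <;> omega
    rw [checkCode, run_append, inner, run_cons, step_andReg, run_nil,
      Function.update_of_ne (by decide), Function.update_self]
  · simp only [List.any_map, List.any_eq_true,
      Function.comp_apply, bodySat, ← exists_or, ← and_or_left]
    refine exists_congr fun l => and_congr_right fun hl => ?_
    have := litReg_ge l
    by_cases h : IsHead B l
    · simp [h, hT]
    · rw [if_neg h, Function.update_of_ne (by omega)]; simp [h]

/-- A literal that is no head yields the void instruction `r 1 := r 1 ∨ False`, so each literal
costs one instruction. Register 1 keeps its value throughout, and all heads see the same
accumulator. -/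
theorem run_head (hF : r 3 = false) (c : Clause) (q : ℕ) : run n x r (headCode n B c) q =
    if ∃ l ∈ c, IsHead B l ∧ q = 4 + 2 * l.1 then r q && r 1 else r q := by
  induction c generalizing r with
  | nil => simp [headCode]
  | cons l c ih =>
    have hc : headCode n B (l :: c) = (if IsHead B l then andReg n (4 + 2 * l.1) 1
      else orReg n 1 3) :: headCode n B c := rfl
    rw [hc, run_cons]
    by_cases h : IsHead B l
    · rw [if_pos h, step_andReg]
      rw [ih (by rw [Function.update_of_ne (by omega)]; exact hF)]
      by_cases hq : q = 4 + 2 * l.1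
      · subst hq
        simp [h, Function.update_of_ne (show 1 ≠ 4 + 2 * l.1 by omega)]
      · have : (∃ l' ∈ l :: c, IsHead B l' ∧ q = 4 + 2 * l'.1) ↔
            ∃ l' ∈ c, IsHead B l' ∧ q = 4 + 2 * l'.1 := by
          simp only [List.mem_cons, or_and_right, exists_or, exists_eq_left]; tauto
        simp only [this, Function.update_of_ne hq,
          Function.update_of_ne (show 1 ≠ 4 + 2 * l.1 by omega)]
    · have h1 : Function.update r 1 (r 1 || r 3) = r := by rw [hF]; simp
      have : (∃ l' ∈ l :: c, IsHead B l' ∧ q = 4 + 2 * l'.1) ↔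
          ∃ l' ∈ c, IsHead B l' ∧ q = 4 + 2 * l'.1 := by
        simp only [List.mem_cons, or_and_right, exists_or, exists_eq_left]; tauto
      rw [if_neg h, step_orReg, h1, ih hF]
      simp only [this]

/-- The effect of one clause in a round. -/
theorem run_clause (hF : r 3 = false) (c : Clause) {q : ℕ} (hq : q ≠ 1) :
    ∃ a, (a = true ↔ bodySat B r c) ∧ run n x r (bodyCode n B c ++ headCode n B c) q =
      if ∃ l ∈ c, IsHead B l ∧ q = 4 + 2 * l.1 then r q && a else r q := by
  obtain ⟨a, ha, hr⟩ := run_body (n := n) (x := x) (B := B) hF c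
  refine ⟨a, ha, ?_⟩
  rw [run_append, hr, run_head (by rw [Function.update_of_ne (by decide)]; exact hF)]
  simp [hq]

theorem bodySat_congr {r' : ℕ → Bool} (h : ∀ q, q ≠ 1 → r' q = r q) (c : Clause) :
    bodySat B r' c ↔ bodySat B r c := by
  refine exists_congr fun l => and_congr_right fun _ => and_congr_right fun _ => ?_
  have := litReg_ge l
  rw [h _ (by omega)]

/-- The registers describe the assignment `τ` to the backdoor. -/
structure Represents (B : List ℕ) (τ r : ℕ → Bool) : Prop where
  true : r 2 = true
  false : r 3 = false
  neg : ∀ v ∈ B, r (4 + 2 * v) = !τ v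
  pos : ∀ v ∈ B, r (5 + 2 * v) = τ v

/-- Propagation and checks change only the result, the accumulator and the "may be False" registers
of variables outside the backdoor, none of which occur in `Represents`. -/
theorem Represents.congr {τ r' : ℕ → Bool} (h : Represents B τ r)
    (hr : ∀ q, q ≠ 0 → q ≠ 1 → (∀ v, v ∉ B → q ≠ 4 + 2 * v) → r' q = r q) :
    Represents B τ r' := by
  refine ⟨?_, ?_, fun v hv => ?_, fun v hv => ?_⟩
  · rw [hr _ (by omega) (by omega) (fun _ _ => by omega), h.true]
  · rw [hr _ (by omega) (by omega) (fun _ _ => by omega), h.false]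
  · rw [hr _ (by omega) (by omega), h.neg v hv]
    intro w hw hvw
    obtain rfl : v = w := by omega
    exact hw hv
  · rw [hr _ (by omega) (by omega) (fun _ _ => by omega), h.pos v hv]

theorem Represents.clause {τ : ℕ → Bool} (h : Represents B τ r) (c : Clause) :
    Represents B τ (run n x r (bodyCode n B c ++ headCode n B c)) := by
  refine h.congr fun q _ h1 hv => ?_
  obtain ⟨a, -, ha⟩ := run_clause (n := n) (x := x) (B := B) h.false c h1
  rw [ha, if_neg]
  rintro ⟨l, -, hl, rfl⟩
  exact hv _ hl.2 rfl

theorem Represents.round {τ : ℕ → Bool} (h : Represents B τ r) (cs : List Clause) :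
    Represents B τ (run n x r (roundCode n B cs)) := by
  induction cs generalizing r with
  | nil => exact h
  | cons c cs ih =>
    rw [roundCode, List.flatMap_cons, run_append]
    exact ih (h.clause c)

theorem Represents.check {τ : ℕ → Bool} (h : Represents B τ r) (c : Clause) :
    Represents B τ (run n x r (checkCode n B c)) := by
  refine h.congr fun q h0 h1 _ => ?_
  obtain ⟨a, -, ha⟩ := run_check (n := n) (x := x) (B := B) h.true h.false c
  rw [ha, Function.update_of_ne h0, Function.update_of_ne h1]

/-- The final checks compute whether all clauses can be satisfied. -/
theorem run_checks {τ : ℕ → Bool} (h : Represents B τ r) (cs : List Clause) :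
    run n x r (cs.flatMap (checkCode n B)) 0 = true ↔
      r 0 = true ∧ ∀ c ∈ cs, bodySat B r c ∨ ∃ l ∈ c, IsHead B l := by
  induction cs generalizing r with
  | nil => simp
  | cons c cs ih =>
    rw [List.flatMap_cons, run_append, ih (h.check c)]
    obtain ⟨a, h1, ha⟩ := run_check (n := n) (x := x) (B := B) h.true h.false c
    have hb : ∀ c', bodySat B (run n x r (checkCode n B c)) c' ↔ bodySat B r c' := by
      intro c'
      refine exists_congr fun l => and_congr_right fun _ => and_congr_right fun _ => ?_
      have := litReg_ge l
      rw [ha, Function.update_of_ne (by omega), Function.update_of_ne (by omega)]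
    have h0 : run n x r (checkCode n B c) 0 = (r 0 && a) := by rw [ha, Function.update_self]
    simp only [hb, h0, Bool.and_eq_true, h1, List.forall_mem_cons]
    tauto

/-- The variables that are False in `τ` may be False. -/
def Sound (V : ℕ) (τ r : ℕ → Bool) : Prop := ∀ v < V, τ v = false → r (4 + 2 * v) = true

theorem litReg_of_sound {V : ℕ} {τ : ℕ → Bool} (h : Represents B τ r) (hs : Sound V τ r)
    {l : Literal} (hV : l.1 < V) (hl : ¬ IsHead B l) (hτ : τ l.1 = l.2) : r (litReg l) = true := by
  obtain ⟨v, s⟩ := l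
  cases s with
  | false => exact hs v hV hτ
  | true =>
    have hv : v ∈ B := by by_contra hv; exact hl ⟨rfl, hv⟩
    rw [litReg, if_pos rfl, h.pos v hv]; exact hτ

/-- Soundness of one propagation step, and the place where the Horn property enters. If the
accumulator is False, then no literal other than a head is true in `τ`, so `τ` satisfies the clause
by a head. The clause survives the restriction to `τ` and contains at most one positive literal
outside `B`, so that head is the one being set, and its variable is indeed True in `τ`. -/
theorem Sound.clause {φ : CNF} (hB : φ.IsStrongHornBackdoor B) {τ : ℕ → Bool}
    (hτ : ∀ c ∈ φ.clauses, ∃ l ∈ c, τ l.1 = l.2) (h : Represents B τ r) (hs : Sound φ.numVars τ r)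
    {c : Clause} (hc : c ∈ φ.clauses) :
    Sound φ.numVars τ (run n x r (bodyCode n B c ++ headCode n B c)) := by
  intro v hvV hv
  obtain ⟨a, h1, ha⟩ := run_clause (n := n) (x := x) (B := B) h.false c
    (show 4 + 2 * v ≠ 1 by omega)
  rw [ha]
  split_ifs with hh
  · rw [hs v hvV hv, Bool.true_and, h1]
    obtain ⟨l, hl, hlB, hlv⟩ := hh
    obtain rfl : v = l.1 := by omega
    by_contra hsat
    have hns : ∀ l' ∈ c, τ l'.1 = l'.2 → IsHead B l' := by
      intro l' hl' h2
      by_contra h3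
      exact hsat ⟨l', hl', h3, litReg_of_sound h hs (φ.var_lt c hc l' hl') h3 h2⟩
    obtain ⟨l', hl', h2⟩ := hτ c hc
    have h3 := hns l' hl' h2
    -- No literal over `B` is true in `τ`, as it would not be a head; hence the clause is not
    -- dropped. Heads are positive and outside `B`, so both of them remain.
    have h4 := hB.2.2 τ (c.filter fun l => l.1 ∉ B) (by
      refine List.mem_map.2 ⟨c, List.mem_filter.2 ⟨hc, ?_⟩, rfl⟩
      simp only [decide_eq_true_eq]
      intro l'' hl'' h5
      exact (hns l'' hl'' h5.2).2 h5.1) l.1 l'.1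
      (List.mem_filter.2 ⟨by rw [← hlB.1]; exact hl, by simpa using hlB.2⟩)
      (List.mem_filter.2 ⟨by rw [← h3.1]; exact hl', by simpa using h3.2⟩)
    rw [h4, h2, h3.1] at hv
    exact Bool.noConfusion hv
  · exact hs v hvV hv

theorem Sound.round {φ : CNF} (hB : φ.IsStrongHornBackdoor B) {τ : ℕ → Bool}
    (hτ : ∀ c ∈ φ.clauses, ∃ l ∈ c, τ l.1 = l.2) (h : Represents B τ r) (hs : Sound φ.numVars τ r)
    {cs : List Clause} (hcs : cs ⊆ φ.clauses) : Sound φ.numVars τ (run n x r (roundCode n B cs)) := by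
  induction cs generalizing r with
  | nil => exact hs
  | cons c cs ih =>
    rw [roundCode, List.flatMap_cons, run_append]
    exact ih (h.clause c) (hs.clause hB hτ h (hcs (by simp))) fun c' hc' => hcs (by simp [hc'])

/-- Unit propagation yields nothing new for the clause `c`. -/
def ClosedAt (B : List ℕ) (r : ℕ → Bool) (c : Clause) : Prop :=
  ∀ l ∈ c, IsHead B l → r (4 + 2 * l.1) = true → bodySat B r c

/-- The number of variables that may be False. -/
def potential (V : ℕ) (r : ℕ → Bool) : ℕ :=
  ((Finset.range V).filter fun v => r (4 + 2 * v) = true).card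

theorem potential_le {V : ℕ} {r' : ℕ → Bool} (h : ∀ q, q ≠ 1 → r' q = true → r q = true) :
    potential V r' ≤ potential V r :=
  Finset.card_le_card (Finset.monotone_filter_right _ fun v _ => h _ (by omega))

theorem potential_lt {V v : ℕ} {r' : ℕ → Bool} (h : ∀ q, q ≠ 1 → r' q = true → r q = true)
    (hv : v < V) (h1 : r (4 + 2 * v) = true) (h2 : r' (4 + 2 * v) = false) :
    potential V r' < potential V r := by
  refine Finset.card_lt_card ⟨Finset.monotone_filter_right _ fun v _ => h _ (by omega), fun hsub => ?_⟩
  have := hsub (Finset.mem_filter.2 ⟨Finset.mem_range.2 hv, h1⟩)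
  rw [Finset.mem_filter, h2] at this
  exact Bool.noConfusion this.2

theorem clause_le {τ : ℕ → Bool} (h : Represents B τ r) (c : Clause) {q : ℕ} (hq : q ≠ 1)
    (hr : run n x r (bodyCode n B c ++ headCode n B c) q = true) : r q = true := by
  obtain ⟨a, -, ha⟩ := run_clause (n := n) (x := x) (B := B) h.false c hq
  rw [ha] at hr
  split_ifs at hr
  · exact (Bool.and_eq_true_iff.1 hr).1
  · exact hr

theorem round_le {τ : ℕ → Bool} (h : Represents B τ r) (cs : List Clause) {q : ℕ} (hq : q ≠ 1)
    (hr : run n x r (roundCode n B cs) q = true) : r q = true := by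
  induction cs generalizing r with
  | nil => exact hr
  | cons c cs ih =>
    rw [roundCode, List.flatMap_cons, run_append] at hr
    exact clause_le h c hq (ih (h.clause c) hr)

theorem clause_of_closedAt {τ : ℕ → Bool} (h : Represents B τ r) {c : Clause}
    (hc : ClosedAt B r c) {q : ℕ} (hq : q ≠ 1) :
    run n x r (bodyCode n B c ++ headCode n B c) q = r q := by
  obtain ⟨a, h1, ha⟩ := run_clause (n := n) (x := x) (B := B) h.false c hq
  rw [ha]
  split_ifs with hh
  · obtain ⟨l, hl, hlB, rfl⟩ := hh
    cases hr : r (4 + 2 * l.1) with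
    | false => rfl
    | true => rw [h1.2 (hc l hl hlB hr)]; rfl
  · rfl

theorem ClosedAt.congr {r' : ℕ → Bool} (h : ∀ q, q ≠ 1 → r' q = r q) {c : Clause}
    (hc : ClosedAt B r c) : ClosedAt B r' c := by
  intro l hl hlB hr
  rw [h _ (by omega)] at hr
  exact (bodySat_congr h c).2 (hc l hl hlB hr)

theorem round_of_closedAt {τ : ℕ → Bool} (h : Represents B τ r) {cs : List Clause}
    (hc : ∀ c ∈ cs, ClosedAt B r c) {q : ℕ} (hq : q ≠ 1) :
    run n x r (roundCode n B cs) q = r q := by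
  induction cs generalizing r with
  | nil => rfl
  | cons c cs ih =>
    have heq : ∀ q, q ≠ 1 → run n x r (bodyCode n B c ++ headCode n B c) q = r q :=
      fun q hq => clause_of_closedAt h (hc c (by simp)) hq
    rw [roundCode, List.flatMap_cons, run_append]
    exact (ih (h.clause c) fun c' hc' => (hc c' (by simp [hc'])).congr heq).trans (heq q hq)

/-- A round either reaches a closed state or removes a variable. -/
theorem round_closed_or_lt {V : ℕ} {τ : ℕ → Bool} (h : Represents B τ r) (cs : List Clause)
    (hV : ∀ c ∈ cs, ∀ l ∈ c, l.1 < V) :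
    ((∀ q, q ≠ 1 → run n x r (roundCode n B cs) q = r q) ∧ ∀ c ∈ cs, ClosedAt B r c) ∨
      potential V (run n x r (roundCode n B cs)) < potential V r := by
  induction cs generalizing r with
  | nil => exact Or.inl ⟨fun _ _ => rfl, by simp⟩
  | cons c cs ih =>
    rw [roundCode, List.flatMap_cons, run_append]
    have hle : ∀ q, q ≠ 1 → run n x r (bodyCode n B c ++ headCode n B c) q = true → r q = true :=
      fun q hq => clause_le h c hq
    have hV' : ∀ c ∈ cs, ∀ l ∈ c, l.1 < V := fun c' hc' => hV c' (by simp [hc'])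
    by_cases hc : ClosedAt B r c
    · have heq : ∀ q, q ≠ 1 → run n x r (bodyCode n B c ++ headCode n B c) q = r q :=
        fun q hq => clause_of_closedAt h hc hq
      rcases ih (h.clause c) hV' with ⟨h1, h2⟩ | h1
      · refine Or.inl ⟨fun q hq => (h1 q hq).trans (heq q hq), ?_⟩
        intro c' hc'
        rcases List.mem_cons.1 hc' with rfl | hc'
        · exact hc
        · exact (h2 c' hc').congr fun q hq => (heq q hq).symm
      · exact Or.inr (h1.trans_le (potential_le hle))
    · right
      unfold ClosedAt at hc
      push Not at hc
      obtain ⟨l, hl, hlB, h1, h2⟩ := hc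
      refine (potential_le fun q hq => round_le (h.clause c) cs hq).trans_lt
        (potential_lt hle (hV c (by simp) l hl) h1 ?_)
      obtain ⟨a, h3, ha⟩ := run_clause (n := n) (x := x) (B := B) h.false c
        (show 4 + 2 * l.1 ≠ 1 by omega)
      rw [ha, if_pos ⟨l, hl, hlB, rfl⟩]
      have : a = false := by
        cases a with
        | false => rfl
        | true => exact absurd (h3.1 rfl) h2
      rw [this, Bool.and_false]

/-- The state after `V` rounds is closed. -/
theorem rounds_spec {φ : CNF} {τ : ℕ → Bool} (h : Represents B τ r) (j : ℕ) :
    ∃ r', run n x r ((List.range j).flatMap fun _ => roundCode n B φ.clauses) = r' ∧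
      Represents B τ r' ∧ ((∀ c ∈ φ.clauses, ClosedAt B r' c) ∨
        potential φ.numVars r' + j ≤ φ.numVars) := by
  induction j with
  | zero =>
    refine ⟨r, rfl, h, Or.inr ?_⟩
    simpa [potential] using (Finset.card_filter_le (Finset.range φ.numVars) _)
  | succ j ih =>
    obtain ⟨r', h1, h2, h3⟩ := ih
    rw [List.range_succ, List.flatMap_append, run_append, h1, List.flatMap_singleton]
    refine ⟨_, rfl, h2.round _, ?_⟩
    rcases h3 with h3 | h3
    -- Once closed, further rounds affect only the accumulator.
    · exact Or.inl fun c hc => (h3 c hc).congr fun q hq => round_of_closedAt h2 h3 hq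
    · rcases round_closed_or_lt (n := n) (x := x) h2 φ.clauses φ.var_lt with ⟨heq, hcl⟩ | hlt
      · exact Or.inl fun c hc => (hcl c hc).congr heq
      · right; omega

theorem rounds_sound {φ : CNF} (hB : φ.IsStrongHornBackdoor B) {τ : ℕ → Bool}
    (hτ : ∀ c ∈ φ.clauses, ∃ l ∈ c, τ l.1 = l.2) (h : Represents B τ r) (hs : Sound φ.numVars τ r) (j : ℕ) :
    Sound φ.numVars τ (run n x r ((List.range j).flatMap fun _ => roundCode n B φ.clauses)) := by
  induction j with
  | zero => exact hs
  | succ j ih =>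
    rw [List.range_succ, List.flatMap_append, run_append, List.flatMap_singleton]
    obtain ⟨r', h1, h2, -⟩ := rounds_spec (n := n) (x := x) (φ := φ) h j
    rw [h1] at ih ⊢
    exact ih.round hB hτ h2 fun _ => id

theorem tgt_ne_zero_of_mem_rounds {φ : CNF} {j : ℕ} {I : Instr}
    (hI : I ∈ (List.range j).flatMap fun _ => roundCode n B φ.clauses) : I.tgt ≠ 0 := by
  simp only [List.mem_flatMap, roundCode, bodyCode, headCode, List.mem_append, List.mem_cons,
    List.mem_map] at hI
  obtain ⟨_, _, c, _, (rfl | ⟨l, _, rfl⟩) | ⟨l, _, rfl⟩⟩ := hI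
  · simp [andReg]
  · simp [orReg]
  · split_ifs <;> simp [andReg, orReg]

/-- The program decides whether the assignment `τ` to the backdoor can be extended. -/
theorem run_hornCode {φ : CNF} (hB : φ.IsStrongHornBackdoor B) {τ : ℕ → Bool}
    (h : Represents B τ r) (hr : ∀ v < φ.numVars, v ∉ B → r (4 + 2 * v) = true) :
    run n x r (hornCode n φ B) 0 = true ↔ r 0 = true ∧
      ∃ τ' : ℕ → Bool, (∀ v ∈ B, τ' v = τ v) ∧ ∀ c ∈ φ.clauses, ∃ l ∈ c, τ' l.1 = l.2 := by
  obtain ⟨r', h1, h2, h3⟩ := rounds_spec (n := n) (x := x) (φ := φ) h φ.numVars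
  have h0 : r' 0 = r 0 := by
    rw [← h1]; exact run_of_forall_ne fun I hI => tgt_ne_zero_of_mem_rounds hI
  rw [hornCode, run_append, h1, run_checks h2, h0]
  refine and_congr_right fun _ => ⟨fun hc => ?_, ?_⟩
  · have hcl : ∀ c ∈ φ.clauses, ClosedAt B r' c := by
      rcases h3 with h3 | h3
      · exact h3
      · intro c hc l hl _ hrl
        have hp : potential φ.numVars r' = 0 := by omega
        rw [potential, Finset.card_eq_zero, Finset.filter_eq_empty_iff] at hp
        exact absurd hrl (hp (Finset.mem_range.2 (φ.var_lt c hc l hl)))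
    -- The least model: outside the backdoor a variable is True only if it was derived.
    refine ⟨fun v => if v ∈ B then τ v else !r' (4 + 2 * v), fun v hv => if_pos hv, ?_⟩
    intro c hcφ
    have hbody : bodySat B r' c →
        ∃ l ∈ c, (if l.1 ∈ B then τ l.1 else !r' (4 + 2 * l.1)) = l.2 := by
      rintro ⟨⟨v, s⟩, hl, hlB, hrl⟩
      refine ⟨_, hl, ?_⟩
      cases s with
      | true =>
        have hv : v ∈ B := by by_contra hv; exact hlB ⟨rfl, hv⟩
        rw [litReg, if_pos rfl, h2.pos v hv] at hrl
        simpa [hv] using hrl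
      | false =>
        rw [litReg, if_neg (by simp)] at hrl
        by_cases hv : v ∈ B
        · rw [h2.neg v hv] at hrl
          simpa [hv] using hrl
        · simpa [hv] using hrl
    rcases hc c hcφ with hs | ⟨l, hl, hlB⟩
    · exact hbody hs
    -- If a head may still be False, closedness shows that the rest of its clause is satisfied;
    -- otherwise the head was derived and is True.
    · by_cases hrl : r' (4 + 2 * l.1) = true
      · exact hbody (hcl c hcφ l hl hlB hrl)
      · exact ⟨l, hl, by simpa [hlB.2, hlB.1] using hrl⟩
  -- A satisfying extension stays below the derived bounds by soundness, so each clause passes its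
  -- check through a literal that `τ'` makes true.
  · rintro ⟨τ', hτB, hτ⟩
    have hrep : Represents B τ' r :=
      ⟨h.true, h.false, fun v hv => by rw [hτB v hv, h.neg v hv],
        fun v hv => by rw [hτB v hv, h.pos v hv]⟩
    have hrep' : Represents B τ' r' :=
      ⟨h2.true, h2.false, fun v hv => by rw [hτB v hv, h2.neg v hv],
        fun v hv => by rw [hτB v hv, h2.pos v hv]⟩
    have hs : Sound φ.numVars τ' r := by
      intro v hv hτv
      by_cases hvB : v ∈ B
      · rw [hrep.neg v hvB, hτv]; rfl
      · exact hr v hv hvB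
    have hs' := rounds_sound (n := n) (x := x) hB hτ hrep hs φ.numVars
    rw [h1] at hs'
    intro c hc
    obtain ⟨l, hl, h4⟩ := hτ c hc
    by_cases h5 : IsHead B l
    · exact Or.inr ⟨l, hl, h5⟩
    · exact Or.inl ⟨l, hl, h5, litReg_of_sound hrep' hs' (φ.var_lt c hc l hl) h5 h4⟩

end CNF

/-! ### Two programs for a formula with a backdoor: with negation, and monotone -/

namespace Instr

variable {n : ℕ}

theorem wf_andReg {W t j : ℕ} (ht : t < W) (hj : j < W) (h : j ≠ t) : (andReg n t j).WF n W :=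
  ⟨ht, by simp only [andReg]; omega, by simp only [andReg]; omega⟩

theorem wf_orReg {W t j : ℕ} (ht : t < W) (hj : j < W) (h : j ≠ t) : (orReg n t j).WF n W :=
  ⟨ht, by simp only [orReg]; omega, by simp only [orReg]; omega⟩

theorem wf_andInput {W t j : ℕ} (ht : t < W) (hj : j < n) : (andInput t j).WF n W :=
  ⟨ht, by simp only [andInput]; omega, by simp only [andInput]; omega⟩

theorem wf_orInput {W t j : ℕ} (ht : t < W) (hj : j < n) : (orInput t j).WF n W :=
  ⟨ht, by simp only [orInput]; omega, by simp only [orInput]; omega⟩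

theorem wf_neg {W t : ℕ} (ht : t < W) (hn : 0 < n) : (neg t).WF n W :=
  ⟨ht, by simp only [neg]; omega, by simp only [neg]; omega⟩

end Instr

namespace CNF

open Instr

variable {n : ℕ} {B : List ℕ} {x r : ℕ → Bool} {φ : CNF}

theorem mem_hornCode {I : Instr} (hI : I ∈ hornCode n φ B) : ∃ c ∈ φ.clauses,
    I ∈ bodyCode n B c ∨ I ∈ headCode n B c ∨ I ∈ checkCode n B c := by
  simp only [hornCode, List.mem_append, List.mem_flatMap, roundCode] at hI
  obtain ⟨_, -, c, hc, h | h⟩ | ⟨c, hc, h⟩ := hI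
  · exact ⟨c, hc, Or.inl h⟩
  · exact ⟨c, hc, Or.inr (Or.inl h)⟩
  · exact ⟨c, hc, Or.inr (Or.inr h)⟩

theorem litReg_lt {V : ℕ} {l : Literal} (h : l.1 < V) : litReg l < 4 + 2 * V := by
  unfold litReg; split_ifs <;> omega

/-- Besides being well-formed, the propagation uses no negation, and register 0 is only ever
conjoined with something. Thus a False verdict stored there beforehand survives. -/
theorem hornCode_spec {I : Instr} (hI : I ∈ hornCode n φ B) :
    I.WF n (4 + 2 * φ.numVars) ∧ I.op ≤ 1 ∧ (I.tgt = 0 → I.op = 0) := by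
  obtain ⟨c, hc, h⟩ := mem_hornCode hI
  have hl : ∀ l ∈ c, l.1 < φ.numVars ∧ 4 ≤ litReg l ∧ litReg l < 4 + 2 * φ.numVars :=
    fun l hl => ⟨φ.var_lt c hc l hl, litReg_ge l, litReg_lt (φ.var_lt c hc l hl)⟩
  simp only [bodyCode, headCode, checkCode, List.mem_append, List.mem_cons, List.mem_map,
    List.not_mem_nil, or_false] at h
  rcases h with (rfl | ⟨l, h, rfl⟩) | ⟨l, h, rfl⟩ | ((rfl | ⟨l, h, rfl⟩) | rfl)
  · exact ⟨wf_andReg (by omega) (by omega) (by omega), by simp [andReg], by simp [andReg]⟩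
  · have := hl l h
    exact ⟨wf_orReg (by omega) (by split_ifs <;> omega) (by split_ifs <;> omega),
      by simp [orReg], by simp [orReg]⟩
  · have := hl l h
    split_ifs
    · exact ⟨wf_andReg (by omega) (by omega) (by omega), by simp [andReg], by simp [andReg]⟩
    · exact ⟨wf_orReg (by omega) (by omega) (by omega), by simp [orReg], by simp [orReg]⟩
  · exact ⟨wf_andReg (by omega) (by omega) (by omega), by simp [andReg], by simp [andReg]⟩
  · have := hl l h
    exact ⟨wf_orReg (by omega) (by split_ifs <;> omega) (by split_ifs <;> omega),
      by simp [orReg], by simp [orReg]⟩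
  · exact ⟨wf_andReg (by omega) (by omega) (by omega), by simp [andReg], by simp [andReg]⟩

/-- Initialize the registers of the variables; the code `blk j` reads the value of the variable
number `j` of the backdoor. -/
def varCode (n V b : ℕ) (blk : ℕ → List Instr) : List Instr :=
  (List.range V).map (fun v => orReg n (4 + 2 * v) 2) ++ (List.range b).flatMap blk

/-- Block `j` writes only the two registers of its own variable; injectivity of `v` keeps the blocks
from overwriting each other. -/
theorem run_blocks {blk : ℕ → List Instr} {v : ℕ → ℕ} {a b : ℕ → Bool} {m : ℕ}
    (hblk : ∀ j < m, ∀ r, r 3 = false → run n x r (blk j) =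
      Function.update (Function.update r (4 + 2 * v j) (a j)) (5 + 2 * v j) (b j))
    (hinj : ∀ i < m, ∀ j < m, v i = v j → i = j) (hF : r 3 = false) :
    (∀ j < m, run n x r ((List.range m).flatMap blk) (4 + 2 * v j) = a j ∧
      run n x r ((List.range m).flatMap blk) (5 + 2 * v j) = b j) ∧
    ∀ q, (∀ j < m, q ≠ 4 + 2 * v j ∧ q ≠ 5 + 2 * v j) →
      run n x r ((List.range m).flatMap blk) q = r q := by
  induction m with
  | zero => simp
  | succ m ih =>
    obtain ⟨h1, h2⟩ := ih (fun j hj => hblk j (by omega))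
      (fun i hi j hj => hinj i (by omega) j (by omega))
    have h3 := h2 3 (fun j _ => by omega)
    rw [List.range_succ, List.flatMap_append, run_append, List.flatMap_singleton,
      hblk m (by omega) _ (h3.trans hF)]
    refine ⟨fun j hj => ?_, fun q hq => ?_⟩
    · rcases Nat.lt_succ_iff_lt_or_eq.1 hj with hj' | rfl
      · have hne : v j ≠ v m := fun h => by have := hinj j hj m (by omega) h; omega
        rw [Function.update_of_ne (by omega), Function.update_of_ne (by omega),
          Function.update_of_ne (by omega), Function.update_of_ne (by omega)]
        exact h1 j hj'
      · rw [Function.update_of_ne (by omega), Function.update_self, Function.update_self]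
        exact ⟨rfl, rfl⟩
    · have := hq m (by omega)
      rw [Function.update_of_ne this.2, Function.update_of_ne this.1]
      exact h2 q fun j hj => hq j (by omega)

theorem run_setTrue (hT : r 2 = true) (V : ℕ) :
    (∀ v < V, run n x r ((List.range V).map fun v => orReg n (4 + 2 * v) 2) (4 + 2 * v) = true) ∧
    ∀ q < 4, run n x r ((List.range V).map fun v => orReg n (4 + 2 * v) 2) q = r q := by
  induction V with
  | zero => simp
  | succ V ih =>
    rw [List.range_succ, List.map_append, run_append, List.map_singleton, run_cons, run_nil,
      step_orReg, ih.2 2 (by omega), hT, Bool.or_true]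
    refine ⟨fun v hv => ?_, fun q hq => ?_⟩
    · by_cases h : v = V
      · rw [h, Function.update_self]
      · rw [Function.update_of_ne (by omega)]; exact ih.1 v (by omega)
    · rw [Function.update_of_ne (by omega)]; exact ih.2 q hq

theorem run_varCode {V : ℕ} {blk : ℕ → List Instr} {τ : ℕ → Bool} (hnd : B.Nodup)
    (hblk : ∀ j < B.length, ∀ r, r 3 = false → run n x r (blk j) =
      Function.update (Function.update r (4 + 2 * B.getD j 0) (!τ (B.getD j 0)))
        (5 + 2 * B.getD j 0) (τ (B.getD j 0)))
    (hT : r 2 = true) (hF : r 3 = false) :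
    Represents B τ (run n x r (varCode n V B.length blk)) ∧
      run n x r (varCode n V B.length blk) 0 = r 0 ∧
      ∀ v < V, v ∉ B → run n x r (varCode n V B.length blk) (4 + 2 * v) = true := by
  obtain ⟨h1, h2⟩ := run_setTrue (n := n) (x := x) hT V
  rw [varCode, run_append]
  generalize run n x r _ = r' at h1 h2
  obtain ⟨h3, h4⟩ := run_blocks (v := fun j => B.getD j 0) hblk
    (by
      intro i hi j hj hij
      simp only [List.getD_eq_getElem _ _ hi, List.getD_eq_getElem _ _ hj] at hij
      exact (hnd.getElem_inj_iff).1 hij) ((h2 3 (by omega)).trans hF)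
  have hmem : ∀ v ∈ B, ∃ j < B.length, B.getD j 0 = v := by
    intro v hv
    obtain ⟨j, hj, rfl⟩ := List.getElem_of_mem hv
    exact ⟨j, hj, List.getD_eq_getElem _ _ hj⟩
  refine ⟨⟨?_, ?_, fun v hv => ?_, fun v hv => ?_⟩, ?_, fun v hv hvB => ?_⟩
  · rw [h4 2 (fun j _ => by omega), h2 2 (by omega), hT]
  · rw [h4 3 (fun j _ => by omega), h2 3 (by omega), hF]
  · obtain ⟨j, hj, rfl⟩ := hmem v hv
    exact (h3 j hj).1
  · obtain ⟨j, hj, rfl⟩ := hmem v hv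
    exact (h3 j hj).2
  · rw [h4 0 (fun j _ => by omega), h2 0 (by omega)]
  · rw [h4, h1 v hv]
    intro j hj
    have : B.getD j 0 ≠ v := by
      rintro rfl
      exact hvB (by rw [List.getD_eq_getElem _ _ hj]; exact List.getElem_mem hj)
    omega

/-! ### A program whose inputs are the variables of the backdoor

Input `0` is not used otherwise; input `j + 1` is the value of the variable number `j` of the
backdoor. -/

/-- Conjunction with the False register clears the target before the input is read. With negation
available, both registers of the variable come from the same input. -/
def negBlock (n : ℕ) (B : List ℕ) (j : ℕ) : List Instr :=
  [andReg n (4 + 2 * B.getD j 0) 3, orInput (4 + 2 * B.getD j 0) (j + 1),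
    neg (4 + 2 * B.getD j 0), andReg n (5 + 2 * B.getD j 0) 3,
    orInput (5 + 2 * B.getD j 0) (j + 1)]

/-- There are no constants and all registers start as input 0, so True and False are produced as `¬x
0 ∨ x 0` and `¬x 0 ∧ x 0`. -/
def negCode (φ : CNF) (B : List ℕ) : List Instr :=
  [neg 2, orInput 2 0, neg 3, andInput 3 0, orReg (B.length + 1) 0 2] ++
    (varCode (B.length + 1) φ.numVars B.length (negBlock (B.length + 1) B) ++
      hornCode (B.length + 1) φ B)

theorem run_negBlock {j : ℕ} (hj : j < B.length) (hF : r 3 = false) :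
    run (B.length + 1) x r (negBlock (B.length + 1) B j) =
      Function.update (Function.update r (4 + 2 * B.getD j 0) (!x (j + 1)))
        (5 + 2 * B.getD j 0) (x (j + 1)) := by
  have hj' : j + 1 < B.length + 1 := by omega
  have h1 : 3 ≠ 4 + 2 * B.getD j 0 := by omega
  have h2 : 5 + 2 * B.getD j 0 ≠ 4 + 2 * B.getD j 0 := by omega
  simp only [negBlock, run_cons, run_nil, step_andReg, step_orInput _ hj', step_neg, hF,
    Bool.and_false, Function.update_self, Bool.false_or, Function.update_idem,
    Function.update_of_ne h1]

theorem getD_lt (hB : φ.IsStrongHornBackdoor B) {j : ℕ} (hj : j < B.length) :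
    B.getD j 0 < φ.numVars := by
  rw [List.getD_eq_getElem _ _ hj]; exact hB.2.1 _ (List.getElem_mem hj)

theorem mem_varCode {V b : ℕ} {blk : ℕ → List Instr} {I : Instr} (hI : I ∈ varCode n V b blk) :
    (∃ v < V, I = orReg n (4 + 2 * v) 2) ∨ ∃ j < b, I ∈ blk j := by
  simp only [varCode, List.mem_append, List.mem_map, List.mem_range, List.mem_flatMap] at hI
  obtain ⟨v, hv, rfl⟩ | ⟨j, hj, h⟩ := hI
  · exact Or.inl ⟨v, hv, rfl⟩
  · exact Or.inr ⟨j, hj, h⟩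

def negProg (φ : CNF) (B : List ℕ) (hB : φ.IsStrongHornBackdoor B) : RegProg where
  n := B.length + 1
  W := 4 + 2 * φ.numVars
  code := negCode φ B
  n_pos := Nat.succ_pos _
  W_pos := by omega
  wf := by
    intro I hI
    rw [negCode, List.mem_append, List.mem_append] at hI
    rcases hI with hI | hI | hI
    · simp only [List.mem_cons, List.not_mem_nil, or_false] at hI
      rcases hI with rfl | rfl | rfl | rfl | rfl
      · exact wf_neg (by omega) (by omega)
      · exact wf_orInput (by omega) (by omega)
      · exact wf_neg (by omega) (by omega)
      · exact wf_andInput (by omega) (by omega)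
      · exact wf_orReg (by omega) (by omega) (by omega)
    · rcases mem_varCode hI with ⟨v, hv, rfl⟩ | ⟨j, hj, hI⟩
      · exact wf_orReg (by omega) (by omega) (by omega)
      · have := getD_lt hB hj
        simp only [negBlock, List.mem_cons, List.not_mem_nil, or_false] at hI
        rcases hI with rfl | rfl | rfl | rfl | rfl
        · exact wf_andReg (by omega) (by omega) (by omega)
        · exact wf_orInput (by omega) (by omega)
        · exact wf_neg (by omega) (by omega)
        · exact wf_andReg (by omega) (by omega) (by omega)
        · exact wf_orInput (by omega) (by omega)
    · exact (hornCode_spec hI).1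
  covers := by
    intro j hj
    cases j with
    | zero => exact ⟨orInput 2 0, by simp [negCode], by simp [orInput], rfl⟩
    | succ j =>
      refine ⟨orInput (4 + 2 * B.getD j 0) (j + 1), ?_, by simp [orInput], rfl⟩
      simp only [negCode, varCode, List.mem_append, List.mem_flatMap, List.mem_range]
      exact Or.inr (Or.inl (Or.inr ⟨j, by omega, by simp [negBlock]⟩))

theorem negProg_accepts (hB : φ.IsStrongHornBackdoor B) (x : ℕ → Bool) :
    (negProg φ B hB).Accepts x ↔ ∃ τ : ℕ → Bool, (∀ j < B.length, τ (B.getD j 0) = x (j + 1)) ∧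
      ∀ c ∈ φ.clauses, ∃ l ∈ c, τ l.1 = l.2 := by
  have hB1 := hB.1
  let τ : ℕ → Bool := fun v => x (B.idxOf v + 1)
  have hτ : ∀ j < B.length, τ (B.getD j 0) = x (j + 1) := by
    intro j hj
    simp only [τ, List.getD_eq_getElem _ _ hj, hB1.idxOf_getElem]
  have hpre : ∃ r, run (B.length + 1) x (fun _ => x 0)
      [neg 2, orInput 2 0, neg 3, andInput 3 0, orReg (B.length + 1) 0 2] = r ∧
        r 0 = true ∧ r 2 = true ∧ r 3 = false := by
    refine ⟨_, rfl, ?_⟩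
    simp only [run_cons, run_nil, step_neg, step_orInput 2 (Nat.succ_pos B.length),
      step_andInput 3 (Nat.succ_pos B.length), step_orReg]
    cases x 0 <;> simp
  obtain ⟨r, h1, h2, h3, h4⟩ := hpre
  obtain ⟨h5, h6, h7⟩ := run_varCode (n := B.length + 1) (x := x) (V := φ.numVars)
    (blk := negBlock (B.length + 1) B) (τ := τ) hB1
    (fun j hj r hr => by rw [hτ j hj]; exact run_negBlock hj hr) h3 h4
  change run (B.length + 1) x (fun _ => x 0) (negCode φ B) 0 = true ↔ _
  rw [negCode, run_append, h1, run_append, run_hornCode hB h5 h7, h6, h2]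
  simp only [true_and]
  refine exists_congr fun τ' => and_congr_left fun _ => ?_
  constructor
  · intro h j hj
    rw [← hτ j hj]
    refine h _ ?_
    rw [List.getD_eq_getElem _ _ hj]; exact List.getElem_mem hj
  · intro h v hv
    obtain ⟨j, hj, rfl⟩ := List.getElem_of_mem hv
    have := h j hj
    rw [← hτ j hj] at this
    rwa [List.getD_eq_getElem _ _ hj] at this

theorem negProg_satisfiable (hB : φ.IsStrongHornBackdoor B) :
    (negProg φ B hB).toCircuit.Satisfiable ↔ φ.Satisfiable := by
  simp only [Circuit.Satisfiable, RegProg.toCircuit_accepts, negProg_accepts]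
  constructor
  · rintro ⟨x, τ, -, h⟩; exact ⟨τ, h⟩
  · rintro ⟨τ, h⟩
    exact ⟨fun q => τ (B.getD (q - 1) 0), τ, fun j _ => by simp, h⟩

/-! ### A monotone program

The backdoor is divided into `k` groups of at most `L` variables. For each of them there are `2 ^ L`
inputs, one for each assignment to the group. -/

/-- The number of variables in a group. -/
def groupLen (b k : ℕ) : ℕ := b / k + 1

/-- The number of inputs for a group. -/
def groupSize (b k : ℕ) : ℕ := 2 ^ groupLen b k

/-- Input `g * D + a` says that group `g` takes the assignment `a`, with `D` inputs per group. It
raises the "may be True" or the "may be False" register of variable `j` according to the bit of `a`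
at the position of `j` in its group. Both signs are thus available without negation. -/
def groupBlock (n : ℕ) (B : List ℕ) (k j : ℕ) : List Instr :=
  andReg n (4 + 2 * B.getD j 0) 3 :: andReg n (5 + 2 * B.getD j 0) 3 ::
    (List.range (groupSize B.length k)).map fun a =>
      orInput (if a.testBit (j % groupLen B.length k) = true then 5 + 2 * B.getD j 0
        else 4 + 2 * B.getD j 0)
        (j / groupLen B.length k * groupSize B.length k + a)

/-- Check that all groups have a True input. -/
def groupCheck (n D k : ℕ) : List Instr :=
  (List.range k).flatMap fun g =>
    andReg n 1 3 :: ((List.range D).map (fun a => orInput 1 (g * D + a)) ++ [andReg n 0 1])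

/-- A monotone program cannot produce constants unconditionally. The conjunction of all inputs
stands in for False and their disjunction for True; both are correct when each group has exactly one
True input among at least two. -/
def groupPrelude (n : ℕ) : List Instr :=
  (List.range n).map (andInput 3) ++ ((List.range n).map (orInput 2) ++ [orReg n 0 2])

def groupCode (φ : CNF) (B : List ℕ) (k : ℕ) : List Instr :=
  groupPrelude (k * groupSize B.length k) ++
    (groupCheck (k * groupSize B.length k) (groupSize B.length k) k ++
      (varCode (k * groupSize B.length k) φ.numVars B.length
        (groupBlock (k * groupSize B.length k) B k) ++
      hornCode (k * groupSize B.length k) φ B))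

theorem groupSize_pos (b k : ℕ) : 0 < groupSize b k := Nat.two_pow_pos _

/-- The `+ 1` in `groupLen` matters here: even for an empty backdoor a group has two inputs, so not
all inputs can be True at weight at most `k`. -/
theorem two_le_groupSize (b k : ℕ) : 2 ≤ groupSize b k := by
  rw [groupSize, groupLen, pow_succ]
  have := Nat.two_pow_pos (b / k)
  omega

/-- Groups of length `b / k + 1` are long enough for `k` of them to cover the backdoor. -/
theorem div_groupLen_lt {b k j : ℕ} (hk : 0 < k) (hj : j < b) : j / groupLen b k < k := by
  rw [Nat.div_lt_iff_lt_mul (show 0 < groupLen b k from Nat.succ_pos _), groupLen]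
  exact hj.trans (Nat.lt_mul_div_succ b hk)

theorem group_lt {k D g a : ℕ} (hg : g < k) (ha : a < D) : g * D + a < k * D := by
  have : (g + 1) * D ≤ k * D := Nat.mul_le_mul_right _ hg
  linarith [Nat.add_mul g 1 D]

def groupProg (φ : CNF) (B : List ℕ) (hB : φ.IsStrongHornBackdoor B) (k : ℕ) (hk : 0 < k) :
    RegProg where
  n := k * groupSize B.length k
  W := 4 + 2 * φ.numVars
  code := groupCode φ B k
  n_pos := Nat.mul_pos hk (groupSize_pos _ _)
  W_pos := by omega
  wf := by
    intro I hI
    simp only [groupCode, groupPrelude, groupCheck, List.mem_append, List.mem_map, List.mem_range,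
      List.mem_flatMap, List.mem_cons, List.not_mem_nil, or_false] at hI
    rcases hI with (⟨j, hj, rfl⟩ | ⟨j, hj, rfl⟩ | rfl) | ⟨g, hg, rfl | ⟨a, ha, rfl⟩ | rfl⟩ | hI | hI
    · exact wf_andInput (by omega) hj
    · exact wf_orInput (by omega) hj
    · exact wf_orReg (by omega) (by omega) (by omega)
    · exact wf_andReg (by omega) (by omega) (by omega)
    · exact wf_orInput (by omega) (group_lt hg ha)
    · exact wf_andReg (by omega) (by omega) (by omega)
    · rcases mem_varCode hI with ⟨v, hv, rfl⟩ | ⟨j, hj, hI⟩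
      · exact wf_orReg (by omega) (by omega) (by omega)
      · have := getD_lt hB hj
        simp only [groupBlock, List.mem_cons, List.mem_map, List.mem_range] at hI
        rcases hI with rfl | rfl | ⟨a, ha, rfl⟩
        · exact wf_andReg (by omega) (by omega) (by omega)
        · exact wf_andReg (by omega) (by omega) (by omega)
        · exact wf_orInput (by split_ifs <;> omega) (group_lt (div_groupLen_lt hk hj) ha)
    · exact (hornCode_spec hI).1
  covers := by
    intro j hj
    refine ⟨orInput 2 j, ?_, by simp [orInput], rfl⟩
    simp only [groupCode, groupPrelude, List.mem_append, List.mem_map, List.mem_range]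
    exact Or.inl (Or.inr (Or.inl ⟨j, hj, rfl⟩))

theorem groupProg_isMonotone (hB : φ.IsStrongHornBackdoor B) (k : ℕ) (hk : 0 < k) :
    (groupProg φ B hB k hk).IsMonotone := by
  intro I hI
  change I ∈ groupCode φ B k at hI
  simp only [groupCode, groupPrelude, groupCheck, List.mem_append, List.mem_map, List.mem_range,
    List.mem_flatMap, List.mem_cons, List.not_mem_nil, or_false] at hI
  rcases hI with (⟨j, hj, rfl⟩ | ⟨j, hj, rfl⟩ | rfl) | ⟨g, hg, rfl | ⟨a, ha, rfl⟩ | rfl⟩ | hI | hI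
  any_goals simp [andReg, orReg, andInput, orInput]
  · rcases mem_varCode hI with ⟨v, hv, rfl⟩ | ⟨j, hj, hI⟩
    · simp [orReg]
    · simp only [groupBlock, List.mem_cons, List.mem_map, List.mem_range] at hI
      rcases hI with rfl | rfl | ⟨a, ha, rfl⟩ <;> simp [andReg, orInput]
  · exact (hornCode_spec hI).2.1

theorem run_groupPrelude (hn : 0 < n) :
    run n x (fun _ => x 0) (groupPrelude n) 3 = (List.range n).all x ∧
    run n x (fun _ => x 0) (groupPrelude n) 2 = (List.range n).any x ∧
    run n x (fun _ => x 0) (groupPrelude n) 0 = (List.range n).any x := by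
  have h1 : ∀ j ∈ List.range n, j < n := fun j => List.mem_range.1
  have h2 : (x 0 && (List.range n).all x) = (List.range n).all x := by
    rw [Bool.eq_iff_iff, Bool.and_eq_true, List.all_eq_true]
    exact ⟨fun h => h.2, fun h => ⟨h 0 (List.mem_range.2 hn), h⟩⟩
  have h3 : (x 0 || (List.range n).any x) = (List.range n).any x := by
    rw [Bool.eq_iff_iff, Bool.or_eq_true, List.any_eq_true]
    exact ⟨fun h => h.elim (fun h => ⟨0, List.mem_range.2 hn, h⟩) id, Or.inr⟩
  rw [groupPrelude, run_append, run_andInput _ _ h1, run_append, run_orInput _ _ h1, run_cons,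
    run_nil, step_orReg]
  simp [h2, h3]

theorem run_groupCheck {D k : ℕ} (hF : r 3 = false) (m : ℕ) (hm : m ≤ k) :
    (run (k * D) x r (groupCheck (k * D) D m) 0 = true ↔
      r 0 = true ∧ ∀ g < m, ∃ a < D, x (g * D + a) = true) ∧
    ∀ q, 2 ≤ q → run (k * D) x r (groupCheck (k * D) D m) q = r q := by
  induction m with
  | zero => simp [groupCheck]
  | succ m ih =>
    obtain ⟨h1, h2⟩ := ih (by omega)
    have h3 : groupCheck (k * D) D (m + 1) = groupCheck (k * D) D m ++
        (andReg (k * D) 1 3 :: (((List.range D).map (fun a => m * D + a)).map (orInput 1) ++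
          [andReg (k * D) 0 1])) := by
      rw [groupCheck, List.range_succ, List.flatMap_append, List.flatMap_singleton, List.map_map]
      rfl
    rw [h3, run_append, run_cons, step_andReg, h2 3 (by omega), hF, Bool.and_false, run_append,
      run_orInput, run_cons, run_nil, step_andReg]
    · refine ⟨?_, fun q hq => ?_⟩
      · simp only [Function.update_self, Bool.and_eq_true, Bool.false_or, List.any_map,
          List.any_eq_true, List.mem_range, Function.comp_apply, Function.update_of_ne zero_ne_one,
          h1, Nat.lt_succ_iff_lt_or_eq, or_imp, forall_and, forall_eq]
        tauto
      · rw [Function.update_of_ne (by omega), Function.update_of_ne (by omega),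
          Function.update_of_ne (by omega)]
        exact h2 q hq
    · intro j hj
      obtain ⟨a, ha, rfl⟩ := List.mem_map.1 hj
      exact group_lt (by omega) (List.mem_range.1 ha)

theorem run_orInput_ite (t t' : ℕ) (ht : t ≠ t') (s : List ℕ) (p : ℕ → Prop) [DecidablePred p]
    (f : ℕ → ℕ) (hs : ∀ a ∈ s, f a < n) :
    run n x r (s.map fun a => orInput (if p a then t else t') (f a)) =
      Function.update (Function.update r t' (r t' || s.any fun a => !p a && x (f a)))
        t (r t || s.any fun a => p a && x (f a)) := by
  induction s generalizing r with
  | nil => simp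
  | cons a s ih =>
    rw [List.map_cons, run_cons, step_orInput _ (hs a (by simp)),
      ih (fun i hi => hs i (by simp [hi]))]
    by_cases h : p a
    · simp only [h, if_true, List.any_cons, decide_true, Bool.not_true, Bool.false_and,
        Bool.false_or, Bool.true_and, Function.update_self, Function.update_of_ne ht.symm,
        Bool.or_assoc]
      rw [Function.update_comm ht.symm, Function.update_idem, Function.update_comm ht]
    · simp only [h, if_false, List.any_cons, decide_false, Bool.not_false, Bool.false_and,
        Bool.false_or, Bool.true_and, Function.update_self, Function.update_of_ne ht,
        Bool.or_assoc, Function.update_idem]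

/-- If exactly one input of each group is True, then they describe an assignment. -/
theorem run_groupBlock {k j : ℕ} (hk : 0 < k) (hj : j < B.length) {α : ℕ → ℕ}
    (hα : ∀ g < k, α g < groupSize B.length k)
    (hx : ∀ g < k, ∀ a < groupSize B.length k,
      (x (g * groupSize B.length k + a) = true ↔ a = α g)) (hF : r 3 = false) :
    run (k * groupSize B.length k) x r (groupBlock (k * groupSize B.length k) B k j) =
      Function.update (Function.update r (4 + 2 * B.getD j 0)
        (!(α (j / groupLen B.length k)).testBit (j % groupLen B.length k)))
        (5 + 2 * B.getD j 0) ((α (j / groupLen B.length k)).testBit (j % groupLen B.length k)) := by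
  have hg := div_groupLen_lt hk hj
  have h1 : 3 ≠ 4 + 2 * B.getD j 0 := by omega
  have h2 : 5 + 2 * B.getD j 0 ≠ 4 + 2 * B.getD j 0 := by omega
  rw [groupBlock, run_cons, run_cons, step_andReg, step_andReg, hF, Bool.and_false,
    Function.update_of_ne h1, hF, Bool.and_false, run_orInput_ite _ _ h2 _ _ _
      (fun a ha => group_lt hg (List.mem_range.1 ha))]
  set g := j / groupLen B.length k
  set D := groupSize B.length k
  set t := j % groupLen B.length k
  have key : ∀ p : ℕ → Bool, ((List.range D).any fun a => p a && x (g * D + a)) = p (α g) := by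
    intro p
    rw [Bool.eq_iff_iff, List.any_eq_true]
    constructor
    · rintro ⟨a, ha, h⟩
      rw [Bool.and_eq_true] at h
      rw [← (hx g hg a (List.mem_range.1 ha)).1 h.2]
      exact h.1
    · intro h
      refine ⟨α g, List.mem_range.2 (hα g hg), ?_⟩
      rw [h, (hx g hg _ (hα g hg)).2 rfl]; rfl
  have e1 := key fun a => !decide (a.testBit t = true)
  have e2 := key fun a => decide (a.testBit t = true)
  rw [e1, e2]
  funext q
  simp only [Function.update_apply]
  split_ifs <;> simp_all

/-- The monotone program accepts an assignment of weight at most `k` that has exactly one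
True input in each group if this describes an assignment that can be extended. -/
theorem groupProg_accepts_iff (hB : φ.IsStrongHornBackdoor B) {k : ℕ} (hk : 0 < k) {α : ℕ → ℕ}
    (hα : ∀ g < k, α g < groupSize B.length k)
    (hx : ∀ g < k, ∀ a < groupSize B.length k,
      (x (g * groupSize B.length k + a) = true ↔ a = α g)) :
    (groupProg φ B hB k hk).Accepts x ↔
      ∃ τ : ℕ → Bool, (∀ j < B.length, τ (B.getD j 0) =
        (α (j / groupLen B.length k)).testBit (j % groupLen B.length k)) ∧
      ∀ c ∈ φ.clauses, ∃ l ∈ c, τ l.1 = l.2 := by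
  have hD := two_le_groupSize B.length k
  have hn : 0 < k * groupSize B.length k := Nat.mul_pos hk (groupSize_pos _ _)
  let τ : ℕ → Bool := fun v =>
    (α (B.idxOf v / groupLen B.length k)).testBit (B.idxOf v % groupLen B.length k)
  have hτ : ∀ j < B.length, τ (B.getD j 0) =
      (α (j / groupLen B.length k)).testBit (j % groupLen B.length k) := by
    intro j hj
    simp only [τ, List.getD_eq_getElem _ _ hj, hB.1.idxOf_getElem]
  obtain ⟨p1, p2, p3⟩ := run_groupPrelude (x := x) hn
  have hany : (List.range (k * groupSize B.length k)).any x = true :=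
    List.any_eq_true.2 ⟨0 * groupSize B.length k + α 0,
      List.mem_range.2 (group_lt hk (hα 0 hk)), (hx 0 hk _ (hα 0 hk)).2 rfl⟩
  have hall : (List.range (k * groupSize B.length k)).all x = false := by
    rw [Bool.eq_false_iff]
    intro h
    rw [List.all_eq_true] at h
    have h0 := (hx 0 hk 0 (by omega)).1 (h _ (List.mem_range.2 (group_lt hk (by omega))))
    have h1 := (hx 0 hk 1 (by omega)).1 (h _ (List.mem_range.2 (group_lt hk (by omega))))
    omega
  rw [hall] at p1
  rw [hany] at p2 p3
  change run (k * groupSize B.length k) x (fun _ => x 0) (groupCode φ B k) 0 = true ↔ _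
  rw [groupCode, run_append]
  generalize run _ x (fun _ => x 0) (groupPrelude _) = r at p1 p2 p3
  obtain ⟨c1, c2⟩ := run_groupCheck (x := x) (D := groupSize B.length k) p1 k le_rfl
  have c1' := c1.2 ⟨p3, fun g hg => ⟨α g, hα g hg, (hx g hg _ (hα g hg)).2 rfl⟩⟩
  have c3 := c2 2 le_rfl
  have c4 := c2 3 (by omega)
  rw [p2] at c3
  rw [p1] at c4
  rw [run_append]
  generalize run _ x r (groupCheck _ _ _) = r' at c1' c3 c4
  obtain ⟨h5, h6, h7⟩ := run_varCode (n := k * groupSize B.length k) (x := x) (V := φ.numVars)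
    (blk := groupBlock (k * groupSize B.length k) B k) (τ := τ) hB.1
    (fun j hj r hr => by rw [hτ j hj]; exact run_groupBlock hk hj hα hx hr) c3 c4
  rw [run_append, run_hornCode hB h5 h7, h6, c1']
  simp only [true_and]
  refine exists_congr fun τ' => and_congr_left fun _ => ?_
  constructor
  · intro h j hj
    rw [← hτ j hj]
    refine h _ ?_
    rw [List.getD_eq_getElem _ _ hj]; exact List.getElem_mem hj
  · intro h v hv
    obtain ⟨j, hj, rfl⟩ := List.getElem_of_mem hv
    have := h j hj
    rw [← hτ j hj] at this
    rwa [List.getD_eq_getElem _ _ hj] at this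

/-- An accepted assignment of weight at most `k` has exactly one True input in each group. -/
theorem exists_of_groupProg_accepts (hB : φ.IsStrongHornBackdoor B) {k : ℕ} (hk : 0 < k)
    (hw : ((Finset.range (k * groupSize B.length k)).filter fun q => x q = true).card ≤ k)
    (hacc : (groupProg φ B hB k hk).Accepts x) :
    ∃ α : ℕ → ℕ, (∀ g < k, α g < groupSize B.length k) ∧
      ∀ g < k, ∀ a < groupSize B.length k,
        (x (g * groupSize B.length k + a) = true ↔ a = α g) := by
  have hD := two_le_groupSize B.length k
  set D := groupSize B.length k with hDdef
  have hn : 0 < k * D := Nat.mul_pos hk (by omega)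
  obtain ⟨p1, p2, p3⟩ := run_groupPrelude (x := x) hn
  have hall : (List.range (k * D)).all x = false := by
    rw [Bool.eq_false_iff]
    intro h
    rw [List.all_eq_true] at h
    -- If all inputs were True, the weight would be `k * D ≥ 2 * k > k`.
    rw [Finset.filter_true_of_mem (fun q hq => h q (List.mem_range.2 (Finset.mem_range.1 hq))),
      Finset.card_range] at hw
    nlinarith
  rw [hall] at p1
  change run (k * D) x (fun _ => x 0) (groupCode φ B k) 0 = true at hacc
  rw [groupCode, ← hDdef, run_append, run_append] at hacc
  -- After the group check, register 0 changes by conjunctions only, so final acceptance implies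
  -- that the check succeeded. Nothing is yet known here about the meaning of the remaining
  -- registers.
  have hchk := of_run (fun I hI hI0 => by
    rcases List.mem_append.1 hI with hI | hI
    · rcases mem_varCode hI with ⟨v, hv, rfl⟩ | ⟨j, hj, hI⟩
      · simp [orReg] at hI0
      · simp only [groupBlock, List.mem_cons, List.mem_map, List.mem_range] at hI
        rcases hI with rfl | rfl | ⟨a, ha, rfl⟩
        · simp [andReg] at hI0
        · simp [andReg] at hI0
        · simp only [orInput] at hI0
          split_ifs at hI0 <;> omega
    · exact (hornCode_spec hI).2.2 hI0) hacc
  rw [(run_groupCheck (x := x) p1 k le_rfl).1] at hchk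
  have hex := hchk.2
  choose! α hα hxα using hex
  refine ⟨α, hα, fun g hg a ha => ⟨fun hxa => ?_, fun h => by rw [h]; exact hxα g hg⟩⟩
  -- Each of the `k` groups has a True input and there are at most `k` True inputs, so the map from
  -- True inputs to their groups is injective.
  have hinj := Finset.injOn_of_surjOn_of_card_le (s := (Finset.range (k * D)).filter
    fun q => x q = true) (t := Finset.range k) (fun q => q / D)
    (by
      intro q hq
      simp only [Finset.coe_filter, Finset.mem_range, Set.mem_ofPred_eq] at hq
      simp only [Finset.coe_range, Set.mem_Iio]
      rw [Nat.div_lt_iff_lt_mul (by omega)]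
      exact hq.1)
    (by
      intro g hg
      simp only [Finset.coe_range, Set.mem_Iio] at hg
      refine ⟨g * D + α g, ?_, ?_⟩
      · simp only [Finset.coe_filter, Finset.mem_range, Set.mem_ofPred_eq]
        exact ⟨group_lt hg (hα g hg), hxα g hg⟩
      · change (g * D + α g) / D = g
        rw [Nat.mul_comm, Nat.mul_add_div (by omega), Nat.div_eq_of_lt (hα g hg), Nat.add_zero])
    (by simpa using hw)
  have h1 : (g * D + a) / D = g := by
    rw [Nat.mul_comm, Nat.mul_add_div (by omega), Nat.div_eq_of_lt ha, Nat.add_zero]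
  have h2 : (g * D + α g) / D = g := by
    rw [Nat.mul_comm, Nat.mul_add_div (by omega), Nat.div_eq_of_lt (hα g hg), Nat.add_zero]
  have := hinj (x₁ := g * D + a) (x₂ := g * D + α g)
    (by simp only [Finset.coe_filter, Finset.mem_range, Set.mem_ofPred_eq]
        exact ⟨group_lt hg ha, hxa⟩)
    (by simp only [Finset.coe_filter, Finset.mem_range, Set.mem_ofPred_eq]
        exact ⟨group_lt hg (hα g hg), hxα g hg⟩) (h1.trans h2.symm)
  omega

theorem groupProg_satisfiable (hB : φ.IsStrongHornBackdoor B) {k : ℕ} (hk : 0 < k) :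
    (∃ x, (groupProg φ B hB k hk).toCircuit.Accepts x ∧
      (groupProg φ B hB k hk).toCircuit.weight x ≤ k) ↔ φ.Satisfiable := by
  have hD := two_le_groupSize B.length k
  simp only [RegProg.toCircuit_accepts, Circuit.weight, RegProg.toCircuit_inputs]
  constructor
  · rintro ⟨x, h1, h2⟩
    obtain ⟨α, h3, h4⟩ := exists_of_groupProg_accepts hB hk h2 h1
    obtain ⟨τ, -, h⟩ := (groupProg_accepts_iff hB hk h3 h4).1 h1
    exact ⟨τ, h⟩
  · rintro ⟨τ, hτ⟩
    set D := groupSize B.length k with hDdef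
    set L := groupLen B.length k with hLdef
    have hL : 0 < L := Nat.succ_pos _
    -- The bits of `α g` are the values of `τ` on group `g`. Positions beyond the end of the
    -- backdoor read the default variable 0, and those bits are never used.
    let α : ℕ → ℕ := fun g => Nat.ofBits fun t : Fin L => τ (B.getD (g * L + t) 0)
    have hα : ∀ g, α g < D := fun g => Nat.ofBits_lt_two_pow _
    have hdiv : ∀ g, ∀ a < D, (g * D + a) / D = g := fun g a ha => by
      rw [Nat.mul_comm, Nat.mul_add_div (by omega), Nat.div_eq_of_lt ha, Nat.add_zero]
    have hmod : ∀ g, ∀ a < D, (g * D + a) % D = a := fun g a ha => by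
      rw [Nat.mul_comm, Nat.mul_add_mod, Nat.mod_eq_of_lt ha]
    refine ⟨fun q => decide (q % D = α (q / D)), ?_, ?_⟩
    · refine (groupProg_accepts_iff hB hk (fun g _ => hα g) fun g hg a ha => ?_).2
        ⟨τ, fun j hj => ?_, hτ⟩
      · rw [← hDdef, hdiv g a ha, hmod g a ha, decide_eq_true_iff]
      · have h1 : j % L < L := Nat.mod_lt _ hL
        have h2 : j / L * L + j % L = j := Nat.div_add_mod' j L
        rw [← hLdef, Nat.testBit_ofBits_lt _ _ h1]
        simp only [h2]
    -- At most one input per group is True, so the weight is at most the number of groups.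
    · refine (Finset.card_le_card_of_injOn (t := Finset.range k) (fun q => q / D) ?_ ?_).trans
        (Finset.card_range k).le
      · intro q hq
        simp only [Finset.coe_filter, Finset.mem_range, Set.mem_ofPred_eq] at hq
        simp only [Finset.coe_range, Set.mem_Iio]
        rw [Nat.div_lt_iff_lt_mul (by omega)]
        exact hq.1
      · intro q hq q' hq' hqq
        simp only [Finset.coe_filter, Finset.mem_range, Set.mem_ofPred_eq, decide_eq_true_iff]
          at hq hq' hqq
        rw [← Nat.div_add_mod q D, ← Nat.div_add_mod q' D, hq.2, hq'.2, hqq]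

end CNF

namespace RAM

variable {Γ Δ : Type} [Ctx Γ] [Ctx Δ]

/-! ### Words that are concatenations of blocks -/

/-- The position of block `t`. -/
def offset {α : Type} (l : List α) (g : α → List ℕ) (t : ℕ) : ℕ := ((l.take t).flatMap g).length

theorem offset_succ {α : Type} {l : List α} {g : α → List ℕ} {t : ℕ} (ht : t < l.length) :
    offset l g (t + 1) = offset l g t + (g l[t]).length := by
  rw [offset, List.take_add_one, List.getElem?_eq_getElem ht, List.flatMap_append,
    List.length_append]
  simp [offset]

theorem getD_offset {α : Type} {l : List α} {g : α → List ℕ} {t j : ℕ} (ht : t < l.length)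
    (hj : j < (g l[t]).length) : (l.flatMap g).getD (offset l g t + j) 0 = (g l[t]).getD j 0 := by
  have h : l.flatMap g = (l.take t).flatMap g ++ (g l[t] ++ (l.drop (t + 1)).flatMap g) := by
    conv_lhs => rw [← List.take_append_drop t l, List.flatMap_append,
      List.drop_eq_getElem_cons ht, List.flatMap_cons]
  rw [h, List.getD_append_right _ _ _ _ (by rw [offset]; omega), offset, Nat.add_sub_cancel_left,
    List.getD_append _ _ _ _ hj]

/-- With blocks of varying length, the position of a block is found by walking: `blk` reads the
length of the block at the current position, which is then added. Clamping by the number of blocks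
bounds the walk. -/
theorem Comp.offset {α : Type} {l : Γ → List α} {g : α → List ℕ} {blk : Γ → ℕ → ℕ} {t : Γ → ℕ}
    (hblk : ∀ γ t, (h : t < (l γ).length) →
      blk γ (RAM.offset (l γ) g t) = (g (l γ)[t]).length)
    (hc : Comp (fun p : Γ × ℕ => blk p.1 p.2)) (hn : Comp fun γ => (l γ).length)
    (pn : PolyBdd fun γ => (l γ).length) (ht : Comp t) :
    Comp (fun γ => RAM.offset (l γ) g (Min.min (t γ) (l γ).length)) := by
  -- The step of the recursion sees both the index and the position, but `blk` depends on the
  -- position alone. The code for `blk` is reused by placing its loop variable where the accumulator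
  -- is.
  have hs : Comp (fun p : (Γ × ℕ) × ℕ => p.2 + blk p.1.1 p.2) := by
    obtain ⟨code, T, pT, h⟩ := hc
    refine Comp.snd.add ⟨fun ρ s => code (Function.update ρ (Ctx.vars Γ) (ρ (Ctx.vars Γ + 1))) s,
      fun p => T (p.1.1, p.2), ?_, fun ρ s p σ hp hσ => ?_⟩
    · obtain ⟨c, e, hce⟩ := pT
      exact ⟨c, e, fun p => hce (p.1.1, p.2)⟩
    · refine h _ s (p.1.1, p.2) σ ⟨hp.two_le, fun i hi => ?_⟩
        ⟨hσ.word, hσ.length, fun i hi => ?_⟩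
      · change i < Ctx.vars Γ + 1 at hi
        by_cases hv : i = Ctx.vars Γ
        · subst hv; rw [Function.update_self]; exact hp.slot _ (Nat.lt_succ_self _)
        · rw [Function.update_of_ne hv]; exact hp.slot i (by change i < Ctx.vars Γ + 1 + 1; omega)
      · change i < Ctx.vars Γ + 1 at hi
        by_cases hv : i = Ctx.vars Γ
        · subst hv
          have := hσ.slot (Ctx.vars Γ + 1) (Nat.lt_succ_self _)
          rw [Function.update_self, this]
          simp [Ctx.slot, Ctx.vars]
        · have := hσ.slot i (by change i < Ctx.vars Γ + 1 + 1; omega)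
          rw [Function.update_of_ne hv, this]
          have h2 : i ≠ Ctx.vars Γ + 1 := by omega
          simp [Ctx.slot, Ctx.vars, hv, h2]
  refine (natRec (ht.min hn) (pn.mono fun γ => min_le_right _ _) (const 0)
    (step := fun γ _ a => a + blk γ a) hs).congr fun γ => ?_
  have key : ∀ m ≤ (l γ).length, Nat.rec (motive := fun _ => ℕ) 0 (fun _ a => a + blk γ a) m =
      RAM.offset (l γ) g m := by
    intro m hm
    induction m with
    | zero => simp [RAM.offset]
    | succ m ih => simp only [ih (by omega), hblk γ m hm, offset_succ hm]
  exact key _ (min_le_right _ _)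

/-- Machine loops count, so traversing a list becomes traversing its indices; the default value is
never read. -/
theorem flatMap_eq_range {α β : Type} (l : List α) (d : α) (f : α → List β) :
    l.flatMap f = (List.range l.length).flatMap fun i => f (l.getD i d) := by
  conv_lhs => rw [show l = (List.range l.length).map fun i => l.getD i d from
    List.ext_getElem (by simp) fun i h1 h2 => by
      rw [List.getElem_map, List.getElem_range, List.getD_eq_getElem _ _ h1]]
  rw [List.flatMap_map]

theorem map_eq_range {α β : Type} (l : List α) (d : α) (f : α → β) :
    l.map f = (List.range l.length).map fun i => f (l.getD i d) := by
  conv_lhs => rw [show l = (List.range l.length).map fun i => l.getD i d from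
    List.ext_getElem (by simp) fun i h1 h2 => by
      rw [List.getElem_map, List.getElem_range, List.getD_eq_getElem _ _ h1]]
  rw [List.map_map]
  rfl

/-! ### Computable instructions -/

structure CompI (I : Γ → Instr) : Prop where
  op : Comp fun γ => (I γ).op
  tgt : Comp fun γ => (I γ).tgt
  src : Comp fun γ => (I γ).src

/-- A list of instructions that depends on the context is computable in polynomial time. -/
def CompC (f : Γ → List Instr) : Prop :=
  CompL fun γ => (f γ).flatMap fun I => [I.op, I.tgt, I.src]

namespace CompI

variable {n t j : Γ → ℕ}

theorem andReg (hn : Comp n) (ht : Comp t) (hj : Comp j) :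
    CompI (fun γ => Instr.andReg (n γ) (t γ) (j γ)) := ⟨.const 0, ht, hn.add hj⟩

theorem orReg (hn : Comp n) (ht : Comp t) (hj : Comp j) :
    CompI (fun γ => Instr.orReg (n γ) (t γ) (j γ)) := ⟨.const 1, ht, hn.add hj⟩

theorem andInput (ht : Comp t) (hj : Comp j) :
    CompI (fun γ => Instr.andInput (t γ) (j γ)) := ⟨.const 0, ht, hj⟩

theorem orInput (ht : Comp t) (hj : Comp j) :
    CompI (fun γ => Instr.orInput (t γ) (j γ)) := ⟨.const 1, ht, hj⟩

theorem neg (ht : Comp t) : CompI (fun γ => Instr.neg (t γ)) := ⟨.const 2, ht, .const 0⟩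

theorem ite {p : Γ → Prop} [DecidablePred p] {f g : Γ → Instr} (hp : CompP p) (hf : CompI f)
    (hg : CompI g) : CompI (fun γ => if p γ then f γ else g γ) :=
  ⟨(Comp.ite hp hf.op hg.op).congr fun γ => by split_ifs <;> rfl,
    (Comp.ite hp hf.tgt hg.tgt).congr fun γ => by split_ifs <;> rfl,
    (Comp.ite hp hf.src hg.src).congr fun γ => by split_ifs <;> rfl⟩

end CompI

namespace CompC

variable {f g : Γ → List Instr}

theorem congr (hf : CompC f) (h : ∀ γ, f γ = g γ) : CompC g := by
  obtain rfl : f = g := funext h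
  exact hf

theorem fst (hf : CompC f) : CompC (fun p : Γ × ℕ => f p.1) := CompL.fst hf

theorem nil : CompC (fun _ : Γ => []) := CompL.nil

theorem append (hf : CompC f) (hg : CompC g) : CompC (fun γ => f γ ++ g γ) :=
  (CompL.append hf hg).congr fun γ => by rw [List.flatMap_append]

theorem cons {I : Γ → Instr} (hI : CompI I) (hf : CompC f) : CompC (fun γ => I γ :: f γ) :=
  (CompL.cons hI.op (.cons hI.tgt (.cons hI.src hf))).congr fun _ => rfl

theorem flatMap {n : Γ → ℕ} {f : Γ → ℕ → List Instr} (hn : Comp n) (pn : PolyBdd n)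
    (hf : CompC (fun p : Γ × ℕ => f p.1 p.2)) :
    CompC (fun γ => (List.range (n γ)).flatMap (f γ)) :=
  CompL.congr (CompL.flatMap hn pn
    (f := fun γ i => (f γ i).flatMap fun I : Instr => [I.op, I.tgt, I.src]) hf)
    fun γ => by rw [List.flatMap_assoc]

theorem map {n : Γ → ℕ} {f : Γ → ℕ → Instr} (hn : Comp n) (pn : PolyBdd n)
    (hf : CompI (fun p : Γ × ℕ => f p.1 p.2)) :
    CompC (fun γ => (List.range (n γ)).map (f γ)) :=
  (flatMap hn pn (f := fun γ i => [f γ i]) (cons hf nil)).congr fun _ =>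
    List.map_eq_flatMap.symm

end CompC

end RAM

/-! ### Formulas with a backdoor as a context -/

structure HornInst : Type where
  φ : CNF
  B : List ℕ
  isBackdoor : φ.IsStrongHornBackdoor B
  k : ℕ

namespace HornInst

open RAM

def clauseWord (c : Clause) : List ℕ := c.length :: c.flatMap fun l => [l.1, l.2.toNat]

def clause (H : HornInst) (c : ℕ) : Clause := H.φ.clauses.getD c []

def lit (H : HornInst) (c j : ℕ) : Literal := (H.clause c).getD j (0, false)

/-- The size includes the number of inputs of a group, which is exponential in `b / k`; the monotone
reduction is polynomial in this quantity with an exponent independent of `k`. For `k = 0` one has `b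
/ 0 = 0` and groups of size 2, so the same context serves the reduction to general circuits. -/
instance : Ctx HornInst where
  word H := H.φ.encodeWith H.B
  size H := (H.φ.size + 1) * CNF.groupSize H.B.length H.k * (H.k + 1)
  vars := 1
  slot _ H := H.k

theorem size_ge (H : HornInst) : H.φ.size + CNF.groupSize H.B.length H.k + H.k ≤ 3 * Ctx.size H := by
  have h := CNF.groupSize_pos H.B.length H.k
  simp only [Ctx.size]
  generalize CNF.groupSize H.B.length H.k = D at *
  generalize H.φ.size = s
  generalize H.k = k
  have h1 : s ≤ (s + 1) * D * (k + 1) := by nlinarith [Nat.zero_le (s * D * k), Nat.zero_le (s * D)]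
  have h2 : D ≤ (s + 1) * D * (k + 1) := by nlinarith [Nat.zero_le (s * D * k), Nat.zero_le (s * D)]
  have h3 : k ≤ (s + 1) * D * (k + 1) := by nlinarith [Nat.zero_le (s * D * k), Nat.zero_le (s * D)]
  omega

theorem length_le (H : HornInst) : H.B.length ≤ H.φ.numVars := by
  have h : H.B.toFinset ⊆ Finset.range H.φ.numVars := fun v hv =>
    Finset.mem_range.2 (H.isBackdoor.2.1 v (List.mem_toFinset.1 hv))
  have := Finset.card_le_card h
  rwa [List.toFinset_card_of_nodup H.isBackdoor.1, Finset.card_range] at this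

theorem clause_length_le (H : HornInst) (c : ℕ) : (H.clause c).length ≤ H.φ.size := by
  have : (H.clause c).length ≤ (H.φ.clauses.map List.length).sum := by
    by_cases h : c < H.φ.clauses.length
    · rw [clause, List.getD_eq_getElem _ _ h]
      exact List.le_sum_of_mem (List.mem_map_of_mem (List.getElem_mem h))
    · rw [clause, List.getD_eq_default _ _ (Nat.le_of_not_lt h)]; simp
  unfold CNF.size
  omega

theorem bdd_three : PolyBdd (fun H : HornInst => 3 * Ctx.size H) := (PolyLE.const 3).mul .self

theorem bdd_numVars : PolyBdd (fun H : HornInst => H.φ.numVars) :=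
  bdd_three.mono fun H => by have := size_ge H; unfold CNF.size at this; omega

theorem bdd_B : PolyBdd (fun H : HornInst => H.B.length) :=
  bdd_numVars.mono length_le

theorem bdd_clauses : PolyBdd (fun H : HornInst => H.φ.clauses.length) :=
  bdd_three.mono fun H => by have := size_ge H; unfold CNF.size at this; omega

theorem bdd_k : PolyBdd (fun H : HornInst => H.k) :=
  bdd_three.mono fun H => by have := H.size_ge; omega

theorem bdd_groupSize : PolyBdd (fun H : HornInst => CNF.groupSize H.B.length H.k) :=
  bdd_three.mono fun H => by have := H.size_ge; omega

theorem bdd_groupLen : PolyBdd (fun H : HornInst => CNF.groupLen H.B.length H.k) :=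
  (bdd_B.add (.const 1)).mono fun _ => Nat.add_le_add_right (Nat.div_le_self _ _) 1

variable {Δ : Type} [Ctx Δ] {β : Δ → HornInst}

theorem bdd_clause (hβ : Base β) (c : Δ → ℕ) :
    PolyBdd (fun δ => ((β δ).clause (c δ)).length) :=
  (hβ.bdd bdd_three).mono fun δ => by
    have := (β δ).clause_length_le (c δ)
    have := (β δ).size_ge
    omega

/-- The clauses are preceded by the backdoor and by three numbers: its length, `numVars` and the
number of clauses. -/
theorem word_getD_add (H : HornInst) (i : ℕ) :
    (Ctx.word H).getD (H.B.length + 3 + i) 0 = (H.φ.clauses.flatMap clauseWord).getD i 0 := by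
  change (H.B.length :: (H.B ++ _ :: _ :: List.flatMap _ _)).getD _ 0 = _
  rw [show H.B.length + 3 + i = (H.B.length + (i + 2)) + 1 by ring, List.getD_cons_succ,
    List.getD_append_right _ _ _ _ (by omega), Nat.add_sub_cancel_left]
  rfl

theorem comp_B (hβ : Base β) : Comp (fun δ => (β δ).B.length) := hβ.get (.const 0)

theorem comp_k (hβ : Base β) : Comp (fun δ => (β δ).k) := hβ.slot 0 Nat.one_pos

theorem comp_numVars (hβ : Base β) : Comp (fun δ => (β δ).φ.numVars) :=
  (hβ.get ((comp_B hβ).add (.const 1))).congr fun δ => by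
    change (_ :: (_ ++ _ :: _ :: List.flatMap _ _)).getD _ 0 = _
    rw [List.getD_cons_succ, List.getD_append_right _ _ _ _ le_rfl, Nat.sub_self]
    rfl

theorem comp_clauses (hβ : Base β) : Comp (fun δ => (β δ).φ.clauses.length) :=
  (hβ.get ((comp_B hβ).add (.const 2))).congr fun δ => by
    change (_ :: (_ ++ _ :: _ :: List.flatMap _ _)).getD (_ + 1 + 1) 0 = _
    rw [List.getD_cons_succ, List.getD_append_right _ _ _ _ (by omega), Nat.add_sub_cancel_left]
    rfl

theorem comp_getD (hβ : Base β) {j : Δ → ℕ} (hj : Comp j) :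
    Comp (fun δ => (β δ).B.getD (j δ) 0) :=
  (Comp.ite (CompP.lt hj (comp_B hβ)) (hβ.get (hj.add (.const 1))) (.const 0)).congr fun δ => by
    split_ifs with h
    · change (_ :: (_ ++ _ :: _ :: List.flatMap _ _)).getD _ 0 = _
      rw [List.getD_cons_succ, List.getD_append _ _ _ _ h]
    · rw [List.getD_eq_default _ _ (Nat.le_of_not_lt h)]

theorem compP_mem (hβ : Base β) {v : Δ → ℕ} (hv : Comp v) : CompP (fun δ => v δ ∈ (β δ).B) :=
  (CompP.exists_lt (comp_B hβ) (hβ.bdd bdd_B) (p := fun δ j => (β δ).B.getD j 0 = v δ)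
    (.eq (comp_getD hβ.fst .snd) hv.fst)).congr fun δ => by
    constructor
    · rintro ⟨j, hj, h⟩
      rw [← h, List.getD_eq_getElem _ _ hj]
      exact List.getElem_mem hj
    · intro h
      obtain ⟨j, hj, h⟩ := List.getElem_of_mem h
      exact ⟨j, hj, by rw [List.getD_eq_getElem _ _ hj, h]⟩

theorem clauseWord_length (c : Clause) : (clauseWord c).length = 1 + 2 * c.length := by
  simp [clauseWord, Nat.mul_comm, Nat.add_comm]

theorem comp_offset (hβ : Base β) {c : Δ → ℕ} (hc : Comp c) : Comp (fun δ =>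
    offset (β δ).φ.clauses clauseWord (min (c δ) (β δ).φ.clauses.length)) := by
  have h : Comp (fun p : Δ × ℕ => (Ctx.word (β p.1)).getD ((β p.1).B.length + 3 + p.2) 0) :=
    hβ.fst.get (((comp_B hβ.fst).add (.const 3)).add .snd)
  refine Comp.offset (blk := fun δ a => 1 + ((Ctx.word (β δ)).getD ((β δ).B.length + 3 + a) 0 +
    (Ctx.word (β δ)).getD ((β δ).B.length + 3 + a) 0)) (fun δ t ht => ?_)
    ((Comp.const 1).add (h.add h)) (comp_clauses hβ) (hβ.bdd bdd_clauses) hc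
  have := getD_offset (g := clauseWord) ht (j := 0) (by rw [clauseWord_length]; omega)
  rw [Nat.add_zero] at this
  rw [word_getD_add, this, clauseWord_length]
  change 1 + (List.length _ + List.length _) = _
  omega

/-- Letter `j` of the word of clause `c`. -/
theorem comp_clauseWord (hβ : Base β) {c j : Δ → ℕ} (hc : Comp c) (hj : Comp j) :
    Comp (fun δ => if c δ < (β δ).φ.clauses.length then
      (Ctx.word (β δ)).getD ((β δ).B.length + 3 +
        (offset (β δ).φ.clauses clauseWord (min (c δ) (β δ).φ.clauses.length) + j δ)) 0
      else 0) :=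
  .ite (.lt hc (comp_clauses hβ)) (hβ.get (((comp_B hβ).add (.const 3)).add
    ((comp_offset hβ hc).add hj))) (.const 0)

theorem comp_clause_length (hβ : Base β) {c : Δ → ℕ} (hc : Comp c) :
    Comp (fun δ => ((β δ).clause (c δ)).length) :=
  (comp_clauseWord hβ hc (.const 0)).congr fun δ => by
    split_ifs with h
    · rw [word_getD_add, min_eq_left h.le,
        getD_offset h (by rw [clauseWord_length]; omega), clause, List.getD_eq_getElem _ _ h]
      rfl
    · rw [clause, List.getD_eq_default _ _ (Nat.le_of_not_lt h)]; rfl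

theorem clauseWord_getD (c : Clause) {i j : ℕ} (hi : i < 2) (hj : j < c.length) :
    (clauseWord c).getD (1 + (2 * j + i)) 0 =
      [(c.getD j (0, false)).1, (c.getD j (0, false)).2.toNat].getD i 0 := by
  rw [clauseWord, Nat.add_comm 1, List.getD_cons_succ, getD_flatMap (m := 2) (fun _ => rfl) c hi hj,
    List.getD_eq_getElem _ _ hj]

theorem comp_lit (hβ : Base β) {c j : Δ → ℕ} (hc : Comp c) (hj : Comp j) {i : ℕ} (hi : i < 2) :
    Comp (fun δ => [((β δ).lit (c δ) (j δ)).1, ((β δ).lit (c δ) (j δ)).2.toNat].getD i 0) :=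
  (Comp.ite (CompP.lt hj (comp_clause_length hβ hc))
    (comp_clauseWord hβ hc ((Comp.const 1).add ((hj.add hj).add (.const i)))) (.const 0)).congr
      fun δ => by
    split_ifs with h1 h2
    · rw [clause, List.getD_eq_getElem _ _ h2] at h1
      rw [word_getD_add, min_eq_left h2.le, ← Nat.two_mul,
        getD_offset h2 (by rw [clauseWord_length]; omega), clauseWord_getD _ hi h1, lit, clause,
        List.getD_eq_getElem _ _ h2]
    · rw [clause, List.getD_eq_default _ _ (Nat.le_of_not_lt h2)] at h1
      simp at h1
    · rw [lit, List.getD_eq_default _ _ (Nat.le_of_not_lt h1)]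
      interval_cases i <;> rfl

theorem comp_lit_var (hβ : Base β) {c j : Δ → ℕ} (hc : Comp c) (hj : Comp j) :
    Comp (fun δ => ((β δ).lit (c δ) (j δ)).1) := comp_lit hβ hc hj zero_lt_two

theorem compP_lit_sign (hβ : Base β) {c j : Δ → ℕ} (hc : Comp c) (hj : Comp j) :
    CompP (fun δ => ((β δ).lit (c δ) (j δ)).2 = true) :=
  (CompP.eq (comp_lit hβ hc hj one_lt_two) (.const 1)).congr fun δ => by
    change Bool.toNat _ = 1 ↔ _
    cases ((β δ).lit (c δ) (j δ)).2 <;> simp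

theorem compP_isHead (hβ : Base β) {c j : Δ → ℕ} (hc : Comp c) (hj : Comp j) :
    CompP (fun δ => CNF.IsHead (β δ).B ((β δ).lit (c δ) (j δ))) :=
  (compP_lit_sign hβ hc hj).and (compP_mem hβ (comp_lit_var hβ hc hj)).not

theorem comp_reg (i : ℕ) {v : Δ → ℕ} (hv : Comp v) : Comp (fun δ => i + 2 * v δ) :=
  (Comp.const i).add ((hv.add hv).congr fun _ => (Nat.two_mul _).symm)

theorem comp_litReg (hβ : Base β) {c j : Δ → ℕ} (hc : Comp c) (hj : Comp j) :
    Comp (fun δ => CNF.litReg ((β δ).lit (c δ) (j δ))) :=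
  .ite (compP_lit_sign hβ hc hj) (comp_reg 5 (comp_lit_var hβ hc hj))
    (comp_reg 4 (comp_lit_var hβ hc hj))

variable {n : Δ → ℕ}

theorem compC_mapClause (hβ : Base β) {c : Δ → ℕ} (hc : Comp c) {f : Δ → Literal → Instr}
    (hf : CompI (fun p : Δ × ℕ => f p.1 ((β p.1).lit (c p.1) p.2))) :
    CompC (fun δ => ((β δ).clause (c δ)).map (f δ)) :=
  (CompC.map (comp_clause_length hβ hc) (bdd_clause hβ c)
    (f := fun δ j => f δ ((β δ).lit (c δ) j)) hf).congr fun _ => (map_eq_range _ (0, false) _).symm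

theorem compC_flatMapClauses (hβ : Base β) {f : Δ → Clause → List Instr}
    (hf : CompC (fun p : Δ × ℕ => f p.1 ((β p.1).clause p.2))) :
    CompC (fun δ => (β δ).φ.clauses.flatMap (f δ)) :=
  (CompC.flatMap (comp_clauses hβ) (hβ.bdd bdd_clauses)
    (f := fun δ c => f δ ((β δ).clause c)) hf).congr fun _ => (flatMap_eq_range _ [] _).symm

theorem compC_accumulate (hβ : Base β) (hn : Comp n) {c : Δ → ℕ} (hc : Comp c) (i : ℕ) :
    CompC (fun δ => Instr.andReg (n δ) 1 3 :: ((β δ).clause (c δ)).map fun l =>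
      Instr.orReg (n δ) 1 (if CNF.IsHead (β δ).B l then i else CNF.litReg l)) :=
  .cons (.andReg hn (.const 1) (.const 3)) (compC_mapClause hβ hc (.orReg hn.fst (.const 1)
    (.ite (compP_isHead hβ.fst hc.fst .snd) (.const i) (comp_litReg hβ.fst hc.fst .snd))))

theorem compC_hornCode (hβ : Base β) (hn : Comp n) :
    CompC (fun δ => CNF.hornCode (n δ) (β δ).φ (β δ).B) := by
  have h1 : CompC (fun p : Δ × ℕ => CNF.headCode (n p.1) (β p.1).B ((β p.1).clause p.2)) :=
    compC_mapClause hβ.fst .snd (.ite (compP_isHead hβ.fst.fst Comp.snd.fst .snd)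
      (.andReg hn.fst.fst (comp_reg 4 (comp_lit_var hβ.fst.fst Comp.snd.fst .snd)) (.const 1))
      (.orReg hn.fst.fst (.const 1) (.const 3)))
  have h2 : CompC (fun δ => CNF.roundCode (n δ) (β δ).B (β δ).φ.clauses) :=
    compC_flatMapClauses hβ ((compC_accumulate hβ.fst hn.fst .snd 3).append h1)
  have h3 : CompC (fun δ => (β δ).φ.clauses.flatMap (CNF.checkCode (n δ) (β δ).B)) :=
    compC_flatMapClauses hβ ((compC_accumulate hβ.fst hn.fst .snd 2).append
      (.cons (.andReg hn.fst (.const 0) (.const 1)) .nil))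
  exact (CompC.flatMap (comp_numVars hβ) (hβ.bdd bdd_numVars)
    (f := fun δ _ => CNF.roundCode (n δ) (β δ).B (β δ).φ.clauses) h2.fst).append h3

theorem compC_varCode (hβ : Base β) (hn : Comp n) {blk : Δ → ℕ → List Instr}
    (hblk : CompC (fun p : Δ × ℕ => blk p.1 p.2)) :
    CompC (fun δ => CNF.varCode (n δ) (β δ).φ.numVars (β δ).B.length (blk δ)) :=
  (CompC.map (comp_numVars hβ) (hβ.bdd bdd_numVars)
    (f := fun δ v => Instr.orReg (n δ) (4 + 2 * v) 2)
    (.orReg hn.fst (comp_reg 4 .snd) (.const 2))).append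
    (.flatMap (comp_B hβ) (hβ.bdd bdd_B) hblk)

theorem compL_neg : CompL (fun H : HornInst => (CNF.negProg H.φ H.B H.isBackdoor).encode) := by
  have hβ := Base.id (Γ := HornInst)
  have hn := (comp_B hβ).add (.const 1)
  have hv := comp_getD hβ.fst .snd
  have hblk : CompC (fun p : HornInst × ℕ => CNF.negBlock (p.1.B.length + 1) p.1.B p.2) :=
    .cons (.andReg hn.fst (comp_reg 4 hv) (.const 3)) <|
    .cons (.orInput (comp_reg 4 hv) (Comp.snd.add (.const 1))) <|
    .cons (.neg (comp_reg 4 hv)) <|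
    .cons (.andReg hn.fst (comp_reg 5 hv) (.const 3)) <|
    .cons (.orInput (comp_reg 5 hv) (Comp.snd.add (.const 1))) .nil
  have hpre : CompC (fun H : HornInst => [Instr.neg 2, Instr.orInput 2 0, Instr.neg 3,
      Instr.andInput 3 0, Instr.orReg (H.B.length + 1) 0 2]) :=
    .cons (.neg (.const 2)) <| .cons (.orInput (.const 2) (.const 0)) <|
    .cons (.neg (.const 3)) <| .cons (.andInput (.const 3) (.const 0)) <|
    .cons (.orReg hn (.const 0) (.const 2)) .nil
  exact .cons hn (.cons (comp_reg 4 (comp_numVars hβ))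
    (hpre.append ((compC_varCode hβ hn (blk := fun H => CNF.negBlock (H.B.length + 1) H.B)
      hblk).append (compC_hornCode hβ hn))))

theorem comp_groupLen (hβ : Base β) :
    Comp (fun δ => CNF.groupLen (β δ).B.length (β δ).k) :=
  ((comp_B hβ).div (hβ.bdd bdd_B) (comp_k hβ) (hβ.bdd bdd_k)).add (.const 1)

theorem comp_groupSize (hβ : Base β) :
    Comp (fun δ => CNF.groupSize (β δ).B.length (β δ).k) :=
  (comp_groupLen hβ).two_pow (hβ.bdd bdd_groupLen)

theorem comp_groupInputs (hβ : Base β) :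
    Comp (fun δ => (β δ).k * CNF.groupSize (β δ).B.length (β δ).k) :=
  (comp_k hβ).mul' (comp_groupSize hβ) (hβ.bdd bdd_groupSize)

theorem bdd_groupInputs :
    PolyBdd (fun H : HornInst => H.k * CNF.groupSize H.B.length H.k) := bdd_k.mul bdd_groupSize

theorem compC_groupBlock (hβ : Base β) {j : Δ → ℕ} (hj : Comp j) (pj : PolyBdd j) :
    CompC (fun δ => CNF.groupBlock ((β δ).k * CNF.groupSize (β δ).B.length (β δ).k)
      (β δ).B (β δ).k (j δ)) := by
  have hv := comp_getD hβ hj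
  have hn := comp_groupInputs hβ
  have hL := comp_groupLen hβ
  have pL := hβ.bdd bdd_groupLen
  have pD := hβ.bdd bdd_groupSize
  have ht : Comp (fun δ => j δ % CNF.groupLen (β δ).B.length (β δ).k) := hj.mod pj hL pL
  have pt : PolyBdd (fun δ => j δ % CNF.groupLen (β δ).B.length (β δ).k) :=
    pj.mono fun δ => Nat.mod_le _ _
  have hg : Comp (fun δ => j δ / CNF.groupLen (β δ).B.length (β δ).k *
      CNF.groupSize (β δ).B.length (β δ).k) := (hj.div pj hL pL).mul' (comp_groupSize hβ) pD
  have htgt : Comp (fun p : Δ × ℕ =>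
      if p.2.testBit (j p.1 % CNF.groupLen (β p.1).B.length (β p.1).k) = true
        then 5 + 2 * (β p.1).B.getD (j p.1) 0 else 4 + 2 * (β p.1).B.getD (j p.1) 0) :=
    .ite (Comp.snd.testBit ht.fst pt.fst) (comp_reg 5 hv.fst) (comp_reg 4 hv.fst)
  exact .cons (.andReg hn (comp_reg 4 hv) (.const 3)) <|
    .cons (.andReg hn (comp_reg 5 hv) (.const 3)) <|
    .map (comp_groupSize hβ) pD
      (f := fun δ a => Instr.orInput (if a.testBit (j δ % CNF.groupLen (β δ).B.length (β δ).k) = true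
          then 5 + 2 * (β δ).B.getD (j δ) 0 else 4 + 2 * (β δ).B.getD (j δ) 0)
        (j δ / CNF.groupLen (β δ).B.length (β δ).k * CNF.groupSize (β δ).B.length (β δ).k + a))
      (.orInput htgt (hg.fst.add .snd))

theorem compC_groupCheck (hβ : Base β) :
    CompC (fun δ => CNF.groupCheck ((β δ).k * CNF.groupSize (β δ).B.length (β δ).k)
      (CNF.groupSize (β δ).B.length (β δ).k) (β δ).k) := by
  have hn := comp_groupInputs hβ
  have pD := hβ.bdd bdd_groupSize
  have hg : Comp (fun p : Δ × ℕ => p.2 * CNF.groupSize (β p.1).B.length (β p.1).k) :=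
    Comp.snd.mul' (comp_groupSize hβ.fst) pD.fst
  exact .flatMap (comp_k hβ) (hβ.bdd bdd_k)
      (f := fun δ g => Instr.andReg ((β δ).k * CNF.groupSize (β δ).B.length (β δ).k) 1 3 ::
        ((List.range (CNF.groupSize (β δ).B.length (β δ).k)).map (fun a =>
          Instr.orInput 1 (g * CNF.groupSize (β δ).B.length (β δ).k + a)) ++
          [Instr.andReg ((β δ).k * CNF.groupSize (β δ).B.length (β δ).k) 0 1]))
      (.cons (.andReg hn.fst (.const 1) (.const 3)) (.append
        (.map (comp_groupSize hβ.fst) pD.fst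
          (f := fun p a => Instr.orInput 1 (p.2 * CNF.groupSize (β p.1).B.length (β p.1).k + a))
          (.orInput (.const 1) (hg.fst.add .snd)))
        (.cons (.andReg hn.fst (.const 0) (.const 1)) .nil)))

theorem compC_groupPrelude {n : Δ → ℕ} (hn : Comp n) (pn : PolyBdd n) :
    CompC (fun δ => CNF.groupPrelude (n δ)) :=
  (CompC.map hn pn (f := fun _ j => Instr.andInput 3 j) (.andInput (.const 3) .snd)).append
    ((CompC.map hn pn (f := fun _ j => Instr.orInput 2 j) (.orInput (.const 2) .snd)).append
      (.cons (.orReg hn (.const 0) (.const 2)) .nil))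

/-- The encoding of `CNF.groupProg` written out, since that program requires `0 < k` while the
context allows every `k`. -/
theorem compL_group : CompL (fun H : HornInst => H.k * CNF.groupSize H.B.length H.k ::
    (4 + 2 * H.φ.numVars) :: (CNF.groupCode H.φ H.B H.k).flatMap
      fun I => [I.op, I.tgt, I.src]) := by
  have hβ := Base.id (Γ := HornInst)
  have hn := comp_groupInputs hβ
  -- The index `j` is divided by the group length, so it has to be bounded; the clamp disappears for
  -- the indices that occur.
  have hblk := compC_groupBlock hβ.fst (j := fun p => Min.min p.2 p.1.B.length)
    (Comp.snd.min (comp_B hβ.fst)) ((PolyBdd.fst bdd_B).mono fun p => min_le_right _ _)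
  have hvar : CompC (fun H : HornInst => CNF.varCode (H.k * CNF.groupSize H.B.length H.k)
      H.φ.numVars H.B.length
      (CNF.groupBlock (H.k * CNF.groupSize H.B.length H.k) H.B H.k)) :=
    (compC_varCode hβ hn (blk := fun H j => CNF.groupBlock (H.k * CNF.groupSize H.B.length H.k)
      H.B H.k (Min.min j H.B.length)) hblk).congr fun H => by
        simp only [CNF.varCode]
        congr 1
        refine List.flatMap_congr fun j hj => ?_
        rw [min_eq_left (List.mem_range.1 hj).le]
  have hcode : CompC (fun H : HornInst => CNF.groupCode H.φ H.B H.k) :=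
    (compC_groupPrelude hn bdd_groupInputs).append ((compC_groupCheck hβ).append
      (hvar.append (compC_hornCode hβ hn)))
  exact .cons hn (.cons (comp_reg 4 (comp_numVars hβ)) hcode)

end HornInst

/-! ### Horn formulas that evaluate a circuit -/

/-- Restriction only drops clauses and removes the literals over `B`. It therefore suffices to look
at the positive literals outside `B` in the original clauses, independently of the assignment. -/
theorem CNF.isStrongHornBackdoor {φ : CNF} {B : List ℕ} (hB : B.Nodup)
    (hlt : ∀ x ∈ B, x < φ.numVars)
    (h : ∀ c ∈ φ.clauses, ∀ x y : ℕ, (x, true) ∈ c → (y, true) ∈ c → x ∉ B → y ∉ B → x = y) :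
    φ.IsStrongHornBackdoor B := by
  refine ⟨hB, hlt, fun τ c hc x y hx hy => ?_⟩
  obtain ⟨d, hd, rfl⟩ := List.mem_map.1 hc
  rw [List.mem_filter] at hx hy
  exact h d (List.mem_filter.1 hd).1 x y hx.1 hy.1 (by simpa using hx.2) (by simpa using hy.2)

namespace Circuit

variable (C : Circuit)

def gate (i : ℕ) : Gate := C.gates.getD i .input

theorem getElem?_gate {i : ℕ} (hi : i < C.gates.length) : C.gates[i]? = some (C.gate i) := by
  rw [gate, List.getD_eq_getElem _ _ hi, List.getElem?_eq_getElem hi]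

theorem mem_preds_lt {i j : ℕ} (hi : i < C.gates.length) (hj : j ∈ (C.gate i).preds) :
    j < C.gates.length :=
  C.preds_lt _ (List.mem_of_getElem? (C.getElem?_gate hi)) j hj

theorem mem_inputs {i : ℕ} : i ∈ C.inputs ↔ i < C.gates.length ∧ (C.gate i).tag = 0 := by
  rw [inputs, Finset.mem_filter, Finset.mem_range]
  refine and_congr_right fun hi => ?_
  rw [C.getElem?_gate hi, Option.some_inj]
  cases C.gate i <;> simp [Gate.tag]

/-- Every vertex except the sink has an outgoing arc, so it occurs in some list of in-neighbours. -/
theorem length_le_size : C.gates.length ≤ C.size + 1 := by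
  classical
  have h : Finset.range C.gates.length ⊆
      insert C.out (C.gates.flatMap Gate.preds).toFinset := by
    intro i hi
    rw [Finset.mem_range] at hi
    by_cases ho : i = C.out
    · exact ho ▸ Finset.mem_insert_self _ _
    · refine Finset.mem_insert_of_mem (List.mem_toFinset.2 (List.mem_flatMap.2 ?_))
      have := mt (C.sink_iff i hi).1 ho
      push Not at this
      obtain ⟨j, g, hg, hj⟩ := this
      exact ⟨g, List.mem_of_getElem? hg, hj⟩
  have := (Finset.card_le_card h).trans (Finset.card_insert_le _ _)
  rw [Finset.card_range] at this
  refine this.trans (Nat.add_le_add_right ((List.toFinset_card_le _).trans ?_) 1)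
  rw [List.length_flatMap, size]

theorem preds_length_le (i : ℕ) : (C.gate i).preds.length ≤ C.size := by
  by_cases h : i < C.gates.length
  · exact List.le_sum_of_mem (List.mem_map_of_mem (f := fun g : Gate => g.preds.length)
      (List.mem_of_getElem? (C.getElem?_gate h)))
  · rw [gate, List.getD_eq_default _ _ (Nat.le_of_not_lt h)]
    exact Nat.zero_le _

theorem numInputs_le : C.numInputs ≤ C.gates.length :=
  (Finset.card_filter_le _ _).trans (Finset.card_range _).le

/-- A vertex that is minimal for the arc relation has no in-neighbours. That `n ≥ 1` is needed for
the monotonicity of `n ^ t` in the exponent. -/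
theorem numInputs_pos : 0 < C.numInputs := by
  obtain ⟨i, hi, hmin⟩ := C.wellFounded_arc.has_min {i | i < C.gates.length} ⟨C.out, C.out_lt⟩
  refine Finset.card_pos.2 ⟨i, C.mem_inputs.2 ⟨hi, ?_⟩⟩
  by_contra h
  have hne : C.gate i ≠ .input := fun h' => h (by rw [h']; rfl)
  obtain ⟨j, hj⟩ := List.exists_mem_of_ne_nil _
    (C.preds_ne_nil _ (List.mem_of_getElem? (C.getElem?_gate hi)) hne)
  exact hmin j (C.mem_preds_lt hi hj) ⟨_, C.getElem?_gate hi, hj⟩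

/-- If some vertex is not an input, then `n` is less than the number of vertices and
`length_le_size` applies. Otherwise there are no arcs, and uniqueness of the sink leaves a single
vertex; this is the case that needs the maximum with 1. -/
theorem numInputs_le_size : C.numInputs ≤ max C.size 1 := by
  have h1 := C.numInputs_le
  have h2 := C.length_le_size
  rcases Nat.lt_or_ge C.numInputs C.gates.length with h | h
  · omega
  · have h3 : C.inputs = Finset.range C.gates.length :=
      Finset.eq_of_subset_of_card_le (Finset.filter_subset _ _)
        (by rw [Finset.card_range]; exact h)
    have h4 : ∀ i < C.gates.length, (C.gate i).preds = [] := fun i hi => by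
      have := (C.mem_inputs.1 (h3 ▸ Finset.mem_range.2 hi)).2
      cases hg : C.gate i <;> simp_all [Gate.tag, Gate.preds]
    have h5 : ∀ i < C.gates.length, i = C.out := fun i hi =>
      (C.sink_iff i hi).1 fun j ⟨g, hg, hj⟩ => by
        have hjl := (List.getElem?_eq_some_iff.1 hg).1
        rw [C.getElem?_gate hjl, Option.some_inj] at hg
        rw [← hg, h4 j hjl] at hj
        exact List.not_mem_nil hj
    have h6 : C.gates.length ≤ 1 := by
      by_contra hl
      have := h5 0 (by omega)
      have := h5 1 (by omega)
      omega
    omega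

/-! #### The formula

Variable `i` says that vertex `i` is true and variable `M + i` says that it is false. -/

/-- Each clause derives a value of the vertex from values of its in-neighbours, so even negation
gates give Horn clauses. No clause forbids a vertex to be both true and false; this is not needed,
and one wrong extra value does no harm. Input gates have no in-neighbours and get no clauses. -/
def gateClauses (M i : ℕ) (g : Gate) : List Clause :=
  if g.tag = 1 then
    ((i, true) :: g.preds.map fun u => (u, false)) ::
      g.preds.map fun u => [(M + i, true), (M + u, false)]
  else if g.tag = 2 then
    ((M + i, true) :: g.preds.map fun u => (M + u, false)) ::
      g.preds.map fun u => [(i, true), (u, false)]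
  else g.preds.flatMap fun u => [[(i, true), (M + u, false)], [(M + i, true), (u, false)]]

def evalClauses : List Clause :=
  ((List.range C.gates.length).flatMap fun i => gateClauses C.gates.length i (C.gate i)) ++
    [[(C.gates.length + C.out, false)]]

variable {C}

theorem gateClauses_var_lt {M i : ℕ} {g : Gate} (hi : i < M) (hg : ∀ j ∈ g.preds, j < M) :
    ∀ c ∈ gateClauses M i g, ∀ l ∈ c, l.1 < 2 * M := by
  intro c hc l hl
  unfold gateClauses at hc
  split_ifs at hc
  all_goals
    simp only [List.mem_cons, List.mem_map, List.mem_flatMap, List.not_mem_nil, or_false] at hc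
  · rcases hc with rfl | ⟨u, hu, rfl⟩
    · rcases List.mem_cons.1 hl with rfl | hl
      · dsimp only; omega
      · obtain ⟨u, hu, rfl⟩ := List.mem_map.1 hl
        have := hg u hu
        dsimp only; omega
    · have := hg u hu
      simp only [List.mem_cons, List.not_mem_nil, or_false] at hl
      rcases hl with rfl | rfl <;> dsimp only <;> omega
  · rcases hc with rfl | ⟨u, hu, rfl⟩
    · rcases List.mem_cons.1 hl with rfl | hl
      · dsimp only; omega
      · obtain ⟨u, hu, rfl⟩ := List.mem_map.1 hl
        have := hg u hu
        dsimp only; omega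
    · have := hg u hu
      simp only [List.mem_cons, List.not_mem_nil, or_false] at hl
      rcases hl with rfl | rfl <;> dsimp only <;> omega
  · obtain ⟨u, hu, rfl | rfl⟩ := hc <;>
    · have := hg u hu
      simp only [List.mem_cons, List.not_mem_nil, or_false] at hl
      rcases hl with rfl | rfl <;> dsimp only <;> omega

theorem evalClauses_var_lt : ∀ c ∈ C.evalClauses, ∀ l ∈ c, l.1 < 2 * C.gates.length := by
  intro c hc l hl
  rcases List.mem_append.1 hc with hc | hc
  · obtain ⟨i, hi, hc⟩ := List.mem_flatMap.1 hc
    rw [List.mem_range] at hi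
    exact gateClauses_var_lt hi (fun j hj => C.mem_preds_lt hi hj) c hc l hl
  · obtain rfl := List.mem_singleton.1 hc
    obtain rfl := List.mem_singleton.1 hl
    have := C.out_lt
    dsimp only; omega

theorem gateClauses_horn {M i : ℕ} {g : Gate} : ∀ c ∈ gateClauses M i g, ∀ x y : ℕ,
    (x, true) ∈ c → (y, true) ∈ c → x = y := by
  intro c hc x y hx hy
  unfold gateClauses at hc
  split_ifs at hc
  all_goals
    simp only [List.mem_cons, List.mem_map, List.mem_flatMap, List.not_mem_nil, or_false] at hc
  · rcases hc with rfl | ⟨u, hu, rfl⟩ <;> simp at hx hy <;> omega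
  · rcases hc with rfl | ⟨u, hu, rfl⟩ <;> simp at hx hy <;> omega
  · obtain ⟨u, hu, rfl | rfl⟩ := hc <;> simp at hx hy <;> omega

theorem evalClauses_horn : ∀ c ∈ C.evalClauses, ∀ x y : ℕ,
    (x, true) ∈ c → (y, true) ∈ c → x = y := by
  intro c hc x y hx hy
  rcases List.mem_append.1 hc with hc | hc
  · obtain ⟨i, hi, hc⟩ := List.mem_flatMap.1 hc
    exact gateClauses_horn c hc x y hx hy
  · obtain rfl := List.mem_singleton.1 hc
    simp at hx

/-- The variable for the correct value is forced, by one case of evaluation per clause. The variable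
for the opposite value is left open. -/
theorem gateClauses_propagate {M i : ℕ} {g : Gate} {τ v : ℕ → Bool} {a b : Bool}
    (hτ : ∀ c ∈ gateClauses M i g, ∃ l ∈ c, τ l.1 = l.2)
    (hin : g = .input → if a = true then τ i = true else τ (M + i) = true)
    (hv : g.Computes a v b)
    (ih : ∀ j ∈ g.preds, if v j = true then τ j = true else τ (M + j) = true) :
    if b = true then τ i = true else τ (M + i) = true := by
  cases g with
  | input => exact hv ▸ hin rfl
  | not j =>
    have h1 := hτ [(i, true), (M + j, false)] (by simp [gateClauses, Gate.tag, Gate.preds])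
    have h2 := hτ [(M + i, true), (j, false)] (by simp [gateClauses, Gate.tag, Gate.preds])
    have h3 := ih j (by simp [Gate.preds])
    simp only [Gate.Computes] at hv
    subst hv
    cases hj : v j <;> simp_all
  | and l =>
    have h0 := hτ ((i, true) :: l.map fun u => (u, false))
      (by simp [gateClauses, Gate.tag, Gate.preds])
    have h1 : ∀ u ∈ l, _ := fun u hu => hτ [(M + i, true), (M + u, false)]
      (List.mem_cons_of_mem _ (List.mem_map.2 ⟨u, hu, rfl⟩))
    simp only [Gate.Computes] at hv
    subst hv
    split_ifs with h
    · rw [List.all_eq_true] at h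
      obtain ⟨c, hc, hcτ⟩ := h0
      rcases List.mem_cons.1 hc with rfl | hc
      · exact hcτ
      · obtain ⟨u, hu, rfl⟩ := List.mem_map.1 hc
        have := ih u hu
        rw [if_pos (h u hu)] at this
        simp_all
    · rw [List.all_eq_true] at h
      push Not at h
      obtain ⟨u, hu, h⟩ := h
      have := ih u hu
      rw [if_neg h] at this
      have := h1 u hu
      simp_all
  | or l =>
    have h0 := hτ ((M + i, true) :: l.map fun u => (M + u, false))
      (by simp [gateClauses, Gate.tag, Gate.preds])
    have h1 : ∀ u ∈ l, _ := fun u hu => hτ [(i, true), (u, false)]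
      (List.mem_cons_of_mem _ (List.mem_map.2 ⟨u, hu, rfl⟩))
    simp only [Gate.Computes] at hv
    subst hv
    split_ifs with h
    · rw [List.any_eq_true] at h
      obtain ⟨u, hu, h⟩ := h
      have := ih u hu
      rw [if_pos h] at this
      have := h1 u hu
      simp_all
    · rw [List.any_eq_true] at h
      push Not at h
      obtain ⟨c, hc, hcτ⟩ := h0
      rcases List.mem_cons.1 hc with rfl | hc
      · exact hcτ
      · obtain ⟨u, hu, rfl⟩ := List.mem_map.1 hc
        have := ih u hu
        rw [if_neg (h u hu)] at this
        simp_all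

/-- Well-founded induction along the arcs forces the correct value at every vertex. If the output
were false, this would contradict the last clause, which denies that the output is false. -/
theorem accepts_of_evalClauses {τ x : ℕ → Bool}
    (hτ : ∀ c ∈ C.evalClauses, ∃ l ∈ c, τ l.1 = l.2)
    (hin : ∀ i ∈ C.inputs, if x i = true then τ i = true else τ (C.gates.length + i) = true) :
    C.Accepts x := by
  obtain ⟨v, hv⟩ := C.exists_isValuation x
  have key : ∀ i, i < C.gates.length →
      if v i = true then τ i = true else τ (C.gates.length + i) = true := by
    intro i
    induction i using C.wellFounded_arc.induction with
    | _ i ih =>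
      intro hi
      have hg := C.getElem?_gate hi
      refine gateClauses_propagate (fun c hc => hτ c ?_) (fun h => hin i ?_) (hv i _ hg)
        fun j hj => ih j ⟨_, hg, hj⟩ (C.mem_preds_lt hi hj)
      · exact List.mem_append_left _ (List.mem_flatMap.2 ⟨i, List.mem_range.2 hi, hc⟩)
      · exact C.mem_inputs.2 ⟨hi, by rw [h]; rfl⟩
  have ho := key C.out C.out_lt
  obtain ⟨l, hl, h⟩ := hτ [(C.gates.length + C.out, false)]
    (List.mem_append_right _ (List.mem_singleton_self _))
  obtain rfl := List.mem_singleton.1 hl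
  refine ⟨v, hv, ?_⟩
  by_contra hne
  rw [if_neg hne] at ho
  simp_all

theorem gateClauses_satisfied {M i : ℕ} {g : Gate} {τ v : ℕ → Bool} {a : Bool}
    (hv : g.Computes a v (v i)) (hi : i < M) (hg : ∀ j ∈ g.preds, j < M)
    (hp : ∀ j < M, τ j = v j) (hq : ∀ j < M, τ (M + j) = !v j) :
    ∀ c ∈ gateClauses M i g, ∃ l ∈ c, τ l.1 = l.2 := by
  intro c hc
  cases g with
  | input => simp [gateClauses, Gate.tag, Gate.preds] at hc
  | not j =>
    have hj := hg j (by simp [Gate.preds])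
    simp only [Gate.Computes] at hv
    simp only [gateClauses, Gate.tag, Gate.preds, List.flatMap_cons, List.flatMap_nil] at hc
    norm_num at hc
    rcases hc with rfl | rfl <;>
      simp [hp i hi, hq i hi, hp j hj, hq j hj, hv]
  | and l =>
    simp only [Gate.Computes] at hv
    simp only [gateClauses, Gate.tag, Gate.preds, if_true, List.mem_cons, List.mem_map] at hc
    rcases hc with rfl | ⟨u, hu, rfl⟩
    · by_cases h : ∀ u ∈ l, v u = true
      · exact ⟨_, List.mem_cons_self, by rw [hp i hi, hv]; exact List.all_eq_true.2 h⟩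
      · push Not at h
        obtain ⟨u, hu, h⟩ := h
        exact ⟨(u, false), List.mem_cons_of_mem _ (List.mem_map_of_mem (f := fun u => (u, false)) hu),
          by rw [hp u (hg u hu)]; simpa using h⟩
    · have hul := hg u hu
      cases h : v u
      · refine ⟨_, List.mem_cons_self, ?_⟩
        have : l.all v = false := by rw [List.all_eq_false]; exact ⟨u, hu, by simp [h]⟩
        simp [hq i hi, hv, this]
      · exact ⟨(M + u, false), by simp, by simp [hq u hul, h]⟩
  | or l =>
    simp only [Gate.Computes] at hv
    simp only [gateClauses, Gate.tag, Gate.preds, if_true] at hc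
    norm_num at hc
    rcases hc with rfl | ⟨u, hu, rfl⟩
    · by_cases h : ∃ u ∈ l, v u = true
      · obtain ⟨u, hu, h⟩ := h
        exact ⟨(M + u, false),
          List.mem_cons_of_mem _ (List.mem_map_of_mem (f := fun u => (M + u, false)) hu),
          by simp [hq u (hg u hu), h]⟩
      · refine ⟨_, List.mem_cons_self, ?_⟩
        have : l.any v = false := by
          rw [List.any_eq_false]; exact fun u hu hvu => h ⟨u, hu, hvu⟩
        simp [hq i hi, hv, this]
    · have hul := hg u hu
      cases h : v u
      · exact ⟨(u, false), by simp, by simp [hp u hul, h]⟩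
      · refine ⟨_, List.mem_cons_self, ?_⟩
        rw [hp i hi, hv]
        exact List.any_eq_true.2 ⟨u, hu, h⟩

theorem evalClauses_satisfied {τ x v : ℕ → Bool} (hv : C.IsValuation x v) (hout : v C.out = true)
    (hp : ∀ j < C.gates.length, τ j = v j)
    (hq : ∀ j < C.gates.length, τ (C.gates.length + j) = !v j) :
    ∀ c ∈ C.evalClauses, ∃ l ∈ c, τ l.1 = l.2 := by
  intro c hc
  rcases List.mem_append.1 hc with hc | hc
  · obtain ⟨i, hi, hc⟩ := List.mem_flatMap.1 hc
    rw [List.mem_range] at hi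
    exact gateClauses_satisfied (hv i _ (C.getElem?_gate hi)) hi
      (fun j hj => C.mem_preds_lt hi hj) hp hq c hc
  · obtain rfl := List.mem_singleton.1 hc
    exact ⟨_, List.mem_singleton_self _, by simp [hq _ C.out_lt, hout]⟩

/-! #### Guessing the inputs -/

/-- Variable `2 * M + i`, with `M` the number of vertices, guesses input `i` and forces the matching
value. The second clause has two positive literals, which is why the guess has to be in the
backdoor. -/
def guessClauses (C : Circuit) : List Clause :=
  (List.range C.gates.length).flatMap fun i => if (C.gate i).tag = 0 then
    [[(2 * C.gates.length + i, false), (i, true)],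
      [(2 * C.gates.length + i, true), (C.gates.length + i, true)]] else []

def guessVars (C : Circuit) : List ℕ :=
  (List.range C.gates.length).flatMap fun i => if (C.gate i).tag = 0 then
    [2 * C.gates.length + i] else []

theorem mem_guessClauses {c : Clause} : c ∈ C.guessClauses ↔ ∃ i ∈ C.inputs,
    c = [(2 * C.gates.length + i, false), (i, true)] ∨
      c = [(2 * C.gates.length + i, true), (C.gates.length + i, true)] := by
  simp only [guessClauses, List.mem_flatMap, List.mem_range, mem_inputs]
  refine exists_congr fun i => ?_
  split_ifs with h <;> simp [h]

theorem guessVars_eq : C.guessVars =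
    ((List.range C.gates.length).filter fun i => (C.gate i).tag = 0).map
      (2 * C.gates.length + ·) := by
  rw [guessVars]
  generalize List.range C.gates.length = l
  induction l with
  | nil => rfl
  | cons a l ih =>
    rw [List.flatMap_cons, List.filter_cons, ih]
    by_cases h : (C.gate a).tag = 0 <;> simp [h]

theorem mem_guessVars {w : ℕ} : w ∈ C.guessVars ↔ ∃ i ∈ C.inputs, 2 * C.gates.length + i = w := by
  rw [guessVars_eq]
  simp only [List.mem_map, List.mem_filter, List.mem_range, decide_eq_true_eq, mem_inputs]

theorem guessVars_nodup : C.guessVars.Nodup := by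
  rw [guessVars_eq]
  exact (List.nodup_range.filter _).map fun a b h => Nat.add_left_cancel h

theorem guessVars_length : C.guessVars.length = C.numInputs := by
  have h : C.guessVars.toFinset = C.inputs.image (2 * C.gates.length + ·) := by
    ext w; simp [mem_guessVars]
  rw [← List.toFinset_card_of_nodup guessVars_nodup, h,
    Finset.card_image_of_injective _ fun a b h => Nat.add_left_cancel h, numInputs]

def guessFormula (C : Circuit) : CNF where
  numVars := 3 * C.gates.length
  clauses := C.evalClauses ++ C.guessClauses
  var_lt c hc l hl := by
    rcases List.mem_append.1 hc with hc | hc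
    · have := evalClauses_var_lt c hc l hl
      omega
    · obtain ⟨i, hi, rfl | rfl⟩ := mem_guessClauses.1 hc <;>
      · have := (C.mem_inputs.1 hi).1
        simp only [List.mem_cons, List.not_mem_nil, or_false] at hl
        rcases hl with rfl | rfl <;> dsimp only <;> omega

theorem guessFormula_isBackdoor : C.guessFormula.IsStrongHornBackdoor C.guessVars := by
  refine CNF.isStrongHornBackdoor guessVars_nodup (fun w hw => ?_)
    fun c hc x y hx hy hxB hyB => ?_
  · obtain ⟨i, hi, rfl⟩ := mem_guessVars.1 hw
    have := (C.mem_inputs.1 hi).1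
    change _ < 3 * C.gates.length
    omega
  · rcases List.mem_append.1 hc with hc | hc
    · exact evalClauses_horn c hc x y hx hy
    · obtain ⟨i, hi, rfl | rfl⟩ := mem_guessClauses.1 hc
      · simp at hx hy
        omega
      · have hB := mem_guessVars.2 ⟨i, hi, rfl⟩
        simp only [List.mem_cons, Prod.mk.injEq, and_true, List.not_mem_nil, or_false] at hx hy
        rcases hx with rfl | rfl
        · exact absurd hB hxB
        · rcases hy with rfl | rfl
          · exact absurd hB hyB
          · rfl

theorem guessFormula_satisfiable : C.guessFormula.Satisfiable ↔ C.Satisfiable := by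
  constructor
  · rintro ⟨τ, hτ⟩
    refine ⟨fun i => τ (2 * C.gates.length + i), accepts_of_evalClauses
      (fun c hc => hτ c (List.mem_append_left _ hc)) fun i hi => ?_⟩
    have h1 := hτ _ (List.mem_append_right _ (mem_guessClauses.2 ⟨i, hi, .inl rfl⟩))
    have h2 := hτ _ (List.mem_append_right _ (mem_guessClauses.2 ⟨i, hi, .inr rfl⟩))
    cases h : τ (2 * C.gates.length + i) <;> simp_all
  · rintro ⟨x, v, hv, hout⟩
    set M := C.gates.length with hM
    let τ : ℕ → Bool := fun w => if w < M then v w else if w < 2 * M then !v (w - M)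
      else v (w - 2 * M)
    have hp : ∀ j < M, τ j = v j := fun j hj => by simp [τ, hj]
    have hq : ∀ j < M, τ (M + j) = !v j := fun j hj => by
      have h1 : ¬ M + j < M := by omega
      have h2 : M + j < 2 * M := by omega
      simp only [τ, h1, h2, if_true, if_false, Nat.add_sub_cancel_left]
    have hx : ∀ j < M, τ (2 * M + j) = v j := fun j hj => by
      have h1 : ¬ 2 * M + j < M := by omega
      have h2 : ¬ 2 * M + j < 2 * M := by omega
      simp only [τ, h1, h2, if_false, Nat.add_sub_cancel_left]
    refine ⟨τ, fun c hc => ?_⟩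
    rcases List.mem_append.1 hc with hc | hc
    · exact evalClauses_satisfied hv hout hp hq c hc
    · obtain ⟨i, hi, rfl | rfl⟩ := mem_guessClauses.1 hc
      · have := (C.mem_inputs.1 hi).1
        cases h : v i <;> simp [← hM, hx i this, hp i this, h]
      · have := (C.mem_inputs.1 hi).1
        cases h : v i <;> simp [← hM, hx i this, hq i this, h]

end Circuit

/-! ### Horn formulas that guess a fixed number of true inputs -/

namespace Circuit

variable (C : Circuit)

/-- The number of inputs before vertex `i`. -/
def rank (i : ℕ) : ℕ := ∑ j ∈ Finset.range i, if (C.gate j).tag = 0 then 1 else 0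

theorem rank_length : C.rank C.gates.length = C.numInputs := by
  rw [rank, ← Finset.card_filter, numInputs]
  congr 1
  ext i
  rw [Finset.mem_filter, Finset.mem_range, mem_inputs]

theorem rank_lt_rank {i j : ℕ} (hi : i ∈ C.inputs) (h : i < j) : C.rank i < C.rank j := by
  have h1 : C.rank i < C.rank (i + 1) := by
    rw [rank, rank, Finset.sum_range_succ, if_pos (C.mem_inputs.1 hi).2]
    omega
  exact h1.trans_le (Finset.sum_le_sum_of_subset (Finset.range_subset_range.2 h))

theorem rank_injOn {i j : ℕ} (hi : i ∈ C.inputs) (hj : j ∈ C.inputs) (h : C.rank i = C.rank j) :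
    i = j := by
  rcases lt_trichotomy i j with hij | hij | hij
  · exact absurd h (C.rank_lt_rank hi hij).ne
  · exact hij
  · exact absurd h (C.rank_lt_rank hj hij).ne'

/-- The number of bits that are needed to name an input. -/
def width : ℕ := Nat.clog 2 C.numInputs

theorem rank_lt {i : ℕ} (hi : i ∈ C.inputs) : C.rank i < 2 ^ C.width :=
  ((C.rank_lt_rank hi (C.mem_inputs.1 hi).1).trans_eq C.rank_length).trans_le
    (Nat.le_pow_clog one_lt_two _)

theorem eq_of_testBit {i j : ℕ} (hi : i ∈ C.inputs) (hj : j ∈ C.inputs)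
    (h : ∀ t < C.width, (C.rank i).testBit t = (C.rank j).testBit t) : i = j := by
  refine C.rank_injOn hi hj (Nat.eq_of_testBit_eq fun t => ?_)
  by_cases ht : t < C.width
  · exact h t ht
  · have hp := Nat.pow_le_pow_right two_pos (Nat.le_of_not_lt ht)
    rw [Nat.testBit_lt_two_pow ((C.rank_lt hi).trans_le hp),
      Nat.testBit_lt_two_pow ((C.rank_lt hj).trans_le hp)]

/-- The `j`-th name is not `r`; bit `t` of the `j`-th name is variable `2 * M + (j * L + t)`. -/
def nameNe (M L j r : ℕ) : Clause :=
  (List.range L).map fun t => (2 * M + (j * L + t), !r.testBit t)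

/-- The variable saying that the `j`-th name does not name vertex `i`. -/
def notNamed (M L k j i : ℕ) : ℕ := 2 * M + (k * L + (j * M + i))

/-- For input `i` of rank `r`: a name equal to `r` makes `i` true; a name differing from `r` in some
bit is marked as not naming `i`; no two names are equal to `r`; and if no name is `r`, then `i` is
false. -/
def nameClauses (M L k i r : ℕ) : List Clause :=
  ((List.range k).flatMap fun j => (nameNe M L j r ++ [(i, true)]) ::
    (((List.range L).map fun t =>
      [(2 * M + (j * L + t), r.testBit t), (notNamed M L k j i, true)]) ++
    (List.range j).map fun j' => nameNe M L j r ++ nameNe M L j' r)) ++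
  [((List.range k).map fun j => (notNamed M L k j i, false)) ++ [(M + i, true)]]

/-- Excludes bit patterns that are not the rank of any input. -/
def someNamed (k j : ℕ) : Clause :=
  (List.range C.gates.length).flatMap fun i =>
    if (C.gate i).tag = 0 then [(notNamed C.gates.length C.width k j i, false)] else []

def chooseClauses (k : ℕ) : List Clause :=
  ((List.range C.gates.length).flatMap fun i => if (C.gate i).tag = 0 then
    nameClauses C.gates.length C.width k i (C.rank i) else []) ++ (List.range k).map (C.someNamed k)

def chooseVars (k : ℕ) : List ℕ :=
  (List.range (k * C.width)).map fun t => 2 * C.gates.length + t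

variable {C}

theorem mem_nameNe {M L j r : ℕ} {l : Literal} :
    l ∈ nameNe M L j r ↔ ∃ t < L, (2 * M + (j * L + t), !r.testBit t) = l := by
  simp [nameNe]

theorem mem_nameClauses {M L k i r : ℕ} {c : Clause} : c ∈ nameClauses M L k i r ↔
    (∃ j < k, c = nameNe M L j r ++ [(i, true)] ∨
      (∃ t < L, c = [(2 * M + (j * L + t), r.testBit t), (notNamed M L k j i, true)]) ∨
      ∃ j' < j, c = nameNe M L j r ++ nameNe M L j' r) ∨
    c = ((List.range k).map fun j => (notNamed M L k j i, false)) ++ [(M + i, true)] := by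
  simp only [nameClauses, List.mem_append, List.mem_flatMap, List.mem_cons, List.mem_map,
    List.mem_range, List.not_mem_nil, or_false, eq_comm]

theorem mem_someNamed {k j : ℕ} {l : Literal} : l ∈ C.someNamed k j ↔
    ∃ i ∈ C.inputs, l = (notNamed C.gates.length C.width k j i, false) := by
  simp only [someNamed, List.mem_flatMap, List.mem_range, mem_inputs]
  refine exists_congr fun i => ?_
  split_ifs with h <;> simp [h]

theorem mem_chooseClauses {k : ℕ} {c : Clause} : c ∈ C.chooseClauses k ↔
    (∃ i ∈ C.inputs, c ∈ nameClauses C.gates.length C.width k i (C.rank i)) ∨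
      ∃ j < k, c = C.someNamed k j := by
  simp only [chooseClauses, List.mem_append, List.mem_flatMap, List.mem_map, List.mem_range,
    mem_inputs, eq_comm (a := c)]
  refine or_congr (exists_congr fun i => ?_) Iff.rfl
  split_ifs with h <;> simp [h]

theorem mul_add_lt {j k L t : ℕ} (hj : j < k) (ht : t < L) : j * L + t < k * L := by
  calc j * L + t < j * L + L := Nat.add_lt_add_left ht _
    _ = (j + 1) * L := by ring
    _ ≤ k * L := Nat.mul_le_mul_right _ hj

theorem nameNe_var_lt {M L k j r : ℕ} (hj : j < k) :
    ∀ l ∈ nameNe M L j r, l.1 < 2 * M + (k * L + k * M) := by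
  intro l hl
  obtain ⟨t, ht, rfl⟩ := mem_nameNe.1 hl
  have := mul_add_lt hj ht
  dsimp only; omega

theorem notNamed_lt {M L k j i : ℕ} (hj : j < k) (hi : i < M) :
    notNamed M L k j i < 2 * M + (k * L + k * M) := by
  have := mul_add_lt hj hi
  unfold notNamed; omega

theorem nameClauses_var_lt {M L k i r : ℕ} (hi : i < M) :
    ∀ c ∈ nameClauses M L k i r, ∀ l ∈ c, l.1 < 2 * M + (k * L + k * M) := by
  intro c hc l hl
  rcases mem_nameClauses.1 hc with ⟨j, hj, rfl | ⟨t, ht, rfl⟩ | ⟨j', hj', rfl⟩⟩ | rfl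
  · rcases List.mem_append.1 hl with hl | hl
    · exact nameNe_var_lt hj l hl
    · obtain rfl := List.mem_singleton.1 hl
      dsimp only; omega
  · have := mul_add_lt hj ht
    simp only [List.mem_cons, List.not_mem_nil, or_false] at hl
    rcases hl with rfl | rfl
    · dsimp only; omega
    · exact notNamed_lt hj hi
  · rcases List.mem_append.1 hl with hl | hl
    · exact nameNe_var_lt hj l hl
    · exact nameNe_var_lt (hj'.trans hj) l hl
  · rcases List.mem_append.1 hl with hl | hl
    · obtain ⟨j, hj, rfl⟩ := List.mem_map.1 hl
      exact notNamed_lt (List.mem_range.1 hj) hi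
    · obtain rfl := List.mem_singleton.1 hl
      dsimp only; omega

/-- The formula for the choice of `min k n` inputs, made unsatisfiable if `k` exceeds `n`. -/
def chooseFormula (C : Circuit) (k : ℕ) : CNF where
  numVars := 2 * C.gates.length +
    (min k C.numInputs * C.width + min k C.numInputs * C.gates.length)
  clauses := C.evalClauses ++ (C.chooseClauses (min k C.numInputs) ++
    if C.numInputs < k then [[]] else [])
  var_lt c hc l hl := by
    rcases List.mem_append.1 hc with hc | hc
    · have := evalClauses_var_lt c hc l hl
      omega
    rcases List.mem_append.1 hc with hc | hc
    · rcases mem_chooseClauses.1 hc with ⟨i, hi, hc⟩ | ⟨j, hj, rfl⟩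
      · exact nameClauses_var_lt (C.mem_inputs.1 hi).1 c hc l hl
      · obtain ⟨i, hi, rfl⟩ := mem_someNamed.1 hl
        exact notNamed_lt hj (C.mem_inputs.1 hi).1
    · split_ifs at hc
      · obtain rfl := List.mem_singleton.1 hc
        exact absurd hl List.not_mem_nil
      · exact absurd hc List.not_mem_nil

theorem mem_chooseVars {k w : ℕ} : w ∈ C.chooseVars k ↔
    ∃ t < k * C.width, 2 * C.gates.length + t = w := by
  simp [chooseVars]

theorem chooseVars_length (k : ℕ) : (C.chooseVars k).length = k * C.width := by
  simp [chooseVars]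

theorem nameNe_mem_chooseVars {k j r : ℕ} (hj : j < k) :
    ∀ l ∈ nameNe C.gates.length C.width j r, l.1 ∈ C.chooseVars k := by
  intro l hl
  obtain ⟨t, ht, rfl⟩ := mem_nameNe.1 hl
  exact mem_chooseVars.2 ⟨_, mul_add_lt hj ht, rfl⟩

/-- All bits of the names lie in the backdoor. What remains of a choice clause has at most one
positive literal: the truth or falsity of an input, or one `notNamed` variable. -/
theorem chooseFormula_isBackdoor (k : ℕ) :
    (C.chooseFormula k).IsStrongHornBackdoor (C.chooseVars (min k C.numInputs)) := by
  refine CNF.isStrongHornBackdoor (List.nodup_range.map fun a b h => Nat.add_left_cancel h)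
    (fun w hw => ?_) fun c hc x y hx hy hxB hyB => ?_
  · obtain ⟨t, ht, rfl⟩ := mem_chooseVars.1 hw
    change _ < 2 * _ + (_ + _)
    omega
  rcases List.mem_append.1 hc with hc | hc
  · exact evalClauses_horn c hc x y hx hy
  rcases List.mem_append.1 hc with hc | hc
  · rcases mem_chooseClauses.1 hc with ⟨i, hi, hc⟩ | ⟨j, hj, rfl⟩
    · have key : ∀ {j : ℕ}, j < min k C.numInputs → ∀ {w : ℕ}, w ∉ C.chooseVars (min k C.numInputs) →
          (w, true) ∉ nameNe C.gates.length C.width j (C.rank i) := fun hj w hw h =>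
        hw (nameNe_mem_chooseVars hj _ h)
      rcases mem_nameClauses.1 hc with ⟨j, hj, rfl | ⟨t, ht, rfl⟩ | ⟨j', hj', rfl⟩⟩ | rfl
      · rw [List.mem_append, or_iff_right (key hj hxB)] at hx
        rw [List.mem_append, or_iff_right (key hj hyB)] at hy
        simp at hx hy
        omega
      · have hv : 2 * C.gates.length + (j * C.width + t) ∈ C.chooseVars (min k C.numInputs) :=
          mem_chooseVars.2 ⟨_, mul_add_lt hj ht, rfl⟩
        simp only [List.mem_cons, Prod.mk.injEq, List.not_mem_nil, or_false] at hx hy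
        rcases hx with ⟨rfl, -⟩ | ⟨rfl, -⟩
        · exact absurd hv hxB
        · rcases hy with ⟨rfl, -⟩ | ⟨rfl, -⟩
          · exact absurd hv hyB
          · rfl
      · rcases List.mem_append.1 hx with h | h
        · exact absurd h (key hj hxB)
        · exact absurd h (key (hj'.trans hj) hxB)
      · simp at hx hy
        omega
    · obtain ⟨i, hi, h⟩ := mem_someNamed.1 hx
      simp at h
  · split_ifs at hc
    · obtain rfl := List.mem_singleton.1 hc
      exact absurd hx List.not_mem_nil
    · exact absurd hc List.not_mem_nil

/-- Every name denotes exactly one input, since some input is named and ranks are determined by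
their bits. Distinct names denote distinct inputs, so setting the named inputs to True gives weight
exactly `k`. -/
theorem exists_of_chooseClauses {τ : ℕ → Bool} {k : ℕ}
    (hE : ∀ c ∈ C.evalClauses, ∃ l ∈ c, τ l.1 = l.2)
    (hτ : ∀ c ∈ C.chooseClauses k, ∃ l ∈ c, τ l.1 = l.2) :
    ∃ x, C.Accepts x ∧ C.weight x = k := by
  set M := C.gates.length with hM
  let named : ℕ → ℕ → Prop := fun j i =>
    ∀ t < C.width, τ (2 * M + (j * C.width + t)) = (C.rank i).testBit t
  have hname : ∀ i ∈ C.inputs, ∀ c ∈ nameClauses M C.width k i (C.rank i), ∃ l ∈ c, τ l.1 = l.2 :=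
    fun i hi c hc => hτ c (mem_chooseClauses.2 (.inl ⟨i, hi, hc⟩))
  have hne : ∀ {j i : ℕ}, named j i →
      ¬ ∃ l ∈ nameNe M C.width j (C.rank i), τ l.1 = l.2 := by
    rintro j i h ⟨l, hl, hl'⟩
    obtain ⟨t, ht, rfl⟩ := mem_nameNe.1 hl
    rw [h t ht] at hl'
    simp at hl'
  -- If `notNamed` is False, the two-literal clauses force all bits of the name to agree with the
  -- rank.
  have hnot : ∀ {j i : ℕ}, j < k → i ∈ C.inputs → τ (notNamed M C.width k j i) = false →
      named j i := fun {j i} hj hi h t ht => by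
    obtain ⟨l, hl, hl'⟩ := hname i hi _ (mem_nameClauses.2 (.inl ⟨j, hj, .inr (.inl ⟨t, ht, rfl⟩)⟩))
    simp only [List.mem_cons, List.not_mem_nil, or_false] at hl
    rcases hl with rfl | rfl
    · exact hl'
    · rw [h] at hl'; simp at hl'
  have hex : ∀ j : Fin k, ∃ i ∈ C.inputs, named j i := fun j => by
    obtain ⟨l, hl, hl'⟩ := hτ _ (mem_chooseClauses.2 (.inr ⟨j, j.2, rfl⟩))
    obtain ⟨i, hi, rfl⟩ := mem_someNamed.1 hl
    exact ⟨i, hi, hnot j.2 hi hl'⟩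
  choose e he hen using hex
  have huniq : ∀ (j : Fin k) (i : ℕ), i ∈ C.inputs → named j i → e j = i := fun j i hi h =>
    C.eq_of_testBit (he j) hi fun t ht => by rw [← hen j t ht, h t ht]
  have hlt : ∀ {a b : Fin k}, a < b → e a ≠ e b := by
    intro a b hab heq
    obtain ⟨l, hl, hl'⟩ := hname (e b) (he b) _
      (mem_nameClauses.2 (.inl ⟨b, b.2, .inr (.inr ⟨a, hab, rfl⟩)⟩))
    rcases List.mem_append.1 hl with hl | hl
    · exact hne (hen b) ⟨l, hl, hl'⟩
    · exact hne (heq ▸ hen a) ⟨l, hl, hl'⟩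
  have hinj : e.Injective := fun a b hab => by
    rcases lt_trichotomy a b with h | h | h
    · exact absurd hab (hlt h)
    · exact h
    · exact absurd hab.symm (hlt h)
  classical
  refine ⟨fun i => decide (∃ j, e j = i), accepts_of_evalClauses hE fun i hi => ?_, ?_⟩
  · split_ifs with h
    · obtain ⟨j, rfl⟩ := of_decide_eq_true h
      obtain ⟨l, hl, hl'⟩ := hname _ hi _ (mem_nameClauses.2 (.inl ⟨j, j.2, .inl rfl⟩))
      rcases List.mem_append.1 hl with hl | hl
      · exact absurd ⟨l, hl, hl'⟩ (hne (hen j))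
      · obtain rfl := List.mem_singleton.1 hl
        exact hl'
    · rw [decide_eq_true_eq] at h
      obtain ⟨l, hl, hl'⟩ := hname _ hi _ (mem_nameClauses.2 (.inr rfl))
      rcases List.mem_append.1 hl with hl | hl
      · obtain ⟨j, hj, rfl⟩ := List.mem_map.1 hl
        rw [List.mem_range] at hj
        exact absurd ⟨⟨j, hj⟩, huniq ⟨j, hj⟩ i hi (hnot hj hi hl')⟩ h
      · obtain rfl := List.mem_singleton.1 hl
        exact hl'
  · have : (C.inputs.filter fun i => decide (∃ j, e j = i) = true) = Finset.univ.image e := by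
      ext i
      simp only [decide_eq_true_eq, Finset.mem_filter, Finset.mem_image, Finset.mem_univ, true_and]
      exact ⟨fun h => h.2, fun ⟨j, h⟩ => ⟨h ▸ he j, j, h⟩⟩
    rw [weight, this, Finset.card_image_of_injective _ hinj, Finset.card_univ, Fintype.card_fin]

/-- Conversely, an enumeration `e` of the True inputs supplies the names, and the variables of the
vertices take their true values. -/
theorem exists_satisfies_chooseClauses {x v : ℕ → Bool} (hv : C.IsValuation x v)
    (hout : v C.out = true) : ∃ τ : ℕ → Bool,
      ∀ c ∈ C.evalClauses ++ C.chooseClauses (C.weight x), ∃ l ∈ c, τ l.1 = l.2 := by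
  set M := C.gates.length with hM
  set k := C.weight x with hk
  let S := C.inputs.filter fun i => x i = true
  let e' : Fin k ≃ S := (Finset.equivFinOfCardEq rfl).symm
  let e : ℕ → ℕ := fun j => if h : j < k then e' ⟨j, h⟩ else 0
  have heS : ∀ j < k, e j ∈ S := fun j hj => by
    simp only [e, dif_pos hj]
    exact (e' ⟨j, hj⟩).2
  have hei : ∀ j < k, e j ∈ C.inputs := fun j hj => (Finset.mem_filter.1 (heS j hj)).1
  have hsurj : ∀ i ∈ S, ∃ j < k, e j = i := fun i hi => by
    obtain ⟨j, hj⟩ := e'.surjective ⟨i, hi⟩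
    exact ⟨j, j.2, by simp [e, hj]⟩
  have hinj : ∀ a < k, ∀ b < k, e a = e b → a = b := fun a ha b hb h => by
    simp only [e, dif_pos ha, dif_pos hb] at h
    simpa using e'.injective (Subtype.ext h)
  have hvx : ∀ i ∈ C.inputs, v i = x i := fun i hi => by
    obtain ⟨h1, h2⟩ := C.mem_inputs.1 hi
    have := hv i _ (C.getElem?_gate h1)
    cases hg : C.gate i <;> simp_all [Gate.tag, Gate.Computes]
  -- Four consecutive ranges: vertices being true, vertices being false, the bits of the names, and
  -- the `notNamed` variables.
  let τ : ℕ → Bool := fun w => if w < M then v w else if w < 2 * M then !v (w - M)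
    else if w - 2 * M < k * C.width then
      (C.rank (e ((w - 2 * M) / C.width))).testBit ((w - 2 * M) % C.width)
    else decide (e ((w - 2 * M - k * C.width) / M) ≠ (w - 2 * M - k * C.width) % M)
  have hp : ∀ j < M, τ j = v j := fun j hj => by simp [τ, hj]
  have hq : ∀ j < M, τ (M + j) = !v j := fun j hj => by
    have h1 : ¬ M + j < M := by omega
    have h2 : M + j < 2 * M := by omega
    simp only [τ, h1, h2, if_true, if_false, Nat.add_sub_cancel_left]
  have hy : ∀ j < k, ∀ t < C.width,
      τ (2 * M + (j * C.width + t)) = (C.rank (e j)).testBit t := fun j hj t ht => by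
    have h1 : ¬ 2 * M + (j * C.width + t) < M := by omega
    have h2 : ¬ 2 * M + (j * C.width + t) < 2 * M := by omega
    have h3 : (j * C.width + t) / C.width = j := by
      rw [Nat.mul_comm, Nat.mul_add_div (by omega), Nat.div_eq_of_lt ht, Nat.add_zero]
    have h4 : (j * C.width + t) % C.width = t := by
      rw [Nat.mul_comm, Nat.mul_add_mod, Nat.mod_eq_of_lt ht]
    simp only [τ, h1, h2, if_true, if_false, Nat.add_sub_cancel_left, mul_add_lt hj ht, h3, h4]
  have hz : ∀ j < k, ∀ i < M, τ (notNamed M C.width k j i) = decide (e j ≠ i) := fun j hj i hi => by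
    have h1 : ¬ 2 * M + (k * C.width + (j * M + i)) < M := by omega
    have h2 : ¬ 2 * M + (k * C.width + (j * M + i)) < 2 * M := by omega
    have h3 : (j * M + i) / M = j := by
      rw [Nat.mul_comm, Nat.mul_add_div (by omega), Nat.div_eq_of_lt hi, Nat.add_zero]
    have h4 : (j * M + i) % M = i := by
      rw [Nat.mul_comm, Nat.mul_add_mod, Nat.mod_eq_of_lt hi]
    have h5 : ¬ k * C.width + (j * M + i) < k * C.width := by omega
    simp only [τ, notNamed, h1, h2, h5, if_false, Nat.add_sub_cancel_left, h3, h4]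
  have hne : ∀ j < k, ∀ i ∈ C.inputs, e j ≠ i →
      ∃ l ∈ nameNe M C.width j (C.rank i), τ l.1 = l.2 := fun j hj i hi h => by
    by_contra! hall
    refine h (C.eq_of_testBit (hei j hj) hi fun t ht => ?_)
    have := hall _ (mem_nameNe.2 ⟨t, ht, rfl⟩)
    rw [hy j hj t ht] at this
    simpa using this
  refine ⟨τ, fun c hc => ?_⟩
  rcases List.mem_append.1 hc with hc | hc
  · exact evalClauses_satisfied hv hout hp hq c hc
  rcases mem_chooseClauses.1 hc with ⟨i, hi, hc⟩ | ⟨j, hj, rfl⟩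
  · have hiM := (C.mem_inputs.1 hi).1
    rcases mem_nameClauses.1 hc with ⟨j, hj, rfl | ⟨t, ht, rfl⟩ | ⟨j', hj', rfl⟩⟩ | rfl
    · by_cases h : e j = i
      · refine ⟨(i, true), by simp, ?_⟩
        rw [hp i hiM, hvx i hi]
        have hiS : i ∈ S := h ▸ heS j hj
        exact (Finset.mem_filter.1 hiS).2
      · obtain ⟨l, hl, hl'⟩ := hne j hj i hi h
        exact ⟨l, List.mem_append_left _ hl, hl'⟩
    · by_cases h : e j = i
      · exact ⟨_, List.mem_cons_self, by rw [← hM, hy j hj t ht, h]⟩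
      · exact ⟨(notNamed M C.width k j i, true), by simp [← hM], by simp [hz j hj i hiM, h]⟩
    · by_cases h : e j = i
      · have h' : e j' ≠ i := fun h' => hj'.ne (hinj _ (hj'.trans hj) _ hj (h'.trans h.symm))
        obtain ⟨l, hl, hl'⟩ := hne j' (hj'.trans hj) i hi h'
        exact ⟨l, List.mem_append_right _ hl, hl'⟩
      · obtain ⟨l, hl, hl'⟩ := hne j hj i hi h
        exact ⟨l, List.mem_append_left _ hl, hl'⟩
    · by_cases h : x i = true
      · obtain ⟨j, hj, h⟩ := hsurj i (Finset.mem_filter.2 ⟨hi, h⟩)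
        exact ⟨(notNamed M C.width k j i, false), List.mem_append_left _
          (List.mem_map.2 ⟨j, List.mem_range.2 hj, rfl⟩), by simp [hz j hj i hiM, h]⟩
      · exact ⟨(M + i, true), by simp [← hM], by simp [hq i hiM, hvx i hi, h]⟩
  · exact ⟨_, mem_someNamed.2 ⟨e j, hei j hj, rfl⟩,
      by simp [← hM, hz j hj _ (C.mem_inputs.1 (hei j hj)).1]⟩

theorem weight_le (x : ℕ → Bool) : C.weight x ≤ C.numInputs := Finset.card_filter_le _ _

theorem chooseFormula_satisfiable (k : ℕ) :
    (C.chooseFormula k).Satisfiable ↔ ∃ x, C.Accepts x ∧ C.weight x = k := by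
  constructor
  · rintro ⟨τ, hτ⟩
    -- For `k > n` the formula contains the empty clause.
    have hk : ¬ C.numInputs < k := fun h => by
      obtain ⟨l, hl, -⟩ := hτ [] (List.mem_append_right _ (List.mem_append_right _ (by simp [h])))
      exact List.not_mem_nil hl
    have := exists_of_chooseClauses (fun c hc => hτ c (List.mem_append_left _ hc))
      (fun c hc => hτ c (List.mem_append_right _ (List.mem_append_left _ hc)))
    rwa [min_eq_left (Nat.le_of_not_lt hk)] at this
  · rintro ⟨x, ⟨v, hv, hout⟩, rfl⟩
    obtain ⟨τ, hτ⟩ := exists_satisfies_chooseClauses hv hout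
    refine ⟨τ, fun c hc => hτ c ?_⟩
    simpa [chooseFormula, weight_le, (weight_le x).not_gt] using hc

end Circuit

namespace RAM

variable {Γ Δ : Type} [Ctx Γ] [Ctx Δ]

/-! ### Lists of encoded objects -/

/-- A list of objects with the encoding `g` is computable in polynomial time. -/
structure CompB {α : Type} (g : α → List ℕ) (f : Γ → List α) : Prop where
  length : Comp fun γ => (f γ).length
  bdd : PolyBdd fun γ => ((f γ).flatMap g).length
  word : CompL fun γ => (f γ).flatMap g

namespace CompB

variable {α : Type} {g : α → List ℕ} {f h : Γ → List α}

theorem congr (hf : CompB g f) (hfh : ∀ γ, f γ = h γ) : CompB g h := by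
  obtain rfl : f = h := funext hfh
  exact hf

theorem nil : CompB g (fun _ : Γ => []) := ⟨.const 0, .const 0, CompL.nil⟩

theorem singleton {a : Γ → α} (ha : CompL fun γ => g (a γ))
    (pa : PolyBdd fun γ => (g (a γ)).length) : CompB g (fun γ => [a γ]) :=
  ⟨.const 1, pa.mono fun γ => by simp, ha.congr fun γ => by simp⟩

theorem append (hf : CompB g f) (hh : CompB g h) : CompB g (fun γ => f γ ++ h γ) :=
  ⟨(hf.length.add hh.length).congr fun γ => by rw [List.length_append],
    (hf.bdd.add hh.bdd).mono fun γ => by rw [List.flatMap_append, List.length_append],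
    (hf.word.append hh.word).congr fun γ => by rw [List.flatMap_append]⟩

theorem ite {p : Γ → Prop} [DecidablePred p] (hp : CompP p) (hf : CompB g f) (hh : CompB g h) :
    CompB g (fun γ => if p γ then f γ else h γ) :=
  ⟨(Comp.ite hp hf.length hh.length).congr fun γ => by split_ifs <;> rfl,
    (hf.bdd.add hh.bdd).mono fun γ => by split_ifs <;> omega,
    (CompL.ite hp hf.word hh.word).congr fun γ => by split_ifs <;> rfl⟩

theorem flatMap {n : Γ → ℕ} {f : Γ → ℕ → List α} (hn : Comp n) (pn : PolyBdd n)
    (hf : CompB g (fun p : Γ × ℕ => f p.1 p.2)) :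
    CompB g (fun γ => (List.range (n γ)).flatMap (f γ)) := by
  refine ⟨(Comp.sum hn pn (f := fun γ i => (f γ i).length) hf.length).congr fun γ => ?_, ?_,
    (CompL.flatMap hn pn (f := fun γ i => (f γ i).flatMap g) hf.word).congr fun γ => by
      rw [List.flatMap_assoc]⟩
  · induction n γ with
    | zero => simp
    | succ n ih => rw [Finset.sum_range_succ, ih, List.range_succ]; simp
  · obtain ⟨c, e, hc⟩ := hf.bdd
    refine (pn.mul (⟨c, e, fun γ => le_rfl⟩ :
      PolyBdd fun γ : Γ => c * (Ctx.size γ + 1) ^ e)).mono fun γ => ?_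
    induction n γ with
    | zero => simp
    | succ n ih =>
      rw [List.range_succ, List.flatMap_append, List.flatMap_append, List.length_append,
        Nat.add_one_mul]
      refine Nat.add_le_add ih ?_
      have h : _ ≤ c * (Ctx.size γ + 1) ^ e := hc (γ, n)
      simpa using h

theorem map {n : Γ → ℕ} {f : Γ → ℕ → α} (hn : Comp n) (pn : PolyBdd n)
    (hf : CompL fun p : Γ × ℕ => g (f p.1 p.2))
    (pf : PolyBdd fun p : Γ × ℕ => (g (f p.1 p.2)).length) :
    CompB g (fun γ => (List.range (n γ)).map (f γ)) :=
  (flatMap hn pn (f := fun γ i => [f γ i]) (singleton hf pf)).congr fun _ =>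
    List.map_eq_flatMap.symm

end CompB

def litWord (l : Literal) : List ℕ := [l.1, l.2.toNat]

/-- A clause is computable in polynomial time. -/
abbrev CompClause (c : Γ → Clause) : Prop := CompB litWord c

/-- A list of clauses is computable in polynomial time. -/
abbrev CompCNF (f : Γ → List Clause) : Prop := CompB HornInst.clauseWord f

/-- A literal is computable in polynomial time. -/
structure CompLit (l : Γ → Literal) : Prop where
  var : Comp fun γ => (l γ).1
  sign : CompP fun γ => (l γ).2 = true

theorem CompLit.word {l : Γ → Literal} (hl : CompLit l) : CompL fun γ => litWord (l γ) :=
  .cons hl.var (.singleton ((Comp.ite hl.sign (.const 1) (.const 0)).congr fun γ => by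
    cases (l γ).2 <;> rfl))

theorem CompP.const (q : Prop) : CompP (fun _ : Γ => q) := Comp.const _

theorem CompLit.pos {v : Γ → ℕ} (hv : Comp v) : CompLit (fun γ => (v γ, true)) :=
  ⟨hv, .const (true = true)⟩

theorem CompLit.neg {v : Γ → ℕ} (hv : Comp v) : CompLit (fun γ => (v γ, false)) :=
  ⟨hv, .const (false = true)⟩

theorem CompB.cons_lit {l : Γ → Literal} {c : Γ → Clause} (hl : CompLit l) (hc : CompClause c) :
    CompClause (fun γ => l γ :: c γ) :=
  append (singleton hl.word (.const 2)) hc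

theorem CompB.map_lit {n : Γ → ℕ} {f : Γ → ℕ → Literal} (hn : Comp n) (pn : PolyBdd n)
    (hf : CompLit fun p : Γ × ℕ => f p.1 p.2) :
    CompClause (fun γ => (List.range (n γ)).map (f γ)) :=
  map hn pn hf.word (.const 2)

theorem CompB.clauseWord {c : Γ → Clause} (hc : CompClause c) :
    CompL fun γ => HornInst.clauseWord (c γ) := .cons hc.length hc.word

theorem CompB.bdd_clauseWord {c : Γ → Clause} (hc : CompClause c) :
    PolyBdd fun γ => (HornInst.clauseWord (c γ)).length :=
  (hc.bdd.add (.const 1)).mono fun _ => le_rfl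

theorem CompB.cons_clause {c : Γ → Clause} {f : Γ → List Clause} (hc : CompClause c)
    (hf : CompCNF f) : CompCNF (fun γ => c γ :: f γ) :=
  append (singleton hc.clauseWord hc.bdd_clauseWord) hf

theorem CompB.map_clause {n : Γ → ℕ} {f : Γ → ℕ → Clause} (hn : Comp n) (pn : PolyBdd n)
    (hf : CompClause fun p : Γ × ℕ => f p.1 p.2) :
    CompCNF (fun γ => (List.range (n γ)).map (f γ)) :=
  map hn pn hf.clauseWord hf.bdd_clauseWord

theorem length_flatMap_clauseWord (cs : List Clause) :
    cs.length + (cs.map List.length).sum ≤ (cs.flatMap HornInst.clauseWord).length := by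
  induction cs with
  | nil => simp
  | cons c cs ih =>
    rw [List.flatMap_cons, List.length_append, HornInst.clauseWord_length, List.length_cons,
      List.map_cons, List.sum_cons]
    omega

/-- The clause part of the size is at most the length of its encoding, which a `CompCNF` already
bounds. -/
theorem bdd_cnf_size {φ : Γ → CNF} (pv : PolyBdd fun γ => (φ γ).numVars)
    (hφ : CompCNF fun γ => (φ γ).clauses) : PolyBdd fun γ => (φ γ).size :=
  (pv.add hφ.bdd).mono fun γ => by
    have := length_flatMap_clauseWord (φ γ).clauses
    unfold CNF.size
    omega

theorem compL_encodeWith {φ : Γ → CNF} {B : Γ → List ℕ} (hv : Comp fun γ => (φ γ).numVars)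
    (hφ : CompCNF fun γ => (φ γ).clauses) (hB : CompL B) (hb : Comp fun γ => (B γ).length) :
    CompL fun γ => (φ γ).encodeWith (B γ) :=
  .cons hb (hB.append (.cons hv (.cons hφ.length hφ.word)))

/-! ### Circuits in the context -/

/-- The word of the context ends with the encoding of the circuit `β δ`. -/
structure Reads (o : ℕ) (β : Δ → Circuit) : Prop where
  word : ∀ δ t, (Ctx.word δ).getD (o + t) 0 = (β δ).encode.getD t 0
  bdd : PolyBdd fun δ => (β δ).size

namespace Reads

variable {o : ℕ} {β : Δ → Circuit} {i : Δ → ℕ}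

theorem fst (hβ : Reads o β) : Reads o (fun p : Δ × ℕ => β p.1) :=
  ⟨fun p => hβ.word p.1, hβ.bdd.fst⟩

theorem get (hβ : Reads o β) {t : Δ → ℕ} (ht : Comp t) :
    Comp (fun δ => (β δ).encode.getD (t δ) 0) :=
  ((Comp.const o).add ht).get.congr fun δ => hβ.word δ _

theorem bdd_length (hβ : Reads o β) : PolyBdd fun δ => (β δ).gates.length :=
  (hβ.bdd.add (.const 1)).mono fun δ => (β δ).length_le_size

theorem bdd_numInputs (hβ : Reads o β) : PolyBdd fun δ => (β δ).numInputs :=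
  hβ.bdd_length.mono fun δ => (β δ).numInputs_le

theorem bdd_preds (hβ : Reads o β) (i : Δ → ℕ) :
    PolyBdd fun δ => ((β δ).gate (i δ)).preds.length :=
  hβ.bdd.mono fun δ => (β δ).preds_length_le _

theorem comp_out (hβ : Reads o β) : Comp fun δ => (β δ).out := hβ.get (.const 0)

theorem comp_length (hβ : Reads o β) : Comp fun δ => (β δ).gates.length := hβ.get (.const 1)

theorem gate_encode_length (g : Gate) : g.encode.length = 2 + g.preds.length := by
  rw [Gate.encode, List.length_cons, List.length_cons, Nat.add_comm 2]

theorem encode_getD (C : Circuit) (t : ℕ) :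
    C.encode.getD (2 + t) 0 = (C.gates.flatMap Gate.encode).getD t 0 := by
  rw [Nat.add_comm]; rfl

theorem comp_offset (hβ : Reads o β) (hi : Comp i) : Comp fun δ =>
    offset (β δ).gates Gate.encode (min (i δ) (β δ).gates.length) := by
  have h : Comp (fun p : Δ × ℕ => (β p.1).encode.getD (2 + (p.2 + 1)) 0) :=
    hβ.fst.get ((Comp.const 2).add (Comp.snd.add (.const 1)))
  refine Comp.offset (blk := fun δ a => 2 + (β δ).encode.getD (2 + (a + 1)) 0) (fun δ t ht => ?_)
    ((Comp.const 2).add h) hβ.comp_length hβ.bdd_length hi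
  rw [encode_getD, getD_offset ht (by rw [gate_encode_length]; omega), gate_encode_length]
  rfl

/-- Letter `j` of the word of vertex `i`. -/
theorem comp_gateWord (hβ : Reads o β) (hi : Comp i) {j : Δ → ℕ} (hj : Comp j) :
    Comp fun δ => if i δ < (β δ).gates.length then (β δ).encode.getD
      (2 + (offset (β δ).gates Gate.encode (min (i δ) (β δ).gates.length) + j δ)) 0 else 0 :=
  .ite (.lt hi hβ.comp_length)
    (hβ.get ((Comp.const 2).add ((hβ.comp_offset hi).add hj))) (.const 0)

theorem comp_gateWord_of_lt (hβ : Reads o β) (hi : Comp i) {j : ℕ} (hj : j < 2) :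
    Comp fun δ => ((β δ).gate (i δ)).encode.getD j 0 :=
  (hβ.comp_gateWord hi (.const j)).congr fun δ => by
    split_ifs with h
    · rw [encode_getD, min_eq_left h.le, getD_offset h (by rw [gate_encode_length]; omega),
        Circuit.gate, List.getD_eq_getElem _ _ h]
    · rw [Circuit.gate, List.getD_eq_default _ _ (Nat.le_of_not_lt h)]
      interval_cases j <;> rfl

theorem comp_tag (hβ : Reads o β) (hi : Comp i) : Comp fun δ => ((β δ).gate (i δ)).tag :=
  hβ.comp_gateWord_of_lt hi zero_lt_two

theorem comp_preds_length (hβ : Reads o β) (hi : Comp i) :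
    Comp fun δ => ((β δ).gate (i δ)).preds.length :=
  hβ.comp_gateWord_of_lt hi one_lt_two

theorem comp_pred (hβ : Reads o β) (hi : Comp i) {j : Δ → ℕ} (hj : Comp j) :
    Comp fun δ => ((β δ).gate (i δ)).preds.getD (j δ) 0 :=
  (Comp.ite (CompP.lt hj (hβ.comp_preds_length hi))
    (hβ.comp_gateWord hi (hj.add (.const 2))) (.const 0)).congr fun δ => by
    split_ifs with h1 h2
    · rw [Circuit.gate, List.getD_eq_getElem _ _ h2] at h1
      rw [encode_getD, min_eq_left h2.le, getD_offset h2 (by rw [gate_encode_length]; omega),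
        Circuit.gate, List.getD_eq_getElem _ _ h2]
      rfl
    · rw [Circuit.gate, List.getD_eq_default _ _ (Nat.le_of_not_lt h2)] at h1
      exact absurd h1 (Nat.not_lt_zero _)
    · rw [List.getD_eq_default _ _ (Nat.le_of_not_lt h1)]

theorem compP_input (hβ : Reads o β) (hi : Comp i) :
    CompP fun δ => ((β δ).gate (i δ)).tag = 0 := .eq_zero (hβ.comp_tag hi)

theorem compCNF_gateClauses (hβ : Reads o β) (hi : Comp i) :
    CompCNF fun δ => Circuit.gateClauses (β δ).gates.length (i δ) ((β δ).gate (i δ)) := by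
  have hM := hβ.comp_length
  have hd := hβ.comp_preds_length hi
  have pd := hβ.bdd_preds i
  have hu := hβ.fst.comp_pred hi.fst .snd
  have hM' := hM.fst
  have hi' : Comp fun p : Δ × ℕ => i p.1 := hi.fst
  have h1 : CompCNF fun δ => ((i δ, true) :: ((β δ).gate (i δ)).preds.map fun u => (u, false)) ::
      ((β δ).gate (i δ)).preds.map fun u =>
        [((β δ).gates.length + i δ, true), ((β δ).gates.length + u, false)] :=
    (CompB.cons_clause (.cons_lit (.pos hi) (.map_lit hd pd
      (f := fun δ j => (((β δ).gate (i δ)).preds.getD j 0, false)) (.neg hu)))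
      (.map_clause hd pd (f := fun δ j => [((β δ).gates.length + i δ, true),
        ((β δ).gates.length + ((β δ).gate (i δ)).preds.getD j 0, false)])
        (.cons_lit (.pos (hM'.add hi')) (.cons_lit (.neg (hM'.add hu)) .nil)))).congr fun δ => by
      rw [map_eq_range _ 0 (fun u => (u, false)), map_eq_range _ 0 (fun u => [_, (_ + u, false)])]
  have h2 : CompCNF fun δ => (((β δ).gates.length + i δ, true) ::
      ((β δ).gate (i δ)).preds.map fun u => ((β δ).gates.length + u, false)) ::
      ((β δ).gate (i δ)).preds.map fun u => [(i δ, true), (u, false)] :=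
    (CompB.cons_clause (.cons_lit (.pos (hM.add hi)) (.map_lit hd pd
      (f := fun δ j => ((β δ).gates.length + ((β δ).gate (i δ)).preds.getD j 0, false))
      (.neg (hM'.add hu))))
      (.map_clause hd pd (f := fun δ j => [(i δ, true), (((β δ).gate (i δ)).preds.getD j 0, false)])
        (.cons_lit (.pos hi') (.cons_lit (.neg hu) .nil)))).congr fun δ => by
      rw [map_eq_range _ 0 (fun u => (_ + u, false)), map_eq_range _ 0 (fun u => [_, (u, false)])]
  have h3 : CompCNF fun δ => ((β δ).gate (i δ)).preds.flatMap fun u =>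
      [[(i δ, true), ((β δ).gates.length + u, false)],
        [((β δ).gates.length + i δ, true), (u, false)]] :=
    (CompB.flatMap hd pd (f := fun δ j =>
      [[(i δ, true), ((β δ).gates.length + ((β δ).gate (i δ)).preds.getD j 0, false)],
        [((β δ).gates.length + i δ, true), (((β δ).gate (i δ)).preds.getD j 0, false)]])
      (.cons_clause (.cons_lit (.pos hi') (.cons_lit (.neg (hM'.add hu)) .nil))
        (.cons_clause (.cons_lit (.pos (hM'.add hi')) (.cons_lit (.neg hu) .nil)) .nil))).congr
      fun δ => (flatMap_eq_range ((β δ).gate (i δ)).preds 0 fun u =>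
        [[(i δ, true), ((β δ).gates.length + u, false)],
          [((β δ).gates.length + i δ, true), (u, false)]]).symm
  exact .ite (.eq (hβ.comp_tag hi) (.const 1)) h1 (.ite (.eq (hβ.comp_tag hi) (.const 2)) h2 h3)

theorem compCNF_evalClauses (hβ : Reads o β) : CompCNF fun δ => (β δ).evalClauses :=
  (CompB.flatMap hβ.comp_length hβ.bdd_length (f := fun δ i =>
    Circuit.gateClauses (β δ).gates.length i ((β δ).gate i)) (hβ.fst.compCNF_gateClauses .snd)).append
    (.cons_clause (.cons_lit (.neg (hβ.comp_length.add hβ.comp_out)) .nil) .nil)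

theorem comp_two_mul {f : Δ → ℕ} (hf : Comp f) : Comp fun δ => 2 * f δ :=
  (hf.add hf).congr fun _ => (Nat.two_mul _).symm

theorem compCNF_guessClauses (hβ : Reads o β) : CompCNF fun δ => (β δ).guessClauses := by
  have hM := hβ.fst.comp_length
  have hx := (comp_two_mul hM).add .snd
  exact .flatMap hβ.comp_length hβ.bdd_length
    (f := fun δ i => if ((β δ).gate i).tag = 0 then
      [[(2 * (β δ).gates.length + i, false), (i, true)],
        [(2 * (β δ).gates.length + i, true), ((β δ).gates.length + i, true)]] else [])
    (.ite (hβ.fst.compP_input .snd)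
      (.cons_clause (.cons_lit (.neg hx) (.cons_lit (.pos .snd) .nil))
        (.cons_clause (.cons_lit (.pos hx) (.cons_lit (.pos (hM.add .snd)) .nil)) .nil)) .nil)

theorem comp_rank (hβ : Reads o β) (hi : Comp i) (pi : PolyBdd i) :
    Comp fun δ => (β δ).rank (i δ) :=
  .sum hi pi (f := fun δ j => if ((β δ).gate j).tag = 0 then 1 else 0)
    (.ite (hβ.fst.compP_input .snd) (.const 1) (.const 0))

theorem comp_numInputs (hβ : Reads o β) : Comp fun δ => (β δ).numInputs :=
  (hβ.comp_rank hβ.comp_length hβ.bdd_length).congr fun δ => (β δ).rank_length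

theorem width_le (C : Circuit) : C.width ≤ C.numInputs := by
  by_contra! h
  exact absurd (Nat.pow_lt_of_lt_clog h) (Nat.lt_two_pow_self).not_gt

theorem bdd_width (hβ : Reads o β) : PolyBdd fun δ => (β δ).width :=
  hβ.bdd_numInputs.mono fun _ => width_le _

/-- The ceiling logarithm of `n` is the number of `t` with `2 ^ t < n`, and all such `t` are below
`n`. The exponent is clamped to keep the computation bounded for every value of the loop variable.
-/
theorem comp_width (hβ : Reads o β) : Comp fun δ => (β δ).width := by
  have hp : Comp fun p : Δ × ℕ => 2 ^ (min p.2 (β p.1).numInputs) :=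
    (Comp.snd.min hβ.fst.comp_numInputs).two_pow
      (hβ.fst.bdd_numInputs.mono fun p => min_le_right _ _)
  refine (Comp.sum hβ.comp_numInputs hβ.bdd_numInputs (f := fun δ t =>
    if 2 ^ (min t (β δ).numInputs) < (β δ).numInputs then 1 else 0)
    (.ite (.lt hp hβ.fst.comp_numInputs) (.const 1) (.const 0))).congr fun δ => ?_
  rw [← Finset.card_filter]
  have : (Finset.range (β δ).numInputs).filter (fun t =>
      2 ^ (min t (β δ).numInputs) < (β δ).numInputs) = Finset.range (β δ).width := by
    ext t
    rw [Finset.mem_filter, Finset.mem_range, Finset.mem_range, Circuit.width,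
      Nat.lt_clog_iff_pow_lt one_lt_two]
    constructor
    · rintro ⟨h1, h2⟩
      rwa [min_eq_left h1.le] at h2
    · intro h
      have h1 := (Nat.lt_two_pow_self (n := t)).trans h
      exact ⟨h1, by rwa [min_eq_left h1.le]⟩
  rw [this, Finset.card_range]

section Choose

variable {k : Δ → ℕ}

theorem comp_nameBit (hβ : Reads o β) {j t : Δ → ℕ} (hj : Comp j) (ht : Comp t) :
    Comp fun δ => 2 * (β δ).gates.length + (j δ * (β δ).width + t δ) :=
  (comp_two_mul hβ.comp_length).add ((hj.mul' hβ.comp_width hβ.bdd_width).add ht)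

/-- Bit `t` of `r`, for a `t` below the width. -/
theorem compP_testBit (hβ : Reads o β) {r t : Δ → ℕ} (hr : Comp r) (ht : Comp t) :
    CompP fun δ => (r δ).testBit (min (t δ) (β δ).width) = true :=
  hr.testBit (ht.min hβ.comp_width) (hβ.bdd_width.mono fun _ => min_le_right _ _)

theorem compClause_nameNe (hβ : Reads o β) {j r : Δ → ℕ} (hj : Comp j) (hr : Comp r) :
    CompClause fun δ => Circuit.nameNe (β δ).gates.length (β δ).width (j δ) (r δ) :=
  (CompB.map_lit hβ.comp_width hβ.bdd_width
    (f := fun δ t => (2 * (β δ).gates.length + (j δ * (β δ).width + t),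
      !(r δ).testBit (min t (β δ).width)))
    ⟨hβ.fst.comp_nameBit hj.fst .snd, (hβ.fst.compP_testBit hr.fst .snd).not.congr fun p => by
      simp⟩).congr fun δ => List.map_congr_left fun t ht => by
        rw [min_eq_left (List.mem_range.1 ht).le]

theorem comp_notNamed (hβ : Reads o β) (hk : Comp k) {j : Δ → ℕ} (hj : Comp j) (hi : Comp i) :
    Comp fun δ => Circuit.notNamed (β δ).gates.length (β δ).width (k δ) (j δ) (i δ) :=
  (comp_two_mul hβ.comp_length).add ((hk.mul' hβ.comp_width hβ.bdd_width).add
    ((hj.mul' hβ.comp_length hβ.bdd_length).add hi))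

/-- Bit positions and the inner index are clamped by `min`, because their loops must be bounded
uniformly in the outer loop variable; on the actual ranges the clamps vanish. -/
theorem compCNF_nameClauses (hβ : Reads o β) (hk : Comp k) (pk : PolyBdd k) (hi : Comp i)
    {r : Δ → ℕ} (hr : Comp r) : CompCNF fun δ =>
      Circuit.nameClauses (β δ).gates.length (β δ).width (k δ) (i δ) (r δ) := by
  have hi' : Comp fun p : Δ × ℕ => i p.1 := hi.fst
  have hr' : Comp fun p : Δ × ℕ => r p.1 := hr.fst
  have hz := hβ.fst.comp_notNamed hk.fst .snd hi'
  have hl : CompLit fun q : (Δ × ℕ) × ℕ =>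
      (2 * (β q.1.1).gates.length + (q.1.2 * (β q.1.1).width + q.2),
        (r q.1.1).testBit (min q.2 (β q.1.1).width)) :=
    ⟨hβ.fst.fst.comp_nameBit Comp.snd.fst .snd, hβ.fst.fst.compP_testBit hr'.fst .snd⟩
  have h0 := CompB.map_clause hβ.fst.comp_width hβ.fst.bdd_width (f := fun p t =>
      [(2 * (β p.1).gates.length + (p.2 * (β p.1).width + t),
        (r p.1).testBit (min t (β p.1).width)),
      (Circuit.notNamed (β p.1).gates.length (β p.1).width (k p.1) p.2 (i p.1), true)])
      (.cons_lit hl (.cons_lit (.pos hz.fst) .nil))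
  have h1 : CompCNF fun p : Δ × ℕ => (List.range (β p.1).width).map fun t =>
      [(2 * (β p.1).gates.length + (p.2 * (β p.1).width + t), (r p.1).testBit t),
        (Circuit.notNamed (β p.1).gates.length (β p.1).width (k p.1) p.2 (i p.1), true)] :=
    h0.congr fun p => List.map_congr_left fun t ht => by rw [min_eq_left (List.mem_range.1 ht).le]
  have h2 : CompCNF fun p : Δ × ℕ => (List.range (min p.2 (k p.1))).map fun j' =>
      Circuit.nameNe (β p.1).gates.length (β p.1).width p.2 (r p.1) ++
        Circuit.nameNe (β p.1).gates.length (β p.1).width j' (r p.1) :=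
    .map_clause (Comp.snd.min hk.fst) (pk.fst.mono fun p => min_le_right _ _)
      (f := fun p j' => Circuit.nameNe (β p.1).gates.length (β p.1).width p.2 (r p.1) ++
        Circuit.nameNe (β p.1).gates.length (β p.1).width j' (r p.1))
      ((hβ.fst.fst.compClause_nameNe Comp.snd.fst hr'.fst).append
        (hβ.fst.fst.compClause_nameNe .snd hr'.fst))
  have h3 : CompClause fun p : Δ × ℕ =>
      Circuit.nameNe (β p.1).gates.length (β p.1).width p.2 (r p.1) ++ [(i p.1, true)] :=
    (hβ.fst.compClause_nameNe .snd hr').append (.cons_lit (.pos hi') .nil)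
  have h4 := CompB.cons_clause h3 (h1.append h2)
  have h5 := CompB.flatMap hk pk (f := fun δ j =>
    (Circuit.nameNe (β δ).gates.length (β δ).width j (r δ) ++ [(i δ, true)]) ::
    ((List.range (β δ).width).map (fun t =>
      [(2 * (β δ).gates.length + (j * (β δ).width + t), (r δ).testBit t),
        (Circuit.notNamed (β δ).gates.length (β δ).width (k δ) j (i δ), true)]) ++
    (List.range (min j (k δ))).map fun j' =>
      Circuit.nameNe (β δ).gates.length (β δ).width j (r δ) ++
        Circuit.nameNe (β δ).gates.length (β δ).width j' (r δ))) h4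
  have h6 : CompClause fun δ => ((List.range (k δ)).map fun j =>
      (Circuit.notNamed (β δ).gates.length (β δ).width (k δ) j (i δ), false)) ++
      [((β δ).gates.length + i δ, true)] :=
    .append (.map_lit hk pk (f := fun δ j =>
      (Circuit.notNamed (β δ).gates.length (β δ).width (k δ) j (i δ), false)) (.neg hz))
      (.cons_lit (.pos (hβ.comp_length.add hi)) .nil)
  refine (h5.append (.cons_clause h6 .nil)).congr fun δ => ?_
  rw [Circuit.nameClauses]
  congr 1
  refine List.flatMap_congr fun j hj => ?_
  rw [min_eq_left (List.mem_range.1 hj).le]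

theorem compClause_someNamed (hβ : Reads o β) (hk : Comp k) {j : Δ → ℕ} (hj : Comp j) :
    CompClause fun δ => (β δ).someNamed (k δ) (j δ) :=
  .flatMap hβ.comp_length hβ.bdd_length (f := fun δ i => if ((β δ).gate i).tag = 0 then
      [(Circuit.notNamed (β δ).gates.length (β δ).width (k δ) (j δ) i, false)] else [])
    (.ite (hβ.fst.compP_input .snd)
      (.cons_lit (.neg (hβ.fst.comp_notNamed hk.fst hj.fst .snd)) .nil) .nil)

theorem compCNF_chooseClauses (hβ : Reads o β) (hk : Comp k) (pk : PolyBdd k) :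
    CompCNF fun δ => (β δ).chooseClauses (k δ) := by
  refine .append ((CompB.flatMap hβ.comp_length hβ.bdd_length
    (f := fun δ i => if ((β δ).gate i).tag = 0 then
      Circuit.nameClauses (β δ).gates.length (β δ).width (k δ) i
        ((β δ).rank (min i (β δ).gates.length)) else [])
    (.ite (hβ.fst.compP_input .snd) (hβ.fst.compCNF_nameClauses hk.fst pk.fst .snd
      (hβ.fst.comp_rank (Comp.snd.min hβ.fst.comp_length)
        (hβ.fst.bdd_length.mono fun p => min_le_right _ _))) .nil)).congr
    fun δ => List.flatMap_congr fun i hi => ?_)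
    (.map_clause hk pk (f := fun δ j => (β δ).someNamed (k δ) j)
      (hβ.fst.compClause_someNamed hk.fst .snd))
  rw [min_eq_left (List.mem_range.1 hi).le]

end Choose

end Reads

end RAM

/-! ### The reductions from circuits to formulas -/

open RAM

/-- The variable is a dummy with value 0, present because `exists_reduction` expects exactly one. -/
instance : Ctx Circuit where
  word C := C.encode
  size C := C.size
  vars := 1
  slot _ _ := 0

namespace Circuit

theorem reads : Reads 0 (fun C : Circuit => C) :=
  ⟨fun C t => by rw [Nat.zero_add]; rfl, .self⟩

theorem compCNF_guessFormula : CompCNF fun C : Circuit => C.guessFormula.clauses :=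
  reads.compCNF_evalClauses.append reads.compCNF_guessClauses

theorem bdd_guessFormula : PolyBdd fun C : Circuit => C.guessFormula.size :=
  bdd_cnf_size (PolyLE.mul (.const 3) reads.bdd_length) compCNF_guessFormula

theorem compL_guessFormula : CompL fun C : Circuit => C.guessFormula.encodeWith C.guessVars := by
  refine compL_encodeWith (((reads.comp_length.add reads.comp_length).add
    reads.comp_length).congr fun C => ?_) compCNF_guessFormula ?_
    (reads.comp_numInputs.congr fun C => guessVars_length.symm)
  · change _ = 3 * C.gates.length
    omega
  · exact .flatMap reads.comp_length reads.bdd_length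
      (f := fun C i => if (C.gate i).tag = 0 then [2 * C.gates.length + i] else [])
      (.ite (reads.fst.compP_input .snd)
        (.singleton ((Reads.comp_two_mul reads.fst.comp_length).add .snd)) .nil)

end Circuit

/-! ### Reductions for weighted satisfiability -/

/-- A circuit together with a weight. -/
structure WeightedInst : Type where
  k : ℕ
  C : Circuit

namespace WeightedInst

/-- In contrast to `RegInst` and `HornInst`, the number `k` is read from the word, because a single
program has to serve all `k`. It is not counted in the size, so it is only used through `min k n` or
in comparisons. -/
instance : Ctx WeightedInst where
  word I := I.k :: I.C.encode
  size I := I.C.size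
  vars := 1
  slot _ _ := 0

theorem reads : Reads 1 (fun I : WeightedInst => I.C) :=
  ⟨fun C t => by rw [Nat.add_comm]; rfl, .self⟩

theorem comp_k : Comp fun I : WeightedInst => I.k := (Comp.const 0).get

theorem comp_min : Comp fun I : WeightedInst => min I.k I.C.numInputs :=
  comp_k.min reads.comp_numInputs

theorem bdd_min : PolyBdd fun I : WeightedInst => min I.k I.C.numInputs :=
  reads.bdd_numInputs.mono fun _ => min_le_right _ _

theorem compCNF_chooseFormula : CompCNF fun I : WeightedInst => (I.C.chooseFormula I.k).clauses :=
  reads.compCNF_evalClauses.append ((reads.compCNF_chooseClauses comp_min bdd_min).append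
    (.ite (.lt reads.comp_numInputs comp_k) (.cons_clause .nil .nil) .nil))

theorem bdd_chooseFormula : PolyBdd fun I : WeightedInst => (I.C.chooseFormula I.k).size :=
  bdd_cnf_size ((PolyLE.mul (.const 2) reads.bdd_length).add
    ((bdd_min.mul reads.bdd_width).add (bdd_min.mul reads.bdd_length))) compCNF_chooseFormula

theorem compL_chooseFormula : CompL fun I : WeightedInst =>
    (I.C.chooseFormula I.k).encodeWith (I.C.chooseVars (min I.k I.C.numInputs)) := by
  have hkL := comp_min.mul' reads.comp_width reads.bdd_width
  refine compL_encodeWith ((Reads.comp_two_mul reads.comp_length).add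
    (hkL.add (comp_min.mul' reads.comp_length reads.bdd_length))) compCNF_chooseFormula ?_
    (hkL.congr fun I => (Circuit.chooseVars_length _).symm)
  exact .map hkL (bdd_min.mul reads.bdd_width) (f := fun I t => 2 * I.C.gates.length + t)
    ((Reads.comp_two_mul reads.fst.comp_length).add .snd)

theorem encode_length (C : Circuit) : C.encode.length = 2 + (2 * C.gates.length + C.size) := by
  have : ∀ l : List Gate, (l.flatMap Gate.encode).length =
      2 * l.length + (l.map fun g => g.preds.length).sum := by
    intro l
    induction l with
    | nil => rfl
    | cons g l ih =>
      rw [List.flatMap_cons, List.length_append, Reads.gate_encode_length, ih, List.map_cons,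
        List.sum_cons, List.length_cons]
      omega
  rw [Circuit.encode, List.length_cons, List.length_cons, this, Circuit.size]
  omega

/-- The first letter is replaced and the rest of the word is copied letter by letter. -/
theorem compL_min : CompL fun I : WeightedInst => min I.k I.C.numInputs :: I.C.encode := by
  have hn : PolyBdd fun I : WeightedInst => (Ctx.word I).length - 1 :=
    ((PolyLE.const 2).add ((PolyLE.mul (.const 2) reads.bdd_length).add reads.bdd)).mono fun I => by
      change _ + 1 - 1 ≤ _
      rw [encode_length, Nat.add_sub_cancel]
  refine .cons comp_min ((CompL.map (Comp.wordLength.sub (.const 1)) hn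
    (f := fun I t => (Ctx.word I).getD (t + 1) 0) ((Comp.snd.add (.const 1)).get)).congr fun I => ?_)
  change (List.range I.C.encode.length).map (fun t => (I.k :: I.C.encode).getD (t + 1) 0) = _
  refine List.ext_getElem (by simp) fun t h1 h2 => ?_
  rw [List.getElem_map, List.getElem_range, List.getD_cons_succ, List.getD_eq_getElem]

end WeightedInst

open RAM

/-! ### Sizes of the register programs -/

namespace CNF

theorem length_roundCode_le (n : ℕ) (B : List ℕ) (cs : List Clause) :
    (roundCode n B cs).length ≤ 2 * (cs.length + (cs.map List.length).sum) := by
  rw [roundCode]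
  induction cs with
  | nil => simp
  | cons c cs ih =>
    simp only [List.flatMap_cons, List.length_append, bodyCode, headCode, List.length_cons,
      List.length_map, List.map_cons, List.sum_cons] at ih ⊢
    omega

theorem length_checkCode_le (n : ℕ) (B : List ℕ) (cs : List Clause) :
    (cs.flatMap (checkCode n B)).length ≤ 2 * (cs.length + (cs.map List.length).sum) := by
  induction cs with
  | nil => simp
  | cons c cs ih =>
    simp only [List.flatMap_cons, List.length_append, checkCode, List.length_cons,
      List.length_map, List.map_cons, List.sum_cons, List.length_nil] at ih ⊢
    omega

theorem length_flatMap_range {α : Type} (f : ℕ → List α) (m N : ℕ)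
    (h : ∀ i < m, (f i).length ≤ N) : ((List.range m).flatMap f).length ≤ m * N := by
  induction m with
  | zero => simp
  | succ m ih =>
    rw [List.range_succ, List.flatMap_append, List.length_append, Nat.add_one_mul]
    exact Nat.add_le_add (ih fun i hi => h i (by omega)) (by simpa using h m (by omega))

theorem length_hornCode_le (n : ℕ) (φ : CNF) (B : List ℕ) :
    (hornCode n φ B).length ≤ 2 * (φ.size + 1) ^ 2 := by
  have h1 := length_flatMap_range (fun _ => roundCode n B φ.clauses) φ.numVars _
    fun _ _ => length_roundCode_le n B φ.clauses
  have h2 := length_checkCode_le n B φ.clauses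
  have h3 : φ.clauses.length + (φ.clauses.map List.length).sum ≤ φ.size := by
    unfold CNF.size; omega
  have h4 : φ.numVars ≤ φ.size := by unfold CNF.size; omega
  rw [hornCode, List.length_append]
  calc _ ≤ φ.size * (2 * φ.size) + 2 * φ.size := Nat.add_le_add
        (h1.trans (Nat.mul_le_mul h4 (by omega))) (h2.trans (by omega))
    _ ≤ 2 * (φ.size + 1) ^ 2 := by nlinarith

theorem length_varCode_le {n V b N : ℕ} {blk : ℕ → List Instr}
    (h : ∀ j < b, (blk j).length ≤ N) : (varCode n V b blk).length ≤ V + b * N := by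
  rw [varCode, List.length_append, List.length_map, List.length_range]
  exact Nat.add_le_add_left (length_flatMap_range _ _ _ h) _

theorem length_negCode_le {φ : CNF} {B : List ℕ} (hB : B.length ≤ φ.numVars) :
    (negCode φ B).length ≤ 13 * (φ.size + 1) ^ 2 := by
  have h1 := length_hornCode_le (B.length + 1) φ B
  have h2 : (varCode (B.length + 1) φ.numVars B.length (negBlock (B.length + 1) B)).length ≤
      φ.numVars + B.length * 5 := length_varCode_le fun j _ => by simp [negBlock]
  have h3 : φ.numVars ≤ φ.size := by unfold CNF.size; omega
  rw [negCode, List.length_append, List.length_append]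
  simp only [List.length_cons, List.length_nil]
  nlinarith

/-- The dependence on the group size must be linear: the `k`-th power of the circuit size should
contribute `2 ^ b` and no larger exponential. -/
theorem length_groupCode_le {φ : CNF} {B : List ℕ} (hB : B.length ≤ φ.numVars) (k : ℕ) :
    (groupCode φ B k).length ≤ 11 * (groupSize B.length k * (k + 1) * (φ.size + 1) ^ 2) := by
  have hs : φ.numVars ≤ φ.size := by unfold CNF.size; omega
  have hD := two_le_groupSize B.length k
  have hlen : (groupCode φ B k).length = (groupPrelude (k * groupSize B.length k)).length +
      ((groupCheck (k * groupSize B.length k) (groupSize B.length k) k).length +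
      ((varCode (k * groupSize B.length k) φ.numVars B.length
        (groupBlock (k * groupSize B.length k) B k)).length +
      (hornCode (k * groupSize B.length k) φ B).length)) := by
    rw [groupCode, List.length_append, List.length_append, List.length_append]
  rw [hlen]
  have h0 := length_hornCode_le (k * groupSize B.length k) φ B
  have h1 : (varCode (k * groupSize B.length k) φ.numVars B.length
      (groupBlock (k * groupSize B.length k) B k)).length ≤
      φ.numVars + B.length * (groupSize B.length k + 2) :=
    length_varCode_le fun j _ => by simp [groupBlock]
  have h2 : (groupCheck (k * groupSize B.length k) (groupSize B.length k) k).length ≤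
      k * (groupSize B.length k + 2) := length_flatMap_range _ _ _ fun j _ => by simp
  have h3 : (groupPrelude (k * groupSize B.length k)).length =
      2 * (k * groupSize B.length k) + 1 := by
    simp [groupPrelude]; ring
  have h4 : B.length * (groupSize B.length k + 2) ≤ φ.size * (groupSize B.length k + 2) :=
    Nat.mul_le_mul_right _ (hB.trans hs)
  generalize groupSize B.length k = D at *
  generalize φ.size = s at *
  have hX : ∀ d ≤ D, ∀ a ≤ k + 1, ∀ u ≤ (s + 1) ^ 2, d * a * u ≤ D * (k + 1) * (s + 1) ^ 2 :=
    fun d hd a ha u hu => Nat.mul_le_mul (Nat.mul_le_mul hd ha) hu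
  have hu : s ≤ (s + 1) ^ 2 := by nlinarith
  have hu1 : 1 ≤ (s + 1) ^ 2 := Nat.one_le_pow _ _ (by omega)
  have x1 := hX D le_rfl k (by omega) 1 hu1
  have x2 := hX D le_rfl 1 (by omega) s hu
  have x3 := hX 2 hD 1 (by omega) ((s + 1) ^ 2) le_rfl
  have x4 := hX 2 hD k (by omega) 1 hu1
  have x5 := hX 1 (by omega) 1 (by omega) 1 hu1
  have x6 := hX 2 hD 1 (by omega) s hu
  have e1 : k * (D + 2) = D * k * 1 + 2 * k * 1 := by ring
  have e2 : s * (D + 2) = D * 1 * s + 2 * 1 * s := by ring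
  have e3 : 2 * (k * D) = 2 * (D * k * 1) := by ring
  rw [e1] at h2
  rw [e2] at h4
  rw [e3] at h3
  omega

end CNF

theorem RegInst.size_le (R : RegInst) : Ctx.size R ≤ R.prog.numVertices := by
  have := R.prog.W_pos
  simp only [Ctx.size, RegProg.numVertices]
  nlinarith

theorem CNF.numVertices_groupProg_le {φ : CNF} {B : List ℕ} (hB : φ.IsStrongHornBackdoor B)
    (hb : B.length ≤ φ.numVars) {k : ℕ} (hk : 0 < k) : (groupProg φ B hB k hk).numVertices ≤
      groupSize B.length k * (57 * (k + 1) * (φ.size + 1) ^ 3) := by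
  have h := length_groupCode_le hb k
  have hD := groupSize_pos B.length k
  have hs : φ.numVars ≤ φ.size := by unfold CNF.size; omega
  change k * groupSize B.length k + ((groupCode φ B k).length + 3) * (4 + 2 * φ.numVars) ≤ _
  generalize groupSize B.length k = D at *
  generalize φ.size = s at *
  have h1 : 1 ≤ D * (k + 1) * (s + 1) ^ 2 := Nat.mul_pos (by positivity) (by positivity)
  have h2 : k * D ≤ D * (k + 1) * (s + 1) ^ 3 := by
    calc k * D = D * k * 1 := by ring
      _ ≤ _ := Nat.mul_le_mul (Nat.mul_le_mul_left _ (by omega)) (Nat.one_le_pow _ _ (by omega))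
  calc _ ≤ D * (k + 1) * (s + 1) ^ 3 +
        (14 * (D * (k + 1) * (s + 1) ^ 2)) * (4 * (s + 1)) :=
        Nat.add_le_add h2 (Nat.mul_le_mul (by omega) (by omega))
    _ = _ := by ring

/-! ### Time bounds -/

theorem RAM.DecidesWithin.mono {P : Cmd} {w : List ℕ} {yes : Prop} {b b' : ℝ}
    (h : DecidesWithin P w yes b) (hb : b ≤ b') : DecidesWithin P w yes b' := by
  obtain ⟨t, σ, h1, h2, h3⟩ := h
  exact ⟨t, σ, h1, h2, h3.trans hb⟩

theorem PolyLE.exists_polynomial {X : Type} {m g : X → ℕ} (h : PolyLE m g) :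
    ∃ p : Polynomial ℕ, ∀ x, g x ≤ p.eval (m x) := by
  obtain ⟨c, e, h⟩ := h
  exact ⟨.C c * (.X + 1) ^ e, fun x => by simpa using h x⟩

/-- Absorbs the additive time of a reduction into the polynomial factor. This needs an exponential
factor of at least 1, so savings `ε` are first reduced to `min ε (1 / 2)`. -/
theorem mul_add_le_mul_add {a b x y : ℝ} (ha : 1 ≤ a) (hab : a ≤ b) (hx : 0 ≤ x) (hy : 0 ≤ y) :
    a * x + y ≤ b * (x + y) := by
  rw [mul_add]
  exact add_le_add (mul_le_mul_of_nonneg_right hab hx) (le_mul_of_one_le_left hy (ha.trans hab))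

theorem RegProg.numInputs_toCircuit (R : RegProg) : R.toCircuit.numInputs = R.n := by
  rw [Circuit.numInputs, R.toCircuit_inputs, Finset.card_range]

/-! ### The implications between the first three statements -/

/-- A formula with a strong Horn backdoor. -/
abbrev HornPair : Type := {q : CNF × List ℕ // q.1.IsStrongHornBackdoor q.2}

def HornPair.toInst (k : ℕ) (q : HornPair) : HornInst := ⟨q.1.1, q.1.2, q.2, k⟩

theorem HornBackdoorSETHFails.of_circuit {Δ : ℕ} (hΔ : 2 ≤ Δ) (h : CircuitSETHFails Δ) :
    HornBackdoorSETHFails := by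
  obtain ⟨ε, hε, hε2, P, p, hP⟩ := h
  obtain ⟨T₂, pT₂, h₂⟩ := exists_reduction rfl RegInst.compL_encode
  obtain ⟨Q₂, hQ₂⟩ := h₂ P 0
  obtain ⟨T₁, pT₁, h₁⟩ := exists_reduction rfl HornInst.compL_neg
  obtain ⟨Q₁, hQ₁⟩ := h₁ Q₂ 0
  let R : HornPair → RegInst := fun q => ⟨CNF.negProg q.1.1 q.1.2 q.2, 0⟩
  let m : HornPair → ℕ := fun q => q.1.1.size
  -- With group parameter 0 the groups have size 2, so the size of the context is linear in the size
  -- of the formula.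
  have bH : PolyLE m (fun q => Ctx.size (q.toInst 0)) :=
    (((PolyLE.self (m := m)).add (.const 1)).mul (.const 2)).mono fun q => by
      simp [Ctx.size, HornPair.toInst, CNF.groupSize, CNF.groupLen, m]
  have bR : PolyLE m (fun q => Ctx.size (R q)) := by
    have hs : PolyLE m fun q => 4 * (q.1.1.size + 1) :=
      PolyLE.mul (.const 4) ((PolyLE.self (m := m)).add (.const 1))
    refine (hs.add (hs.add (PolyLE.mul (.const 13)
      (((PolyLE.self (m := m)).add (.const 1)).pow 2)))).mono fun q => ?_
    have hb : q.1.2.length ≤ q.1.1.numVars := (q.toInst 0).length_le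
    have hv : q.1.1.numVars ≤ q.1.1.size := by unfold CNF.size; omega
    have := CNF.length_negCode_le hb
    change q.1.2.length + 1 + (4 + 2 * q.1.1.numVars) + (CNF.negCode q.1.1 q.1.2).length ≤
      _ + (_ + 13 * (q.1.1.size + 1) ^ 2)
    omega
  have bV : PolyLE m (fun q => (R q).prog.toCircuit.size) :=
    (bR.trans ((PolyLE.mul (.const 2) RegInst.bdd_numVertices).comp R)).mono
      fun q => (R q).prog.toCircuit_size_le
  obtain ⟨r, hr⟩ := ((PolyLE.mul (.const 2) (bV.eval p)).add
    ((bR.trans (pT₂.comp R)).add (bH.trans (pT₁.comp (HornPair.toInst 0))))).exists_polynomial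
  have hmin : 2 - ε ≤ 2 - min ε (1 / 2) := by linarith [min_le_left ε (1 / 2)]
  have hmin1 : 1 ≤ 2 - min ε (1 / 2) := by linarith [min_le_right ε (1 / 2)]
  refine ⟨min ε (1 / 2), by positivity, (min_le_left _ _).trans_lt hε2, Q₁, r, fun φ B hB => ?_⟩
  let q : HornPair := ⟨(φ, B), hB⟩
  have h := hP (R q).prog.toCircuit ((R q).prog.toCircuit_fanIn hΔ)
  rw [CNF.negProg_satisfiable] at h
  refine (hQ₁ (q.toInst 0) _ _ rfl (hQ₂ (R q) _ _ rfl h)).mono ?_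
  rw [RegProg.numInputs_toCircuit]
  change (2 - ε) ^ (B.length + 1) * _ + _ + _ ≤ _
  have hrq : _ ≤ ((r.eval φ.size : ℕ) : ℝ) := Nat.cast_le.2 (hr q)
  push_cast at hrq
  -- The unused input 0, needed to make constants, costs one factor of at most 2.
  have hpow : (2 - ε) ^ (B.length + 1) ≤ (2 - min ε (1 / 2)) ^ B.length * 2 := by
    rw [pow_succ]
    exact mul_le_mul (pow_le_pow_left₀ (by linarith) hmin _) (by linarith) (by linarith)
      (by positivity)
  calc _ ≤ (2 - min ε (1 / 2)) ^ B.length * 2 * ((p.eval (R q).prog.toCircuit.size : ℕ) : ℝ) +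
        T₂ (R q) + T₁ (q.toInst 0) := by gcongr
    _ = (2 - min ε (1 / 2)) ^ B.length * (2 * ((p.eval (R q).prog.toCircuit.size : ℕ) : ℝ)) +
        (T₂ (R q) + T₁ (q.toInst 0)) := by ring
    _ ≤ (2 - min ε (1 / 2)) ^ B.length * (2 * ((p.eval (R q).prog.toCircuit.size : ℕ) : ℝ) +
        (T₂ (R q) + T₁ (q.toInst 0))) :=
        mul_add_le_mul_add (one_le_pow₀ hmin1) le_rfl (by positivity) (by positivity)
    _ ≤ _ := by gcongr

theorem CircuitSETHFails.of_hornBackdoor (Δ : ℕ) (h : HornBackdoorSETHFails) :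
    CircuitSETHFails Δ := by
  obtain ⟨ε, hε, hε2, P, p, hP⟩ := h
  obtain ⟨T, pT, hT⟩ := exists_reduction rfl Circuit.compL_guessFormula
  obtain ⟨Q, hQ⟩ := hT P 0
  obtain ⟨r, hr⟩ := ((Circuit.bdd_guessFormula.eval p).add pT).exists_polynomial
  have hmin : 2 - ε ≤ 2 - min ε (1 / 2) := by linarith [min_le_left ε (1 / 2)]
  have hmin1 : 1 ≤ 2 - min ε (1 / 2) := by linarith [min_le_right ε (1 / 2)]
  refine ⟨min ε (1 / 2), by positivity, (min_le_left _ _).trans_lt hε2, Q, r, fun C _ => ?_⟩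
  have h := hP C.guessFormula C.guessVars Circuit.guessFormula_isBackdoor
  rw [Circuit.guessFormula_satisfiable, Circuit.guessVars_length] at h
  refine (hQ C _ _ rfl h).mono ?_
  have hrC : _ ≤ ((r.eval C.size : ℕ) : ℝ) := Nat.cast_le.2 (hr C)
  push_cast at hrC
  calc _ ≤ (2 - min ε (1 / 2)) ^ C.numInputs * ((p.eval C.guessFormula.size : ℕ) : ℝ) + T C := by
        gcongr
    _ ≤ (2 - min ε (1 / 2)) ^ C.numInputs * (((p.eval C.guessFormula.size : ℕ) : ℝ) + T C) :=
        mul_add_le_mul_add (one_le_pow₀ hmin1) le_rfl (by positivity) (by positivity)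
    _ ≤ _ := by gcongr

/-- Since `D = 2 ^ (⌊b / k⌋ + 1)`, the power `D ^ t` is at most `2 ^ t * 2 ^ (t * b / k)`, and `t ≤
β * k` bounds the second factor. The rounding costs only `2 ^ t`. -/
theorem CNF.groupSize_rpow_le {b k : ℕ} (hk : 0 < k) {t β : ℝ} (ht : 0 ≤ t) (h : t ≤ β * k) :
    (groupSize b k : ℝ) ^ t ≤ 2 ^ t * ((2 : ℝ) ^ β) ^ b := by
  have hk' : (0 : ℝ) < k := Nat.cast_pos.2 hk
  have h1 : ((b / k : ℕ) : ℝ) ≤ b / k := Nat.cast_div_le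
  have h2 : t * ((b / k : ℕ) : ℝ) ≤ β * b := by
    calc t * ((b / k : ℕ) : ℝ) ≤ t * (b / k) := mul_le_mul_of_nonneg_left h1 ht
      _ ≤ β * k * (b / k) := mul_le_mul_of_nonneg_right h (by positivity)
      _ = β * b := by field_simp
  rw [groupSize, groupLen]
  push_cast
  rw [← Real.rpow_natCast, ← Real.rpow_mul zero_le_two, ← Real.rpow_natCast, ← Real.rpow_mul
    zero_le_two, ← Real.rpow_add zero_lt_two]
  refine Real.rpow_le_rpow_of_exponent_le one_le_two ?_
  push_cast
  linarith

/-- The assumed algorithm takes about `D ^ ((1 - δ) * k)`, that is `(2 ^ (1 - δ)) ^ b` up to factors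
polynomial in the formula. So the new base is `2 ^ (1 - δ) < 2`, and `k` is a constant of the
resulting program. -/
theorem HornBackdoorSETHFails.of_weakWP {Δ : ℕ} (hΔ : 2 ≤ Δ) (h : WeakWPSETHFails Δ) :
    HornBackdoorSETHFails := by
  obtain ⟨ε, k₀, hε, hk₀, P, A, hP⟩ := h
  obtain ⟨T₂, ⟨c₂, e₂, hT₂⟩, h₂⟩ := exists_reduction rfl RegInst.compL_cons_encode
  obtain ⟨T₁, ⟨c₁, e₁, hT₁⟩, h₁⟩ := exists_reduction rfl HornInst.compL_group
  -- Beyond `k₀`, and at least twice each exponent of the two reductions. Then `D ^ e` is at most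
  -- about `2 ^ (b / 2)`, which is below the target because `δ ≤ 1 / 2`.
  set k := k₀ + 1 + 2 * (e₁ + e₂) with hkdef
  have hk : 0 < k := by omega
  obtain ⟨Q₂, hQ₂⟩ := h₂ P k
  obtain ⟨Q₁, hQ₁⟩ := h₁ Q₂ k
  let R : HornPair → RegInst := fun q => ⟨CNF.groupProg q.1.1 q.1.2 q.2 k hk, k⟩
  let m : HornPair → ℕ := fun q => q.1.1.size
  -- A common polynomial factor: all relevant sizes are at most `D * E q`. The constant is `2 * 57 +
  -- 2`, from twice the number of vertices plus one.
  let E : HornPair → ℕ := fun q => 116 * (k + 1) * (q.1.1.size + 1) ^ 3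
  have bE : PolyLE m E :=
    PolyLE.mul (.const (116 * (k + 1))) (((PolyLE.self (m := m)).add (.const 1)).pow 3)
  obtain ⟨r, hr⟩ := ((PolyLE.mul (.const (⌈A⌉₊ * 2 ^ k)) (bE.pow k)).add
    ((PolyLE.mul (.const (2 ^ e₂ * c₂)) (bE.pow e₂)).add
      (PolyLE.mul (.const (2 ^ e₁ * c₁)) (bE.pow e₁)))).exists_polynomial
  set δ := min ε (1 / 2) with hδ
  have hδ0 : 0 < δ := by positivity
  have hδ1 : δ ≤ 1 / 2 := min_le_right _ _
  have hδε : δ ≤ ε := min_le_left _ _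
  have ha1 : (1 : ℝ) ≤ 2 ^ (1 - δ) := Real.one_le_rpow one_le_two (by linarith)
  have ha2 : (2 : ℝ) ^ (1 - δ) < 2 := by
    conv_rhs => rw [← Real.rpow_one 2]
    exact Real.rpow_lt_rpow_of_exponent_lt one_lt_two (by linarith)
  refine ⟨2 - 2 ^ (1 - δ), by linarith, by linarith, Q₁, r, fun φ B hB => ?_⟩
  rw [sub_sub_cancel]
  let q : HornPair := ⟨(φ, B), hB⟩
  have h := hP k (by omega) (R q).prog.toCircuit ((R q).prog.toCircuit_fanIn hΔ)
    (RegProg.IsMonotone.toCircuit (CNF.groupProg_isMonotone hB k hk))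
  have hiff : (∃ x, (R q).prog.toCircuit.Accepts x ∧ (R q).prog.toCircuit.weight x ≤ k) ↔
      φ.Satisfiable := CNF.groupProg_satisfiable hB hk
  rw [hiff] at h
  refine (hQ₁ (q.toInst k) _ _ rfl (hQ₂ (R q) _ _ rfl h)).mono ?_
  have hrq : _ ≤ ((r.eval φ.size : ℕ) : ℝ) := Nat.cast_le.2 (hr q)
  push_cast at hrq
  refine le_trans ?_ (mul_le_mul_of_nonneg_left hrq (by positivity))
  set D := CNF.groupSize B.length k with hD
  have hD2 : 2 ≤ D := CNF.two_le_groupSize _ _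
  have hEpos : 1 ≤ E q := Nat.mul_pos (by positivity) (by positivity)
  have hV : 2 * (R q).prog.numVertices + 1 ≤ D * E q := by
    have h1 : (R q).prog.numVertices ≤ D * (57 * (k + 1) * (φ.size + 1) ^ 3) :=
      CNF.numVertices_groupProg_le hB (q.toInst k).length_le hk
    have h2 : 1 ≤ D * ((k + 1) * (φ.size + 1) ^ 3) := Nat.mul_pos (by omega) (by positivity)
    calc _ ≤ 2 * (D * (57 * (k + 1) * (φ.size + 1) ^ 3)) +
          2 * (D * ((k + 1) * (φ.size + 1) ^ 3)) := by omega
      _ = D * E q := by simp only [E, q]; ring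
  have hS : max (R q).prog.toCircuit.size 1 ≤ D * E q := by
    have := (R q).prog.toCircuit_size_le
    omega
  have hR : Ctx.size (R q) + 1 ≤ D * E q := by
    have := (R q).size_le
    omega
  have hH : Ctx.size (q.toInst k) + 1 ≤ D * E q := by
    change (φ.size + 1) * D * (k + 1) + 1 ≤ D * (116 * (k + 1) * (φ.size + 1) ^ 3)
    have h1 : 1 ≤ (φ.size + 1) * D * (k + 1) := Nat.mul_pos (Nat.mul_pos (by omega) (by omega))
      (by omega)
    calc (φ.size + 1) * D * (k + 1) + 1 ≤ D * (116 * (k + 1) * (φ.size + 1) ^ 1) := by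
          rw [pow_one]; linarith
      _ ≤ _ := by gcongr <;> omega
  have hpow : ∀ {T c e : ℕ}, 2 * e ≤ k → T ≤ c * (D * E q) ^ e →
      (T : ℝ) ≤ ((2 : ℝ) ^ (1 - δ)) ^ B.length * (2 ^ e * c * (E q : ℝ) ^ e) := by
    intro T c e he hT
    have h1 : (D : ℝ) ^ (e : ℝ) ≤ 2 ^ (e : ℝ) * ((2 : ℝ) ^ (1 - δ)) ^ B.length := by
      refine CNF.groupSize_rpow_le hk (by positivity) ?_
      have : (2 : ℝ) * e ≤ k := by exact_mod_cast he
      nlinarith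
    rw [Real.rpow_natCast, Real.rpow_natCast] at h1
    calc (T : ℝ) ≤ c * ((D : ℝ) * E q) ^ e := by exact_mod_cast hT
      _ = c * (E q : ℝ) ^ e * (D : ℝ) ^ e := by rw [mul_pow]; ring
      _ ≤ c * (E q : ℝ) ^ e * (2 ^ e * ((2 : ℝ) ^ (1 - δ)) ^ B.length) := by gcongr
      _ = _ := by ring
  have t₂ := hpow (by omega) ((hT₂ (R q)).trans
    (Nat.mul_le_mul_left _ (Nat.pow_le_pow_left hR e₂)))
  have t₁ := hpow (by omega) ((hT₁ (q.toInst k)).trans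
    (Nat.mul_le_mul_left _ (Nat.pow_le_pow_left hH e₁)))
  have t₀ : A * ((max (R q).prog.toCircuit.size 1 : ℕ) : ℝ) ^ ((1 - ε) * (k : ℝ)) ≤
      ((2 : ℝ) ^ (1 - δ)) ^ B.length * (⌈A⌉₊ * 2 ^ k * (E q : ℝ) ^ k) := by
    have hS1 : (1 : ℝ) ≤ ((max (R q).prog.toCircuit.size 1 : ℕ) : ℝ) :=
      Nat.one_le_cast.2 (le_max_right _ _)
    have hk' : (0 : ℝ) < k := Nat.cast_pos.2 hk
    have hβ : 0 ≤ (1 - δ) * k := mul_nonneg (by linarith) hk'.le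
    have hβk : (1 - δ) * k ≤ k := by nlinarith
    -- The constant `A` may be negative, hence its natural ceiling.
    calc _ ≤ ⌈A⌉₊ * ((max (R q).prog.toCircuit.size 1 : ℕ) : ℝ) ^ ((1 - δ) * (k : ℝ)) := by
          refine mul_le_mul (Nat.le_ceil A) (Real.rpow_le_rpow_of_exponent_le hS1 ?_)
            (by positivity) (by positivity)
          exact mul_le_mul_of_nonneg_right (by linarith) hk'.le
      _ ≤ ⌈A⌉₊ * ((D : ℝ) * E q) ^ ((1 - δ) * (k : ℝ)) := by
          refine mul_le_mul_of_nonneg_left (Real.rpow_le_rpow (by positivity) ?_ hβ) (by positivity)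
          exact_mod_cast hS
      _ = ⌈A⌉₊ * ((D : ℝ) ^ ((1 - δ) * (k : ℝ)) * (E q : ℝ) ^ ((1 - δ) * (k : ℝ))) := by
          rw [Real.mul_rpow (by positivity) (by positivity)]
      _ ≤ ⌈A⌉₊ * ((2 ^ k * ((2 : ℝ) ^ (1 - δ)) ^ B.length) * (E q : ℝ) ^ k) := by
          refine mul_le_mul_of_nonneg_left (mul_le_mul ?_ ?_ (by positivity) (by positivity))
            (by positivity)
          · refine (CNF.groupSize_rpow_le hk hβ le_rfl).trans
              (mul_le_mul_of_nonneg_right ?_ (by positivity))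
            rw [← Real.rpow_natCast]
            exact Real.rpow_le_rpow_of_exponent_le one_le_two hβk
          · rw [← Real.rpow_natCast]
            exact Real.rpow_le_rpow_of_exponent_le (Nat.one_le_cast.2 hEpos) hβk
      _ = _ := by ring
  rw [mul_add, mul_add, ← add_assoc]
  exact add_le_add (add_le_add t₀ t₂) t₁

open RAM

/-! ### Weighted satisfiability -/

theorem Circuit.IsMonotone.accepts {C : Circuit} (hC : C.IsMonotone) {x y : ℕ → Bool}
    (hxy : ∀ i ∈ C.inputs, x i = true → y i = true) (hx : C.Accepts x) : C.Accepts y := by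
  obtain ⟨v, hv, hout⟩ := hx
  obtain ⟨w, hw⟩ := C.exists_isValuation y
  have key : ∀ i, i < C.gates.length → v i = true → w i = true := by
    intro i
    induction i using C.wellFounded_arc.induction with
    | _ i ih =>
      intro hi hvi
      have hg := C.getElem?_gate hi
      have h1 := hv i _ hg
      have h2 := hw i _ hg
      have ih' : ∀ j ∈ (C.gate i).preds, v j = true → w j = true := fun j hj =>
        ih j ⟨_, hg, hj⟩ (C.mem_preds_lt hi hj)
      cases hgi : C.gate i with
      | input =>
        rw [hgi] at h1 h2
        rw [h2]
        exact hxy i (C.mem_inputs.2 ⟨hi, by rw [hgi]; rfl⟩) (h1 ▸ hvi)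
      | not j => exact absurd hgi (hC _ (List.mem_of_getElem? hg) j)
      | and l =>
        rw [hgi] at h1 h2 ih'
        rw [h2, List.all_eq_true]
        rw [h1, List.all_eq_true] at hvi
        exact fun j hj => ih' j hj (hvi j hj)
      | or l =>
        rw [hgi] at h1 h2 ih'
        rw [h2, List.any_eq_true]
        rw [h1, List.any_eq_true] at hvi
        obtain ⟨j, hj, h⟩ := hvi
        exact ⟨j, hj, ih' j hj h⟩
  exact ⟨w, hw, key _ C.out_lt hout⟩

/-- An accepted set of True inputs can be enlarged to any size up to `n` without losing acceptance.
-/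
theorem Circuit.IsMonotone.exists_weight_eq_iff {C : Circuit} (hC : C.IsMonotone) (k : ℕ) :
    (∃ x, C.Accepts x ∧ C.weight x = min k C.numInputs) ↔
      ∃ x, C.Accepts x ∧ C.weight x ≤ k := by
  constructor
  · rintro ⟨x, hx, h⟩
    exact ⟨x, hx, h.le.trans (min_le_left _ _)⟩
  · rintro ⟨x, hx, h⟩
    obtain ⟨S, hS1, hS2, hS⟩ := Finset.exists_subsuperset_card_eq
      (Finset.filter_subset (fun i => x i = true) C.inputs)
      (le_min h (Circuit.weight_le x)) (min_le_right k C.numInputs)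
    refine ⟨fun i => decide (i ∈ S), hC.accepts (fun i hi hxi => ?_) hx, ?_⟩
    · exact decide_eq_true (hS1 (Finset.mem_filter.2 ⟨hi, hxi⟩))
    · rw [← hS, Circuit.weight]
      congr 1
      ext i
      simpa using fun h => hS2 h

theorem WeakWPSETHFails.of_strongWP {Δ : ℕ} (h : StrongWPSETHFails Δ) : WeakWPSETHFails Δ := by
  obtain ⟨ε, hε, P, p, hP⟩ := h
  obtain ⟨T, pT, hT⟩ := exists_reduction rfl WeightedInst.compL_min
  obtain ⟨Q, hQ⟩ := hT P 0
  obtain ⟨c, e, hce⟩ := (WeightedInst.reads.bdd.eval p).add pT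
  set δ := min ε (1 / 2) with hδ
  have hδ0 : 0 < δ := by positivity
  have hδ1 : δ ≤ 1 / 2 := min_le_right _ _
  have hδε : δ ≤ ε := min_le_left _ _
  -- Half of the saving is given up: for `k` above this threshold `e ≤ (δ / 2) * k`, which pays for
  -- the polynomial factor of degree `e`. The factor `2 ^ e` comes from `s + 1 ≤ 2 * max s 1`.
  refine ⟨δ / 2, ⌈2 * e / δ⌉₊ + 1, by positivity, by omega, Q, c * 2 ^ e,
    fun k hk C hC hmon => ?_⟩
  have h := hP (min k C.numInputs) C hC
  rw [hmon.exists_weight_eq_iff] at h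
  refine (hQ ⟨k, C⟩ _ _ rfl h).mono ?_
  have hS : Ctx.size (⟨k, C⟩ : WeightedInst) + 1 ≤ 2 * max C.size 1 := by
    change C.size + 1 ≤ _
    omega
  have hpT : ((p.eval C.size : ℕ) : ℝ) + T ⟨k, C⟩ ≤ c * (2 * ((max C.size 1 : ℕ) : ℝ)) ^ e := by
    exact_mod_cast (hce ⟨k, C⟩).trans (Nat.mul_le_mul_left _ (Nat.pow_le_pow_left hS e))
  have hn : ((C.numInputs : ℕ) : ℝ) ≤ ((max C.size 1 : ℕ) : ℝ) :=
    Nat.cast_le.2 C.numInputs_le_size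
  have hn1 : (1 : ℝ) ≤ C.numInputs := Nat.one_le_cast.2 C.numInputs_pos
  set S : ℝ := ((max C.size 1 : ℕ) : ℝ) with hSdef
  have hS1 : 1 ≤ S := hn1.trans hn
  have hmk : ((min k C.numInputs : ℕ) : ℝ) ≤ k := Nat.cast_le.2 (min_le_left _ _)
  have hek : (e : ℝ) ≤ δ / 2 * k := by
    have h1 : 2 * e / δ ≤ (k : ℝ) := (Nat.le_ceil _).trans (Nat.cast_le.2 (by omega))
    rw [div_le_iff₀ hδ0] at h1
    linarith
  have hb : (C.numInputs : ℝ) ^ ((1 - ε) * ((min k C.numInputs : ℕ) : ℝ)) ≤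
      S ^ ((1 - δ) * (k : ℝ)) := by
    calc _ ≤ (C.numInputs : ℝ) ^ ((1 - δ) * (k : ℝ)) := by
          refine Real.rpow_le_rpow_of_exponent_le hn1 ?_
          exact (mul_le_mul_of_nonneg_right (by linarith) (Nat.cast_nonneg _)).trans
            (mul_le_mul_of_nonneg_left hmk (by linarith))
      _ ≤ _ := Real.rpow_le_rpow (by positivity) hn
          (mul_nonneg (by linarith) (Nat.cast_nonneg _))
  have hb1 : 1 ≤ S ^ ((1 - δ) * (k : ℝ)) :=
    Real.one_le_rpow hS1 (mul_nonneg (by linarith) (Nat.cast_nonneg _))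
  calc _ ≤ S ^ ((1 - δ) * (k : ℝ)) * ((p.eval C.size : ℕ) : ℝ) + T ⟨k, C⟩ :=
        add_le_add_left (mul_le_mul_of_nonneg_right hb (by positivity)) _
    _ ≤ S ^ ((1 - δ) * (k : ℝ)) * (((p.eval C.size : ℕ) : ℝ) + T ⟨k, C⟩) :=
        mul_add_le_mul_add hb1 le_rfl (by positivity) (by positivity)
    _ ≤ S ^ ((1 - δ) * (k : ℝ)) * (c * (2 * S) ^ e) :=
        mul_le_mul_of_nonneg_left hpT (by positivity)
    _ = c * 2 ^ e * (S ^ ((1 - δ) * (k : ℝ)) * S ^ (e : ℝ)) := by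
        rw [Real.rpow_natCast, mul_pow]; ring
    _ = c * 2 ^ e * S ^ ((1 - δ) * (k : ℝ) + e) := by rw [Real.rpow_add (by linarith)]
    _ ≤ _ := by
        refine mul_le_mul_of_nonneg_left (Real.rpow_le_rpow_of_exponent_le hS1 ?_) (by positivity)
        linarith

/-- Guessing an input bit by bit is cheaper than trying all inputs. -/
theorem exists_pow_clog_le {a : ℝ} (ha : 1 < a) (ha2 : a < 2) : ∃ (δ : ℝ) (K : ℕ), 0 < δ ∧ δ < 1 ∧
    ∀ n m : ℕ, 1 ≤ n → m ≤ n →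
      a ^ (m * Nat.clog 2 n) ≤ K * (n : ℝ) ^ ((1 - δ) * (m : ℝ)) := by
  -- Without rounding, `a ^ log₂ n` would be `n ^ α`. Half of the gap `1 - α` is kept as the saving
  -- `δ`; the other half pays for the factor `a` that is lost by rounding the logarithm up.
  set α := Real.logb 2 a with hα
  have ha0 : 0 < a := by linarith
  have haα : (2 : ℝ) ^ α = a := Real.rpow_logb two_pos (by norm_num) ha0
  have hα0 : 0 < α := Real.logb_pos one_lt_two ha
  have hα1 : α < 1 := by
    rw [hα, Real.logb_lt_iff_lt_rpow one_lt_two ha0, Real.rpow_one]; exact ha2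
  set δ := (1 - α) / 2 with hδ
  have hδ0 : 0 < δ := by rw [hδ]; linarith
  -- From `n₀` on, `a ≤ n ^ δ`. Below it, `m ≤ n < n₀` and `clog 2 n ≤ n` bound the whole left side
  -- by a constant.
  set n₀ := ⌈a ^ (1 / δ)⌉₊ with hn₀
  refine ⟨δ, ⌈a ^ (n₀ * n₀)⌉₊ + 1, hδ0, by rw [hδ]; linarith, fun n m hn hm => ?_⟩
  have hn' : (1 : ℝ) ≤ n := Nat.one_le_cast.2 hn
  have hexp : 0 ≤ (1 - δ) * (m : ℝ) :=
    mul_nonneg (by rw [hδ]; linarith) (Nat.cast_nonneg _)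
  have hr1 : 1 ≤ (n : ℝ) ^ ((1 - δ) * (m : ℝ)) := Real.one_le_rpow hn' hexp
  have hL : 2 ^ Nat.clog 2 n ≤ 2 * n := by
    rcases Nat.eq_zero_or_pos (Nat.clog 2 n) with h | h
    · rw [h]; omega
    · obtain ⟨l, hl⟩ := Nat.exists_eq_add_of_le' h
      have := Nat.pow_lt_of_lt_clog (b := 2) (x := n) (y := l) (by omega)
      rw [hl, pow_succ]
      omega
  rcases Nat.lt_or_ge n n₀ with hlt | hge
  · have hLn : Nat.clog 2 n ≤ n := by
      by_contra! h
      exact absurd (Nat.pow_lt_of_lt_clog h) (Nat.lt_two_pow_self).not_gt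
    calc a ^ (m * Nat.clog 2 n) ≤ a ^ (n₀ * n₀) :=
          pow_le_pow_right₀ ha.le (Nat.mul_le_mul (by omega) (by omega))
      _ ≤ ((⌈a ^ (n₀ * n₀)⌉₊ + 1 : ℕ) : ℝ) * 1 := by
          push_cast
          linarith [Nat.le_ceil (a ^ (n₀ * n₀))]
      _ ≤ _ := mul_le_mul_of_nonneg_left hr1 (by positivity)
  · have han : a ≤ (n : ℝ) ^ δ := by
      calc a = (a ^ (1 / δ)) ^ δ := by
            rw [← Real.rpow_mul ha0.le, one_div, inv_mul_cancel₀ hδ0.ne', Real.rpow_one]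
        _ ≤ (n : ℝ) ^ δ := Real.rpow_le_rpow (by positivity)
            ((Nat.le_ceil _).trans (Nat.cast_le.2 hge)) hδ0.le
    have h1 : a ^ Nat.clog 2 n ≤ (n : ℝ) ^ (1 - δ) := by
      calc a ^ Nat.clog 2 n = ((2 : ℝ) ^ Nat.clog 2 n) ^ α := by
            rw [← Real.rpow_natCast 2, ← Real.rpow_mul two_pos.le, mul_comm, Real.rpow_mul
              two_pos.le, haα, Real.rpow_natCast]
        _ ≤ (2 * (n : ℝ)) ^ α :=
            Real.rpow_le_rpow (by positivity) (by exact_mod_cast hL) hα0.le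
        _ = a * (n : ℝ) ^ α := by rw [Real.mul_rpow two_pos.le (by positivity), haα]
        _ ≤ (n : ℝ) ^ δ * (n : ℝ) ^ α := mul_le_mul_of_nonneg_right han (by positivity)
        _ = (n : ℝ) ^ (1 - δ) := by
            rw [← Real.rpow_add (by linarith)]
            congr 1
            rw [hδ]; ring
    calc a ^ (m * Nat.clog 2 n) = (a ^ Nat.clog 2 n) ^ m := by rw [← pow_mul, mul_comm]
      _ ≤ ((n : ℝ) ^ (1 - δ)) ^ m := pow_le_pow_left₀ (by positivity) h1 m
      _ = (n : ℝ) ^ ((1 - δ) * (m : ℝ)) := by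
          rw [Real.rpow_mul (by linarith), Real.rpow_natCast]
      _ ≤ _ := le_mul_of_one_le_left (by positivity) (Nat.one_le_cast.2 (Nat.succ_pos _))

/-- The backdoor has `min k n * ⌈log₂ n⌉` variables. The minimum supplies the condition `m ≤ n` of
`exists_pow_clog_le` and keeps the formula polynomial in the circuit for arbitrarily large `k`. -/
theorem StrongWPSETHFails.of_hornBackdoor (Δ : ℕ) (h : HornBackdoorSETHFails) :
    StrongWPSETHFails Δ := by
  obtain ⟨ε, hε, hε2, P, p, hP⟩ := h
  have hmin : 2 - ε ≤ 2 - min ε (1 / 2) := by linarith [min_le_left ε (1 / 2)]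
  have hmin1 : 1 < 2 - min ε (1 / 2) := by linarith [min_le_right ε (1 / 2)]
  have hmin2 : 2 - min ε (1 / 2) < 2 := by linarith [lt_min hε (by norm_num : (0 : ℝ) < 1 / 2)]
  obtain ⟨δ, K, hδ, hδ1, hK⟩ := exists_pow_clog_le hmin1 hmin2
  obtain ⟨T, pT, hT⟩ := exists_reduction rfl WeightedInst.compL_chooseFormula
  obtain ⟨Q, hQ⟩ := hT P 0
  obtain ⟨r, hr⟩ := ((PolyLE.mul (.const K)
    (WeightedInst.bdd_chooseFormula.eval p)).add pT).exists_polynomial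
  refine ⟨δ, hδ, Q, r, fun k C _ => ?_⟩
  have h := hP (C.chooseFormula k) _ (Circuit.chooseFormula_isBackdoor k)
  rw [Circuit.chooseFormula_satisfiable, Circuit.chooseVars_length] at h
  refine (hQ ⟨k, C⟩ _ _ rfl h).mono ?_
  have hrC : _ ≤ ((r.eval C.size : ℕ) : ℝ) := Nat.cast_le.2 (hr ⟨k, C⟩)
  push_cast at hrC
  have hn1 : (1 : ℝ) ≤ C.numInputs := Nat.one_le_cast.2 C.numInputs_pos
  have hb : (2 - ε) ^ (min k C.numInputs * C.width) ≤
      (C.numInputs : ℝ) ^ ((1 - δ) * (k : ℝ)) * K := by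
    calc _ ≤ (2 - min ε (1 / 2)) ^ (min k C.numInputs * C.width) :=
          pow_le_pow_left₀ (by linarith) hmin _
      _ ≤ K * (C.numInputs : ℝ) ^ ((1 - δ) * ((min k C.numInputs : ℕ) : ℝ)) :=
          hK _ _ C.numInputs_pos (min_le_right _ _)
      _ ≤ K * (C.numInputs : ℝ) ^ ((1 - δ) * (k : ℝ)) := by
          refine mul_le_mul_of_nonneg_left (Real.rpow_le_rpow_of_exponent_le hn1
            (mul_le_mul_of_nonneg_left (Nat.cast_le.2 (min_le_left _ _)) (by linarith)))
            (by positivity)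
      _ = _ := mul_comm _ _
  have hb1 : 1 ≤ (C.numInputs : ℝ) ^ ((1 - δ) * (k : ℝ)) :=
    Real.one_le_rpow hn1 (mul_nonneg (by linarith) (Nat.cast_nonneg _))
  calc _ ≤ (C.numInputs : ℝ) ^ ((1 - δ) * (k : ℝ)) * K *
        ((p.eval (C.chooseFormula k).size : ℕ) : ℝ) + T ⟨k, C⟩ :=
        add_le_add_left (mul_le_mul_of_nonneg_right hb (by positivity)) _
    _ = (C.numInputs : ℝ) ^ ((1 - δ) * (k : ℝ)) *
        (K * ((p.eval (C.chooseFormula k).size : ℕ) : ℝ)) + T ⟨k, C⟩ := by ring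
    _ ≤ (C.numInputs : ℝ) ^ ((1 - δ) * (k : ℝ)) *
        (K * ((p.eval (C.chooseFormula k).size : ℕ) : ℝ) + T ⟨k, C⟩) :=
        mul_add_le_mul_add hb1 le_rfl (by positivity) (by positivity)
    _ ≤ _ := mul_le_mul_of_nonneg_left hrC (by positivity)

theorem mainTheorem3 (Δ : ℕ) (hΔ : 2 ≤ Δ) :
    List.TFAE [CircuitSETHFails Δ, HornBackdoorSETHFails, WeakWPSETHFails Δ,
      StrongWPSETHFails Δ] := by
  tfae_have 1 → 2 := HornBackdoorSETHFails.of_circuit hΔ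
  tfae_have 2 → 1 := CircuitSETHFails.of_hornBackdoor Δ
  tfae_have 2 → 4 := StrongWPSETHFails.of_hornBackdoor Δ
  tfae_have 4 → 3 := WeakWPSETHFails.of_strongWP
  tfae_have 3 → 2 := HornBackdoorSETHFails.of_weakWP hΔ
  tfae_finish
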